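/- **Setting.** A ranking of $[m]$ is a permutation $\pi$ ($\pi(j)$ is the position of item $j$). A dataset is $\Pi=(\pi_1,\dots,\pi_n)\in(\mathbb S_m)^n$ with $n,m\ge 1$; two datasets are neighbouring if they differ in at most one ranking. Let $K(\pi,\pi')$ be the number of pairs $(i,j)$ with $\pi(i)<\pi(j)$ and $\pi'(i)>\pi'(j)$, $\bar K(\sigma,\Pi)=\frac1n\sum_k K(\sigma,\pi_k)$, $\mathrm{OPT}(\Pi)=\min_\sigma\bar K(\sigma,\Pi)$, and $w^\Pi_{ij}=\frac1n|\{k:\pi_k(i)<\pi_k(j)\}|$. For a matrix $w$ satisfying the probability constraint ($w_{ij}\ge0$ and $w_{ij}+w_{ji}=1$ for $i\ne j$), let $\bar K(\sigma,w)=\sum_{i,j:\,\sigma(i)<\sigma(j)}w_{ji}$ and $\mathrm{OPT}(w)=\min_\sigma \bar K(\sigma,w)$. Algorithms are single programs, working for all $n,m$, of a randomized real RAM: exact real arithmetic (including $\exp,\log,\sqrt{\cdot}$) and comparisons, natural-number registers with addition, subtraction and comparison, arrays, rational constants, and independent uniform, standard Laplace and standard Gaussian draws, all at unit cost. "Polynomial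 time" means that the number of steps is at most a fixed polynomial in $n+m$ on every input and for all values of the draws. **Theorem.** For every $\alpha>0$ there is a constant $C=C(\alpha)>0$ such that the following holds. Let $q=q(n,m)\in\mathbb N$, $e=e(n,m)>0$, $\epsilon=\epsilon(n,m)>0$ and $\zeta=\zeta(n,m),\ \delta=\delta(n,m)\in[0,1]$ be arbitrary parameters. Suppose that: 1. $\mathcal A$ is a polynomial-time (not necessarily private) randomized ranking algorithm that is given $n,m$ and accesses its input matrix $w$ only by queries $(i,j)\mapsto w_{ij}$. For all $n,m\ge1$ and every $w$ satisfying the probability constraint, its output $\sigma$ satisfies $\mathbb E[\bar K(\sigma,w)]\le\alpha\cdot\mathrm{OPT}(w)$, and with probability at least $1-\zeta/m^4$ it makes at most $q$ queries. 2. $\mathcal Q$ is a polynomial-time randomized algorithm that, given $\Pi$ and the parameters $n,m,q,\epsilon,\delta$, computes (non-adaptively) a real number $\tilde w_{ij}$ for all $i\neq j$, with $\mathbb E|\tilde w_{ij}-w^\Pi_{ij}|\le e$ for all $i\ne j$. It is $(\epsilon/2,\delta)$-differentially private for $q$ adaptive queries: for every measurable strategy that chooses each next pair from the previous answers, all neighbouring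 $\Pi,\Pi'$ and every measurable set $U\subseteq\mathbb R^q$, the vector $a$ of the $q$ answers (entries of $\tilde w$) revealed to the strategy satisfies $\Pr_\Pi[a\in U]\le e^{\epsilon/2}\Pr_{\Pi'}[a\in U]+\delta$. Then there is a polynomial-time randomized algorithm $\mathcal B$ that, given $\Pi$ and the parameters $n,m,q,\epsilon,\delta$, always outputs a ranking of $[m]$, such that for all $n,m\ge1$: - $\mathcal B$ is $(\epsilon,\delta)$-differentially private: $\Pr[\mathcal B(\Pi)\in S]\le e^{\epsilon}\Pr[\mathcal B(\Pi')\in S]+\delta$ for all neighbouring $\Pi,\Pi'$ and all $S\subseteq\mathbb S_m$; - $\mathcal B$ is an $(\alpha+\zeta,\beta)$-approximation with $\beta=C\left(m^2e+\frac1{\epsilon n}\right)$: for every $\Pi$, $\mathbb E[\bar K(\mathcal B(\Pi),\Pi)]\le(\alpha+\zeta)\,\mathrm{OPT}(\Pi)+C\left(m^2e+\frac1{\epsilon n}\right)$. -/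

import Mathlib

open MeasureTheory ProbabilityTheory
open scoped ENNReal

namespace RankAgg

/-! ## Rank aggregation -/

/-- A ranking of the items `0, …, m - 1`; `π j` is the position of item `j`, lower is better. -/
abbrev Ranking (m : ℕ) := Equiv.Perm (Fin m)

/-- An input of `n` users: one ranking per user. -/
abbrev Dataset (n m : ℕ) := Fin n → Ranking m

/-- The Kendall tau distance: the number of pairwise disagreements. -/
def kendallTau {m : ℕ} (π₁ π₂ : Ranking m) : ℕ :=
  (Finset.univ.filter
    (fun p : Fin m × Fin m => π₁ p.1 < π₁ p.2 ∧ π₂ p.2 < π₂ p.1)).card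

/-- The Kemeny score: the average Kendall tau distance to the input rankings. -/
noncomputable def kemeny {n m : ℕ} (σ : Ranking m) (D : Dataset n m) : ℝ :=
  (∑ k, (kendallTau σ (D k) : ℝ)) / n

/-- The optimal Kemeny score (a minimum over the finite nonempty set of rankings). -/
noncomputable def opt {n m : ℕ} (D : Dataset n m) : ℝ := ⨅ σ : Ranking m, kemeny σ D

/-- `pairWeight D i j` is the fraction of users that rank item `i` before item `j`. -/
noncomputable def pairWeight {n m : ℕ} (D : Dataset n m) (i j : Fin m) : ℝ :=
  ((Finset.univ.filter (fun k => D k i < D k j)).card : ℝ) / n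

/-- The probability constraint on a weight matrix (the diagonal is irrelevant). -/
def ProbConstraint {m : ℕ} (w : Fin m → Fin m → ℝ) : Prop :=
  ∀ i j, i ≠ j → 0 ≤ w i j ∧ w i j + w j i = 1

/-- The cost of a ranking with respect to a weight matrix. -/
noncomputable def weightedCost {m : ℕ} (σ : Ranking m) (w : Fin m → Fin m → ℝ) : ℝ :=
  ∑ i, ∑ j, if σ i < σ j then w j i else 0

/-- The optimal cost with respect to a weight matrix. -/
noncomputable def weightedOpt {m : ℕ} (w : Fin m → Fin m → ℝ) : ℝ :=
  ⨅ σ : Ranking m, weightedCost σ w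

/-- Neighbouring datasets: they agree except possibly for one user. -/
def Neighbors {n m : ℕ} (D D' : Dataset n m) : Prop :=
  ∃ k, ∀ k', k' ≠ k → D k' = D' k'

/-! ## Randomness -/

/-- The standard distributions from which a machine can draw. -/
inductive Source
  | uniform
  | laplace
  | gaussian

/-- The Laplace distribution with mean `0` and scale `1`. -/
noncomputable def stdLaplace : Measure ℝ :=
  volume.withDensity (fun x => ENNReal.ofReal (Real.exp (-|x|) / 2))

instance stdLaplace_isProbabilityMeasure : IsProbabilityMeasure stdLaplace := by
  have hint : ∫ x : ℝ, Real.exp (-|x|) / 2 = 1 := by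
    rw [integral_comp_abs (f := fun x => Real.exp (-x) / 2), integral_div,
      integral_exp_neg_Ioi_zero]
    norm_num
  have hI : Integrable (fun x : ℝ => Real.exp (-|x|) / 2) := by
    by_contra h
    rw [integral_undef h] at hint
    exact zero_ne_one hint
  refine ⟨?_⟩
  rw [stdLaplace, withDensity_apply _ MeasurableSet.univ, Measure.restrict_univ,
    ← ofReal_integral_eq_lintegral_ofReal hI (Filter.Eventually.of_forall fun x => by positivity),
    hint, ENNReal.ofReal_one]

/-- The law of one draw: uniform on `[0, 1]`, standard Laplace, or standard Gaussian. -/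
noncomputable def Source.law : Source → Measure ℝ
  | .uniform => volume.restrict (Set.Icc 0 1)
  | .laplace => stdLaplace
  | .gaussian => gaussianReal 0 1

instance Source.law_isProbabilityMeasure (s : Source) : IsProbabilityMeasure s.law := by
  cases s
  · exact ⟨by simp [Source.law]⟩
  · exact stdLaplace_isProbabilityMeasure
  · exact inferInstanceAs (IsProbabilityMeasure (gaussianReal 0 1))

/-- The random tape: `ω (s, a, i)` is draw number `i` of stream `a` from source `s`. -/
abbrev Tape := Source × ℕ × ℕ → ℝ

/-- All draws on the tape are independent, each with the law of its source. -/
noncomputable def tapeLaw : Measure Tape :=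
  Measure.infinitePi (fun k : Source × ℕ × ℕ => k.1.law)

/-- The value a machine reads from the tape.  Uniform draws are clipped to `[0, 1]`, which changes
nothing almost surely, so that worst-case statements do not range over impossible draws. -/
noncomputable def Tape.read (ω : Tape) : Source → ℕ → ℕ → ℝ
  | .uniform, a, i => max 0 (min 1 (ω (.uniform, a, i)))
  | .laplace, a, i => ω (.laplace, a, i)
  | .gaussian, a, i => ω (.gaussian, a, i)

/-! ## The machine model: randomized real-RAM programs with oracle queries and a step count

The memory consists of two-dimensional arrays of natural numbers and of real numbers.  Natural
numbers (used for indices and counters) can only be added, subtracted and compared, so that their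
bit lengths grow at most linearly with the number of steps; reals cannot be converted to natural
numbers. -/

/-- A memory state with the two counters `steps` and `queries`, which programs cannot read. -/
structure State where
  nat : ℕ → ℕ → ℕ → ℕ
  real : ℕ → ℕ → ℕ → ℝ
  steps : ℕ
  queries : ℕ

/-- What a run depends on besides the memory: the query oracle and the random tape. -/
structure Env where
  oracle : ℕ → ℕ → ℝ
  tape : Tape

/-- Expressions for natural numbers; `get a i j` is cell `(i, j)` of array `a`. -/
inductive NExp
  | const (c : ℕ)
  | get (a : ℕ) (i j : NExp)
  | add (x y : NExp)
  | sub (x y : NExp)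

def NExp.eval (s : State) : NExp → ℕ
  | .const c => c
  | .get a i j => s.nat a (i.eval s) (j.eval s)
  | .add x y => x.eval s + y.eval s
  | .sub x y => x.eval s - y.eval s

/-- Expressions for reals; `draw src a i` reads draw number `i` of stream `a` of the tape. -/
inductive RExp
  | const (c : ℚ)
  | ofNat (x : NExp)
  | get (a : ℕ) (i j : NExp)
  | draw (src : Source) (a : ℕ) (i : NExp)
  | add (x y : RExp)
  | sub (x y : RExp)
  | mul (x y : RExp)
  | div (x y : RExp)
  | exp (x : RExp)
  | log (x : RExp)
  | sqrt (x : RExp)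

noncomputable def RExp.eval (ω : Tape) (s : State) : RExp → ℝ
  | .const c => (c : ℝ)
  | .ofNat x => (x.eval s : ℝ)
  | .get a i j => s.real a (i.eval s) (j.eval s)
  | .draw src a i => ω.read src a (i.eval s)
  | .add x y => x.eval ω s + y.eval ω s
  | .sub x y => x.eval ω s - y.eval ω s
  | .mul x y => x.eval ω s * y.eval ω s
  | .div x y => x.eval ω s / y.eval ω s
  | .exp x => Real.exp (x.eval ω s)
  | .log x => Real.log (x.eval ω s)
  | .sqrt x => Real.sqrt (x.eval ω s)

/-- Tests. -/
inductive BExp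
  | natLt (x y : NExp)
  | realLt (x y : RExp)
  | not (b : BExp)
  | and (b c : BExp)

def BExp.Holds (ω : Tape) (s : State) : BExp → Prop
  | .natLt x y => x.eval s < y.eval s
  | .realLt x y => x.eval ω s < y.eval ω s
  | .not b => ¬ b.Holds ω s
  | .and b c => b.Holds ω s ∧ c.Holds ω s

/-- Programs.  `setNat a i j x` and `setReal a i j x` store `x` in cell `(i, j)` of array `a`;
`query a i j x y` stores the oracle's answer to the query `(x, y)` there. -/
inductive Program
  | skip
  | setNat (a : ℕ) (i j x : NExp)
  | setReal (a : ℕ) (i j : NExp) (x : RExp)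
  | query (a : ℕ) (i j x y : NExp)
  | seq (p q : Program)
  | ite (b : BExp) (p q : Program)
  | while (b : BExp) (p : Program)

/-- Count one step. -/
def State.tick (s : State) : State := { s with steps := s.steps + 1 }

def State.putNat (s : State) (a i j v : ℕ) : State :=
  { s with nat := fun a' i' j' => if a' = a ∧ i' = i ∧ j' = j then v else s.nat a' i' j' }

noncomputable def State.putReal (s : State) (a i j : ℕ) (v : ℝ) : State :=
  { s with real := fun a' i' j' => if a' = a ∧ i' = i ∧ j' = j then v else s.real a' i' j' }

/-- Count one query. -/
def State.countQuery (s : State) : State := { s with queries := s.queries + 1 }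

open Classical in
/-- A loop with test `g` and body `f` in which the test is evaluated at most `fuel` times. -/
noncomputable def loop (g : State → Prop) (f : State → Option State) :
    ℕ → State → Option State
  | 0, _ => none
  | fuel + 1, s => if g s then (f s.tick).bind (loop g f fuel) else some s.tick

open Classical in
/-- Execution: every atomic instruction and every evaluation of a test counts as one step.  The
result is `none` if some loop would need more than `fuel` evaluations of its test. -/
noncomputable def Program.exec (E : Env) (fuel : ℕ) : Program → State → Option State
  | .skip, s => some s.tick
  | .setNat a i j x, s => some (s.putNat a (i.eval s) (j.eval s) (x.eval s)).tick
  | .setReal a i j x, s => some (s.putReal a (i.eval s) (j.eval s) (x.eval E.tape s)).tick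
  | .query a i j x y, s =>
      some (s.putReal a (i.eval s) (j.eval s) (E.oracle (x.eval s) (y.eval s))).countQuery.tick
  | .seq p q, s => (p.exec E fuel s).bind (q.exec E fuel)
  | .ite b p q, s =>
      if b.Holds E.tape s then p.exec E fuel s.tick else q.exec E fuel s.tick
  | .while b p, s => loop (fun s => b.Holds E.tape s) (p.exec E fuel) fuel s

/-- The run of `p` from `s` halts in the state `s'`. -/
def Program.HaltsIn (p : Program) (E : Env) (s s' : State) : Prop :=
  ∃ fuel, p.exec E fuel s = some s'

open Classical in
/-- The final state of a run (the initial state if the run does not halt). -/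
noncomputable def Program.final (p : Program) (E : Env) (s : State) : State :=
  if h : ∃ s', p.HaltsIn E s s' then h.choose else s

/-! ## Ranking algorithms with query access to a weight matrix -/

open Classical in
/-- The oracle for a weight matrix; queries that are not pairs of distinct items return `0`. -/
noncomputable def weightOracle {m : ℕ} (w : Fin m → Fin m → ℝ) (x y : ℕ) : ℝ :=
  if h : x < m ∧ y < m ∧ x ≠ y then w ⟨x, h.1⟩ ⟨y, h.2.1⟩ else 0

/-- Initial memory of a ranking algorithm with query access: only `m` and `n`. -/
def sizeInput (n m : ℕ) : State where
  nat a i j := if a = 0 ∧ i = 0 ∧ j = 0 then m else if a = 0 ∧ i = 0 ∧ j = 1 then n else 0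
  real _ _ _ := 0
  steps := 0
  queries := 0

/-- The memory holds the ranking `σ` in row `0` of array `2`. -/
def HoldsRanking {m : ℕ} (s : State) (σ : Ranking m) : Prop :=
  ∀ j : Fin m, s.nat 2 0 j = (σ j : ℕ)

open Classical in
/-- The ranking held by the memory (arbitrary if there is none). -/
noncomputable def outRanking (m : ℕ) (s : State) : Ranking m :=
  if h : ∃ σ : Ranking m, HoldsRanking s σ then h.choose else 1

/-- Final state of the ranking algorithm `A` with query access to `w`. -/
noncomputable def queryRun (A : Program) (n : ℕ) {m : ℕ} (w : Fin m → Fin m → ℝ) (ω : Tape) :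
    State :=
  A.final ⟨weightOracle w, ω⟩ (sizeInput n m)

/-- `A` always halts within polynomially many steps and outputs a ranking. -/
def PolyTimeQueryRanking (A : Program) : Prop :=
  ∃ T : Polynomial ℕ, ∀ n m : ℕ, 1 ≤ n → 1 ≤ m →
    ∀ w : Fin m → Fin m → ℝ, ProbConstraint w → ∀ ω : Tape,
      ∃ s', A.HaltsIn ⟨weightOracle w, ω⟩ (sizeInput n m) s' ∧
        s'.steps ≤ T.eval (n + m) ∧ ∃ σ : Ranking m, HoldsRanking s' σ

/-- `A` is an `α`-approximation: its expected cost is at most `α` times the optimum. -/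
def QueryApproximation (A : Program) (α : ℝ) : Prop :=
  ∀ n m : ℕ, 1 ≤ n → 1 ≤ m → ∀ w : Fin m → Fin m → ℝ, ProbConstraint w →
    ∫⁻ ω, ENNReal.ofReal (weightedCost (outRanking m (queryRun A n w ω)) w) ∂tapeLaw
      ≤ ENNReal.ofReal (α * weightedOpt w)

/-- With probability at least `1 - ζ / m ^ 4`, `A` makes at most `q` queries. -/
def FewQueries (A : Program) (q : ℕ → ℕ → ℕ) (ζ : ℕ → ℕ → ℝ) : Prop :=
  ∀ n m : ℕ, 1 ≤ n → 1 ≤ m → ∀ w : Fin m → Fin m → ℝ, ProbConstraint w →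
    ENNReal.ofReal (1 - ζ n m / (m : ℝ) ^ 4)
      ≤ tapeLaw {ω | (queryRun A n w ω).queries ≤ q n m}

/-! ## Algorithms with access to the input rankings -/

/-- Initial memory of an algorithm on the dataset `D` with parameters `q`, `ε` and `δ`:
`m`, `n`, `q` in row `0` of the array `0` of naturals, the rankings in its array `1`, and
`ε`, `δ` in row `0` of the array `0` of reals. -/
noncomputable def dataInput {n m : ℕ} (D : Dataset n m) (q : ℕ) (ε δ : ℝ) : State where
  nat a i j :=
    if a = 0 ∧ i = 0 ∧ j = 0 then m
    else if a = 0 ∧ i = 0 ∧ j = 1 then n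
    else if a = 0 ∧ i = 0 ∧ j = 2 then q
    else if h : a = 1 ∧ i < n ∧ j < m then (D ⟨i, h.2.1⟩ ⟨j, h.2.2⟩ : ℕ)
    else 0
  real a i j :=
    if a = 0 ∧ i = 0 ∧ j = 0 then ε
    else if a = 0 ∧ i = 0 ∧ j = 1 then δ
    else 0
  steps := 0
  queries := 0

/-- Such an algorithm has no query oracle. -/
def dataEnv (ω : Tape) : Env := ⟨fun _ _ => 0, ω⟩

/-- Final state of the algorithm `P` on the dataset `D`. -/
noncomputable def dataRun (P : Program) {n m : ℕ} (D : Dataset n m) (q : ℕ) (ε δ : ℝ)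
    (ω : Tape) : State :=
  P.final (dataEnv ω) (dataInput D q ε δ)

/-- `P` always halts within polynomially many steps. -/
def PolyTimeOnData (P : Program) (q : ℕ → ℕ → ℕ) (ε δ : ℕ → ℕ → ℝ) : Prop :=
  ∃ T : Polynomial ℕ, ∀ n m : ℕ, 1 ≤ n → 1 ≤ m → ∀ D : Dataset n m, ∀ ω : Tape,
    ∃ s', P.HaltsIn (dataEnv ω) (dataInput D (q n m) (ε n m) (δ n m)) s' ∧
      s'.steps ≤ T.eval (n + m)

/-! ### Query answering algorithms -/

/-- The matrix of answers prepared by the query answering algorithm `Q`, in the array `1` of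
reals; only pairs of distinct items can be asked for. -/
noncomputable def answerMatrix (Q : Program) {n m : ℕ} (D : Dataset n m) (q : ℕ) (ε δ : ℝ)
    (ω : Tape) (i j : Fin m) : ℝ :=
  if i = j then 0 else (dataRun Q D q ε δ ω).real 1 i j

/-- `Q` incurs expected error at most `e` on every pair. -/
def ExpectedError (Q : Program) (q : ℕ → ℕ → ℕ) (ε δ e : ℕ → ℕ → ℝ) : Prop :=
  ∀ n m : ℕ, 1 ≤ n → 1 ≤ m → ∀ D : Dataset n m, ∀ i j : Fin m, i ≠ j →
    ∫⁻ ω, ENNReal.ofReal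
        |answerMatrix Q D (q n m) (ε n m) (δ n m) ω i j - pairWeight D i j| ∂tapeLaw
      ≤ ENNReal.ofReal (e n m)

/-- An adaptive query strategy chooses the next pair from the previous answers. -/
structure Strategy (m : ℕ) where
  next : (k : ℕ) → (Fin k → ℝ) → Fin m × Fin m
  measurable_next : ∀ k, Measurable (next k)

/-- The first `k` answers that a strategy receives from the matrix `M`. -/
def Strategy.answers {m : ℕ} (S : Strategy m) (M : Fin m → Fin m → ℝ) :
    (k : ℕ) → Fin k → ℝ
  | 0 => Fin.elim0
  | k + 1 =>
      let p := S.next k (S.answers M k)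
      Fin.snoc (α := fun _ => ℝ) (S.answers M k) (M p.1 p.2)

/-- `Q` is `(ε', δ)`-differentially private for answering `q` adaptive queries (`ε` is the
parameter that `Q` receives in its input). -/
def QueryDP (Q : Program) (q : ℕ → ℕ → ℕ) (ε δ ε' : ℕ → ℕ → ℝ) : Prop :=
  ∀ n m : ℕ, 1 ≤ n → 1 ≤ m → ∀ S : Strategy m, ∀ D D' : Dataset n m, Neighbors D D' →
    ∀ U : Set (Fin (q n m) → ℝ), MeasurableSet U →
      tapeLaw {ω | S.answers (answerMatrix Q D (q n m) (ε n m) (δ n m) ω) (q n m) ∈ U}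
        ≤ ENNReal.ofReal (Real.exp (ε' n m)) *
            tapeLaw {ω | S.answers (answerMatrix Q D' (q n m) (ε n m) (δ n m) ω) (q n m) ∈ U}
          + ENNReal.ofReal (δ n m)

/-! ### Ranking algorithms on datasets -/

/-- `B` always outputs a ranking. -/
def OutputsRanking (B : Program) (q : ℕ → ℕ → ℕ) (ε δ : ℕ → ℕ → ℝ) : Prop :=
  ∀ n m : ℕ, 1 ≤ n → 1 ≤ m → ∀ D : Dataset n m, ∀ ω : Tape,
    ∃ σ : Ranking m, HoldsRanking (dataRun B D (q n m) (ε n m) (δ n m) ω) σ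

/-- The ranking computed by `B`. -/
noncomputable def dataRanking (B : Program) {n m : ℕ} (D : Dataset n m) (q : ℕ) (ε δ : ℝ)
    (ω : Tape) : Ranking m :=
  outRanking m (dataRun B D q ε δ ω)

/-- `B` is `(ε, δ)`-differentially private in the central model. -/
def CentralDP (B : Program) (q : ℕ → ℕ → ℕ) (ε δ : ℕ → ℕ → ℝ) : Prop :=
  ∀ n m : ℕ, 1 ≤ n → 1 ≤ m → ∀ D D' : Dataset n m, Neighbors D D' →
    ∀ U : Set (Ranking m),
      tapeLaw {ω | dataRanking B D (q n m) (ε n m) (δ n m) ω ∈ U}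
        ≤ ENNReal.ofReal (Real.exp (ε n m)) *
            tapeLaw {ω | dataRanking B D' (q n m) (ε n m) (δ n m) ω ∈ U}
          + ENNReal.ofReal (δ n m)

/-- `B` is an `(α, β)`-approximation for rank aggregation. -/
def DataApproximation (B : Program) (q : ℕ → ℕ → ℕ) (ε δ α β : ℕ → ℕ → ℝ) : Prop :=
  ∀ n m : ℕ, 1 ≤ n → 1 ≤ m → ∀ D : Dataset n m,
    ∫⁻ ω, ENNReal.ofReal (kemeny (dataRanking B D (q n m) (ε n m) (δ n m) ω) D) ∂tapeLaw
      ≤ ENNReal.ofReal (α n m * opt D + β n m)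

end RankAgg

namespace RankAgg

/-! ## Runs of programs -/

/-! The private algorithm post-processes the noisy matrix of `Q`. It clips the entries above the
diagonal and completes them by complements (`clipMatrix`), which restores the probability
constraint. It then runs `A` on the result and counts the queries. If there are at most `q`, the
ranking of `A` is returned; otherwise the output is a fallback ranking, which sorts the items by
average position plus Laplace noise. The fallback is needed because `Q` protects only `q` answers,
while `A` may exceed `q` with small probability.

Privacy. Fix the draws of `A`. Two runs of `A` with different oracles coincide unless the oracles
disagree on a query that both make after the same earlier queries
(`Program.execLog_eq_or_diverged`). Hence the first `q` answers determine whether the count exceeds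
`q` and, if it does not, the output. A matrix filled with the answers seen so far predicts the next
query, so `A` becomes a query strategy (`fillMatrix_answers`, `exists_strategy`). An output event is
thus an event about `q` adaptive answers and the independent fallback. The answers cost `(ε/2, δ)`.
The fallback costs `ε/2`, since one user moves each of the `m` position sums by at most `m`
(`fallback_private`). `privateResult_private` composes the two; that runs depend measurably on
oracle and tape is `Program.measurable_log`.

Accuracy. Exchanging the true weights for the noisy ones changes every cost by at most `weightDist`,
whose expectation is at most `m² e`. Using this for the output and for the optimum gives `α OPT + (α
+ 1) m² e`. Average positions differ from those in an optimal ranking by at most `OPT`, so the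
fallback costs at most `m² OPT + 2 m⁴ / (ε n)` in expectation (`lintegral_kemeny_fallback_le`). It
is used with probability at most `ζ / m⁴`, independently of its noise, and therefore adds at most `ζ
OPT + 2 / (ε n)`. Together these give `C = α + 3`.

Implementation. `Program.relocate` moves the two given programs to disjoint arrays and disjoint
random streams with a constant slowdown (`Program.relocate_exec`). The streams in the three residue
classes modulo `3` form three independent copies of the tape (`map_tapeParts`), which supplies the
independence used above. -/

/-- Structural induction on programs, with a usable name for the case of loops. -/
@[elab_as_elim]
theorem Program.inductionOn {motive : Program → Prop} (p : Program) (skip : motive .skip)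
    (setNat : ∀ a i j x, motive (.setNat a i j x))
    (setReal : ∀ a i j x, motive (.setReal a i j x))
    (query : ∀ a i j x y, motive (.query a i j x y))
    (seq : ∀ p q, motive p → motive q → motive (.seq p q))
    (ite : ∀ b p q, motive p → motive q → motive (.ite b p q))
    (loop : ∀ b p, motive p → motive (.while b p)) : motive p :=
  Program.rec skip setNat setReal query seq ite loop p

theorem loop_mono {g : State → Prop} {f f' : State → Option State}
    (hf : ∀ s s', f s = some s' → f' s = some s') {fuel fuel' : ℕ} (h : fuel ≤ fuel')
    {s s' : State} (hs : loop g f fuel s = some s') : loop g f' fuel' s = some s' := by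
  induction fuel generalizing fuel' s with
  | zero => simp [loop] at hs
  | succ k ih =>
    obtain ⟨k', rfl⟩ : ∃ k', fuel' = k' + 1 := ⟨fuel' - 1, by omega⟩
    unfold loop at hs ⊢
    split_ifs at hs ⊢ with hg
    · obtain ⟨t, ht, hs⟩ := Option.bind_eq_some_iff.1 hs
      exact Option.bind_eq_some_iff.2 ⟨t, hf _ _ ht, ih (by omega) hs⟩
    · exact hs

theorem Program.exec_mono {E : Env} {fuel fuel' : ℕ} (h : fuel ≤ fuel') {p : Program}
    {s s' : State} (hs : p.exec E fuel s = some s') : p.exec E fuel' s = some s' := by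
  induction p using Program.inductionOn generalizing s s' with
  | seq p q ihp ihq =>
    obtain ⟨t, ht, hs⟩ := Option.bind_eq_some_iff.1 hs
    exact Option.bind_eq_some_iff.2 ⟨t, ihp ht, ihq hs⟩
  | ite b p q ihp ihq =>
    unfold Program.exec at hs ⊢
    split_ifs at hs ⊢
    · exact ihp hs
    · exact ihq hs
  | loop b p ih => exact loop_mono (fun s s' => ih) h hs
  | _ => exact hs

/-- Both runs persist when the fuel is raised to the larger of the two amounts. This makes the
choice in `Program.final` harmless. -/
theorem Program.HaltsIn.unique {p : Program} {E : Env} {s s₁ s₂ : State}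
    (h₁ : p.HaltsIn E s s₁) (h₂ : p.HaltsIn E s s₂) : s₁ = s₂ := by
  obtain ⟨k₁, h₁⟩ := h₁
  obtain ⟨k₂, h₂⟩ := h₂
  have h := (Program.exec_mono (le_max_left k₁ k₂) h₁).symm.trans
    (Program.exec_mono (le_max_right k₁ k₂) h₂)
  simpa using h

theorem Program.HaltsIn.final_eq {p : Program} {E : Env} {s s' : State}
    (h : p.HaltsIn E s s') : p.final E s = s' := by
  have hex : ∃ s', p.HaltsIn E s s' := ⟨s', h⟩
  rw [Program.final, dif_pos hex]
  exact hex.choose_spec.unique h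

/-- `p` halts from `s` within `K` steps in a state satisfying `Q`. -/
def Program.Runs (E : Env) (p : Program) (s : State) (Q : State → Prop) (K : ℕ) : Prop :=
  ∃ s', p.HaltsIn E s s' ∧ Q s' ∧ s'.steps ≤ s.steps + K

theorem Program.Runs.mono {E : Env} {p : Program} {s : State} {Q Q' : State → Prop} {K K' : ℕ}
    (h : p.Runs E s Q K) (hQ : ∀ s', Q s' → Q' s') (hK : K ≤ K') : p.Runs E s Q' K' := by
  obtain ⟨s', h1, h2, h3⟩ := h
  exact ⟨s', h1, hQ _ h2, by omega⟩

theorem Program.Runs.seq {E : Env} {p q : Program} {s : State} {Q R : State → Prop} {K L : ℕ}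
    (hp : p.Runs E s Q K) (hq : ∀ s', Q s' → q.Runs E s' R L) :
    (Program.seq p q).Runs E s R (K + L) := by
  obtain ⟨s', ⟨k, hk⟩, h2, h3⟩ := hp
  obtain ⟨t, ⟨l, hl⟩, h5, h6⟩ := hq s' h2
  exact ⟨t, ⟨max k l, Option.bind_eq_some_iff.2 ⟨s', Program.exec_mono (le_max_left k l) hk,
    Program.exec_mono (le_max_right k l) hl⟩⟩, h5, by omega⟩

theorem Program.Runs.of_exec {E : Env} {p : Program} {s s' : State} {Q : State → Prop} {K : ℕ}
    (h : p.exec E 0 s = some s') (hQ : Q s') (hK : s'.steps ≤ s.steps + K) :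
    p.Runs E s Q K :=
  ⟨s', ⟨0, h⟩, hQ, hK⟩

theorem Program.Runs.ite {E : Env} {b : BExp} {p q : Program} {s : State} {R : State → Prop}
    {K : ℕ} (hp : b.Holds E.tape s → p.Runs E s.tick R K)
    (hq : ¬ b.Holds E.tape s → q.Runs E s.tick R K) :
    (Program.ite b p q).Runs E s R (K + 1) := by
  by_cases hb : b.Holds E.tape s
  · obtain ⟨t, ⟨l, hl⟩, h5, h6⟩ := hp hb
    refine ⟨t, ⟨l, ?_⟩, h5, ?_⟩
    · rw [Program.exec, if_pos hb]; exact hl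
    · simp only [State.tick] at h6; omega
  · obtain ⟨t, ⟨l, hl⟩, h5, h6⟩ := hq hb
    refine ⟨t, ⟨l, ?_⟩, h5, ?_⟩
    · rw [Program.exec, if_neg hb]; exact hl
    · simp only [State.tick] at h6; omega

/-- A counting loop: `I k` is the invariant after `k` of `N` iterations. -/
theorem Program.Runs.while {E : Env} {b : BExp} {p : Program} {N K : ℕ}
    {I : ℕ → State → Prop}
    (htick : ∀ k s, I k s → I k s.tick)
    (hb : ∀ k s, k ≤ N → I k s → (b.Holds E.tape s ↔ k < N))
    (hp : ∀ k s, k < N → I k s → p.Runs E s (I (k + 1)) K)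
    {s : State} (hs : I 0 s) :
    (Program.while b p).Runs E s (I N) (N * (K + 1) + 1) := by
  -- Induction on the number `d` of iterations that remain.
  suffices H : ∀ d k s, k + d = N → I k s →
      (Program.while b p).Runs E s (I N) (d * (K + 1) + 1) from H N 0 s (by omega) hs
  intro d
  induction d with
  | zero =>
    intro k s hk hI
    have hkN : k = N := by omega
    subst hkN
    refine ⟨s.tick, ⟨1, ?_⟩, htick _ _ hI, by simp [State.tick]⟩
    have : ¬ b.Holds E.tape s := fun h => by simpa using (hb k s le_rfl hI).1 h
    simp [Program.exec, loop, this]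
  | succ d ih =>
    intro k s hk hI
    obtain ⟨t, ⟨f₁, h₁⟩, hIt, hst⟩ := hp k s.tick (by omega) (htick _ _ hI)
    obtain ⟨u, ⟨f₂, h₂⟩, hIu, hsu⟩ := ih (k + 1) t (by omega) hIt
    -- The same fuel limits the body and the number of tests; the extra unit pays for the present
    -- test.
    refine ⟨u, ⟨max f₁ f₂ + 1, ?_⟩, hIu, ?_⟩
    · have hh : b.Holds E.tape s := (hb k s (by omega) hI).2 (by omega)
      rw [Program.exec, loop, if_pos hh]
      refine Option.bind_eq_some_iff.2
        ⟨t, Program.exec_mono ((le_max_left f₁ f₂).trans (Nat.le_succ _)) h₁, ?_⟩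
      exact loop_mono (fun s s' => Program.exec_mono ((le_max_right f₁ f₂).trans (Nat.le_succ _)))
        (le_max_right f₁ f₂) h₂
    · simp only [State.tick] at hst
      have : (d + 1) * (K + 1) = d * (K + 1) + K + 1 := by ring
      omega

/-! ## Runs with a log of the queries -/

open Classical in
/-- `loop` for states with a log. -/
noncomputable def loopLog (g : State → Prop)
    (f : State × List (ℕ × ℕ) → Option (State × List (ℕ × ℕ))) :
    ℕ → State × List (ℕ × ℕ) → Option (State × List (ℕ × ℕ))
  | 0, _ => none
  | fuel + 1, s =>
      if g s.1 then (f (s.1.tick, s.2)).bind (loopLog g f fuel) else some (s.1.tick, s.2)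

open Classical in
/-- Execution that also keeps a log of the queries, the most recent one first. -/
noncomputable def Program.execLog (E : Env) (fuel : ℕ) :
    Program → State × List (ℕ × ℕ) → Option (State × List (ℕ × ℕ))
  | .skip, s => some (s.1.tick, s.2)
  | .setNat a i j x, s =>
      some ((s.1.putNat a (i.eval s.1) (j.eval s.1) (x.eval s.1)).tick, s.2)
  | .setReal a i j x, s =>
      some ((s.1.putReal a (i.eval s.1) (j.eval s.1) (x.eval E.tape s.1)).tick, s.2)
  | .query a i j x y, s =>
      some ((s.1.putReal a (i.eval s.1) (j.eval s.1)
        (E.oracle (x.eval s.1) (y.eval s.1))).countQuery.tick, (x.eval s.1, y.eval s.1) :: s.2)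
  | .seq p q, s => (p.execLog E fuel s).bind (q.execLog E fuel)
  | .ite b p q, s =>
      if b.Holds E.tape s.1 then p.execLog E fuel (s.1.tick, s.2)
      else q.execLog E fuel (s.1.tick, s.2)
  | .while b p, s => loopLog (fun s => b.Holds E.tape s) (p.execLog E fuel) fuel s

theorem loopLog_map_fst {g : State → Prop}
    {f : State × List (ℕ × ℕ) → Option (State × List (ℕ × ℕ))} {f' : State → Option State}
    (hf : ∀ s, (f s).map Prod.fst = f' s.1) (fuel : ℕ) (s : State × List (ℕ × ℕ)) :
    (loopLog g f fuel s).map Prod.fst = loop g f' fuel s.1 := by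
  induction fuel generalizing s with
  | zero => rfl
  | succ k ih =>
    unfold loopLog loop
    split_ifs with hg
    · rw [← hf (s.1.tick, s.2), Option.map_bind, Option.bind_map]
      congr 1
      funext t
      exact ih t
    · rfl

theorem Program.execLog_map_fst (E : Env) (fuel : ℕ) (p : Program) (s : State × List (ℕ × ℕ)) :
    (p.execLog E fuel s).map Prod.fst = p.exec E fuel s.1 := by
  induction p using Program.inductionOn generalizing s with
  | seq p q ihp ihq =>
    unfold Program.execLog Program.exec
    rw [← ihp s, Option.map_bind, Option.bind_map]
    congr 1
    funext t
    exact ihq t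
  | ite b p q ihp ihq =>
    unfold Program.execLog Program.exec
    split_ifs
    · exact ihp _
    · exact ihq _
  | loop b p ih => exact loopLog_map_fst ih fuel s
  | _ => rfl

theorem Program.exists_execLog {E : Env} {fuel : ℕ} {p : Program} {s s' : State}
    (h : p.exec E fuel s = some s') (l : List (ℕ × ℕ)) :
    ∃ l', p.execLog E fuel (s, l) = some (s', l') := by
  rw [← Program.execLog_map_fst E fuel p (s, l)] at h
  obtain ⟨⟨t, l'⟩, h1, h2⟩ := Option.map_eq_some_iff.1 h
  exact ⟨l', by rw [h1]; simp only at h2; rw [h2]⟩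

/-- A loop is a chain of ticks and bodies, so transitivity suffices. The relation is arbitrary
because it is needed both for log growth alone and for log growth together with the query count. -/
theorem loopLog_extends {g : State → Prop}
    {f : State × List (ℕ × ℕ) → Option (State × List (ℕ × ℕ))}
    (P : State × List (ℕ × ℕ) → State × List (ℕ × ℕ) → Prop)
    (htick : ∀ s : State × List (ℕ × ℕ), P s (s.1.tick, s.2))
    (htrans : ∀ s t u, P s t → P t u → P s u) (hf : ∀ s s', f s = some s' → P s s')
    (fuel : ℕ) (s s' : State × List (ℕ × ℕ)) (h : loopLog g f fuel s = some s') : P s s' := by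
  induction fuel generalizing s with
  | zero => simp [loopLog] at h
  | succ k ih =>
    unfold loopLog at h
    split_ifs at h with hg
    · obtain ⟨t, ht, h⟩ := Option.bind_eq_some_iff.1 h
      exact htrans _ _ _ (htick s) (htrans _ _ _ (hf _ _ ht) (ih _ h))
    · obtain rfl := Option.some.inj h
      exact htick s

/-- The log grows, by one entry for each counted query. -/
theorem Program.execLog_extends {E : Env} {fuel : ℕ} {p : Program}
    {s s' : State × List (ℕ × ℕ)} (h : p.execLog E fuel s = some s') :
    s.2 <:+ s'.2 ∧ s'.1.queries + s.2.length = s.1.queries + s'.2.length := by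
  induction p using Program.inductionOn generalizing s s' with
  | seq p q ihp ihq =>
    obtain ⟨t, ht, hs⟩ := Option.bind_eq_some_iff.1 h
    have h1 := ihp ht
    have h2 := ihq hs
    exact ⟨h1.1.trans h2.1, by omega⟩
  | ite b p q ihp ihq =>
    unfold Program.execLog at h
    split_ifs at h
    · have h1 := ihp h; exact h1
    · have h1 := ihq h; exact h1
  | loop b p ih =>
    refine loopLog_extends (fun s s' => s.2 <:+ s'.2 ∧
      s'.1.queries + s.2.length = s.1.queries + s'.2.length) (fun s => ⟨List.suffix_rfl, rfl⟩)
      (fun s t u h1 h2 => ⟨h1.1.trans h2.1, by omega⟩) (fun s s' => ih) fuel s s' h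
  | query a i j x y =>
    obtain rfl := Option.some.inj h
    refine ⟨List.suffix_cons _ _, ?_⟩
    simp [State.tick, State.countQuery, State.putReal]
    omega
  | _ =>
    obtain rfl := Option.some.inj h
    exact ⟨List.suffix_rfl, rfl⟩

/-- Two logs contain the same queries up to one on which the oracles `o` and `o'` differ. -/
def Diverged (o o' : ℕ → ℕ → ℝ) (l l' : List (ℕ × ℕ)) : Prop :=
  ∃ (c : ℕ × ℕ) (r : List (ℕ × ℕ)), o c.1 c.2 ≠ o' c.1 c.2 ∧ c :: r <:+ l ∧ c :: r <:+ l'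

theorem Diverged.mono {o o' : ℕ → ℕ → ℝ} {l l' k k' : List (ℕ × ℕ)}
    (h : Diverged o o' l l') (hl : l <:+ k) (hl' : l' <:+ k') : Diverged o o' k k' := by
  obtain ⟨c, r, h1, h2, h3⟩ := h
  exact ⟨c, r, h1, h2.trans hl, h3.trans hl'⟩

/-- The test depends on the state only, so both loops take the same branches as long as their bodies
agree. After a divergence the logs only grow, which keeps the common suffix that witnesses it. -/
theorem loopLog_eq_or_diverged {o o' : ℕ → ℕ → ℝ} {g : State → Prop}
    {f f' : State × List (ℕ × ℕ) → Option (State × List (ℕ × ℕ))}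
    (hf : ∀ s s₁ s₂, f s = some s₁ → f' s = some s₂ → s₁ = s₂ ∨ Diverged o o' s₁.2 s₂.2)
    (hext : ∀ s s', f s = some s' → s.2 <:+ s'.2)
    (hext' : ∀ s s', f' s = some s' → s.2 <:+ s'.2)
    (fuel : ℕ) (s s₁ s₂ : State × List (ℕ × ℕ)) (h₁ : loopLog g f fuel s = some s₁)
    (h₂ : loopLog g f' fuel s = some s₂) : s₁ = s₂ ∨ Diverged o o' s₁.2 s₂.2 := by
  induction fuel generalizing s with
  | zero => simp [loopLog] at h₁
  | succ k ih =>
    unfold loopLog at h₁ h₂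
    split_ifs at h₁ h₂ with hg
    · obtain ⟨t₁, ht₁, h₁⟩ := Option.bind_eq_some_iff.1 h₁
      obtain ⟨t₂, ht₂, h₂⟩ := Option.bind_eq_some_iff.1 h₂
      rcases hf _ _ _ ht₁ ht₂ with rfl | hd
      · exact ih _ h₁ h₂
      · refine .inr (hd.mono ?_ ?_)
        · exact loopLog_extends (fun s s' => s.2 <:+ s'.2) (fun s => List.suffix_rfl)
            (fun s t u h1 h2 => h1.trans h2) hext _ _ _ h₁
        · exact loopLog_extends (fun s s' => s.2 <:+ s'.2) (fun s => List.suffix_rfl)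
            (fun s t u h1 h2 => h1.trans h2) hext' _ _ _ h₂
    · exact .inl (Option.some.inj (h₁.symm.trans h₂))

/-- Runs with different oracles coincide unless the oracles differ on a common query. -/
theorem Program.execLog_eq_or_diverged {o o' : ℕ → ℕ → ℝ} {ω : Tape} {fuel : ℕ} {p : Program}
    {s s₁ s₂ : State × List (ℕ × ℕ)} (h₁ : p.execLog ⟨o, ω⟩ fuel s = some s₁)
    (h₂ : p.execLog ⟨o', ω⟩ fuel s = some s₂) : s₁ = s₂ ∨ Diverged o o' s₁.2 s₂.2 := by
  induction p using Program.inductionOn generalizing s s₁ s₂ with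
  | seq p q ihp ihq =>
    obtain ⟨t₁, ht₁, h₁⟩ := Option.bind_eq_some_iff.1 h₁
    obtain ⟨t₂, ht₂, h₂⟩ := Option.bind_eq_some_iff.1 h₂
    rcases ihp ht₁ ht₂ with rfl | hd
    · exact ihq h₁ h₂
    · exact .inr (hd.mono (Program.execLog_extends h₁).1 (Program.execLog_extends h₂).1)
  | ite b p q ihp ihq =>
    unfold Program.execLog at h₁ h₂
    by_cases hb : b.Holds ω s.1
    · rw [if_pos hb] at h₁ h₂
      exact ihp h₁ h₂
    · rw [if_neg hb] at h₁ h₂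
      exact ihq h₁ h₂
  | loop b p ih =>
    exact loopLog_eq_or_diverged (fun s s₁ s₂ => ih)
      (fun s s' h => (Program.execLog_extends h).1) (fun s s' h => (Program.execLog_extends h).1)
      fuel s s₁ s₂ h₁ h₂
  | query a i j x y =>
    obtain rfl := Option.some.inj h₁
    obtain rfl := Option.some.inj h₂
    by_cases ho : o (x.eval s.1) (y.eval s.1) = o' (x.eval s.1) (y.eval s.1)
    · left; simp only [ho]
    · exact .inr ⟨(x.eval s.1, y.eval s.1), s.2, ho, List.suffix_rfl, List.suffix_rfl⟩
  | _ => exact .inl (Option.some.inj (h₁.symm.trans h₂))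

/-! ## Measurability of runs -/

/-- Pulled back from a product, so that a random state is measurable exactly when each memory cell
and both counters are. -/
instance : MeasurableSpace State :=
  MeasurableSpace.comap (fun s => (s.nat, s.real, s.steps, s.queries)) inferInstance

instance : MeasurableSpace Env :=
  MeasurableSpace.comap (fun E => (E.oracle, E.tape)) inferInstance

section Measurability

variable {P : Type*} [MeasurableSpace P]

theorem measurable_state_iff {s : P → State} :
    Measurable s ↔ (∀ a i j, Measurable fun t => (s t).nat a i j) ∧
      (∀ a i j, Measurable fun t => (s t).real a i j) ∧
      (Measurable fun t => (s t).steps) ∧ Measurable fun t => (s t).queries := by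
  rw [measurable_comap_iff]
  simp only [Function.comp_def, measurable_fun_prod, measurable_pi_iff]

theorem measurable_env_iff {E : P → Env} :
    Measurable E ↔ (∀ x y, Measurable fun t => (E t).oracle x y) ∧
      Measurable fun t => (E t).tape := by
  rw [measurable_comap_iff]
  simp only [Function.comp_def, measurable_fun_prod, measurable_pi_iff]

/-- Handles indirect addressing: the address of a cell, a draw or a query is itself random, but
takes countably many values. -/
theorem measurable_apply_countable {α β : Type*} [Countable α] [MeasurableSpace α]
    [MeasurableSingletonClass α] [MeasurableSpace β] {f : α → P → β} (hf : ∀ a, Measurable (f a))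
    {k : P → α} (hk : Measurable k) : Measurable fun t => f (k t) t :=
  (measurable_from_prod_countable_right (f := fun p : α × P => f p.1 p.2) hf).comp
    (hk.prodMk measurable_id)

theorem NExp.measurable_eval (x : NExp) {s : P → State} (hs : Measurable s) :
    Measurable fun t => x.eval (s t) := by
  induction x with
  | const c => exact measurable_const
  | get a i j ihi ihj =>
    exact measurable_apply_countable
      (f := fun (k : ℕ × ℕ) t => (s t).nat a k.1 k.2)
      (fun k => (measurable_state_iff.1 hs).1 a k.1 k.2) (ihi.prodMk ihj)
  | add x y ihx ihy => exact ihx.add ihy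
  | sub x y ihx ihy => exact ihx.sub ihy

theorem Tape.measurable_read (src : Source) (a i : ℕ) :
    Measurable fun ω : Tape => ω.read src a i := by
  cases src <;> simp only [Tape.read] <;> fun_prop

theorem RExp.measurable_eval (x : RExp) {E : P → Env} {s : P → State} (hE : Measurable E)
    (hs : Measurable s) : Measurable fun t => x.eval (E t).tape (s t) := by
  induction x with
  | const c => exact measurable_const
  | ofNat x => exact (measurable_of_countable (fun n : ℕ => (n : ℝ))).comp (x.measurable_eval hs)
  | get a i j =>
    exact measurable_apply_countable
      (f := fun (k : ℕ × ℕ) t => (s t).real a k.1 k.2)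
      (fun k => (measurable_state_iff.1 hs).2.1 a k.1 k.2)
      ((i.measurable_eval hs).prodMk (j.measurable_eval hs))
  | draw src a i =>
    exact measurable_apply_countable (f := fun (k : ℕ) t => (E t).tape.read src a k)
      (fun k => (Tape.measurable_read src a k).comp (measurable_env_iff.1 hE).2)
      (i.measurable_eval hs)
  | add x y ihx ihy => exact ihx.add ihy
  | sub x y ihx ihy => exact ihx.sub ihy
  | mul x y ihx ihy => exact ihx.mul ihy
  | div x y ihx ihy => exact ihx.div ihy
  | exp x ih => exact Real.measurable_exp.comp ih
  | log x ih => exact Real.measurable_log.comp ih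
  | sqrt x ih => exact Real.continuous_sqrt.measurable.comp ih

theorem BExp.measurableSet_holds (b : BExp) {E : P → Env} {s : P → State} (hE : Measurable E)
    (hs : Measurable s) : MeasurableSet {t | b.Holds (E t).tape (s t)} := by
  induction b with
  | natLt x y => exact measurableSet_lt (x.measurable_eval hs) (y.measurable_eval hs)
  | realLt x y => exact measurableSet_lt (x.measurable_eval hE hs) (y.measurable_eval hE hs)
  | not b ih => exact ih.compl
  | and b c ihb ihc => exact ihb.inter ihc

theorem measurable_tick {s : P → State} (hs : Measurable s) : Measurable fun t => (s t).tick := by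
  rw [measurable_state_iff] at hs ⊢
  exact ⟨hs.1, hs.2.1, hs.2.2.1.add measurable_const, hs.2.2.2⟩

theorem measurable_countQuery {s : P → State} (hs : Measurable s) :
    Measurable fun t => (s t).countQuery := by
  rw [measurable_state_iff] at hs ⊢
  exact ⟨hs.1, hs.2.1, hs.2.2.1, hs.2.2.2.add measurable_const⟩

theorem measurableSet_cell {i j : P → ℕ} (hi : Measurable i) (hj : Measurable j)
    (a a' i' j' : ℕ) : MeasurableSet {t | a' = a ∧ i' = i t ∧ j' = j t} :=
  (MeasurableSet.const _).inter ((measurableSet_eq_fun measurable_const hi).inter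
    (measurableSet_eq_fun measurable_const hj))

theorem measurable_putNat {s : P → State} {i j v : P → ℕ} (hs : Measurable s) (hi : Measurable i)
    (hj : Measurable j) (hv : Measurable v) (a : ℕ) :
    Measurable fun t => (s t).putNat a (i t) (j t) (v t) := by
  rw [measurable_state_iff] at hs ⊢
  exact ⟨fun a' i' j' => Measurable.ite (measurableSet_cell hi hj a a' i' j') hv (hs.1 a' i' j'),
    hs.2⟩

theorem measurable_putReal {s : P → State} {i j : P → ℕ} {v : P → ℝ} (hs : Measurable s)
    (hi : Measurable i) (hj : Measurable j) (hv : Measurable v) (a : ℕ) :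
    Measurable fun t => (s t).putReal a (i t) (j t) (v t) := by
  rw [measurable_state_iff] at hs ⊢
  exact ⟨hs.1, fun a' i' j' =>
    Measurable.ite (measurableSet_cell hi hj a a' i' j') hv (hs.2.1 a' i' j'), hs.2.2⟩

/-- Measurability of a partially defined function. -/
def MeasurablePartial {X : Type*} [MeasurableSpace X] (F : P → Option X) : Prop :=
  ∃ g : P → X, Measurable g ∧ MeasurableSet {t | (F t).isSome} ∧ ∀ t x, F t = some x → g t = x

theorem MeasurablePartial.some {X : Type*} [MeasurableSpace X] {g : P → X} (hg : Measurable g) :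
    MeasurablePartial fun t => some (g t) :=
  ⟨g, hg, by simp, fun t x h => Option.some.inj h⟩

theorem MeasurablePartial.none {X : Type*} [MeasurableSpace X] [Nonempty X] :
    MeasurablePartial fun _ : P => (Option.none : Option X) :=
  ⟨fun _ => Classical.arbitrary X, measurable_const, by simp, by simp⟩

theorem MeasurablePartial.bind {X Y : Type*} [MeasurableSpace X] [MeasurableSpace Y]
    {F : P → Option X} (hF : MeasurablePartial F) {G : P → X → Option Y}
    (hG : ∀ h : P → X, Measurable h → MeasurablePartial fun t => G t (h t)) :
    MeasurablePartial fun t => (F t).bind (G t) := by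
  obtain ⟨f, hf, hfS, hfF⟩ := hF
  -- The second function is evaluated along the total extension `f`; its values where `F` is
  -- undefined do not matter.
  obtain ⟨g, hg, hgS, hgG⟩ := hG f hf
  refine ⟨g, hg, ?_, ?_⟩
  · convert hfS.inter hgS using 1
    ext t
    cases h : F t with
    | none => simp [h]
    | some x => simp [h, hfF t x h]
  · intro t y hy
    obtain ⟨x, hx, hy⟩ := Option.bind_eq_some_iff.1 hy
    exact hgG t y (by simp only [hfF t x hx]; exact hy)

open Classical in
theorem MeasurablePartial.ite {X : Type*} [MeasurableSpace X] {F G : P → Option X} {S : Set P}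
    (hS : MeasurableSet S) (hF : MeasurablePartial F) (hG : MeasurablePartial G) :
    MeasurablePartial fun t => if t ∈ S then F t else G t := by
  obtain ⟨f, hf, hfS, hfF⟩ := hF
  obtain ⟨g, hg, hgS, hgG⟩ := hG
  refine ⟨fun t => if t ∈ S then f t else g t, Measurable.ite hS hf hg, ?_, ?_⟩
  · convert hS.ite hfS hgS using 1
    ext t
    by_cases h : t ∈ S <;> simp [Set.ite, h]
  · intro t x hx
    by_cases h : t ∈ S
    · simp only [h, if_true] at hx ⊢; exact hfF t x hx
    · simp only [h, if_false] at hx ⊢; exact hgG t x hx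

instance : Nonempty State := ⟨⟨0, 0, 0, 0⟩⟩

theorem loopLog_measurable {g : P → State → Prop}
    {f : P → State × List (ℕ × ℕ) → Option (State × List (ℕ × ℕ))}
    [MeasurableSpace (List (ℕ × ℕ))]
    (hg : ∀ s : P → State, Measurable s → MeasurableSet {t | g t (s t)})
    (hf : ∀ s : P → State × List (ℕ × ℕ), Measurable s → MeasurablePartial fun t => f t (s t))
    (fuel : ℕ) {s : P → State × List (ℕ × ℕ)} (hs : Measurable s) :
    MeasurablePartial fun t => loopLog (g t) (f t) fuel (s t) := by
  induction fuel generalizing s with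
  | zero => exact MeasurablePartial.none
  | succ k ih =>
    have ht := (measurable_tick hs.fst).prodMk hs.snd
    exact MeasurablePartial.ite (S := {t | g t (s t).1}) (hg _ hs.fst)
      ((hf _ ht).bind fun h hh => ih hh) (MeasurablePartial.some ht)

/-- Logs form a countable type, so the discrete σ-algebra costs nothing and makes every function of
the log measurable. -/
instance : MeasurableSpace (List (ℕ × ℕ)) := ⊤

theorem Program.execLog_measurable {E : P → Env} (hE : Measurable E) (fuel : ℕ) (p : Program)
    {s : P → State × List (ℕ × ℕ)} (hs : Measurable s) :
    MeasurablePartial fun t => p.execLog (E t) fuel (s t) := by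
  induction p using Program.inductionOn generalizing s with
  | skip => exact MeasurablePartial.some ((measurable_tick hs.fst).prodMk hs.snd)
  | setNat a i j x =>
    exact MeasurablePartial.some ((measurable_tick (measurable_putNat hs.fst
      (i.measurable_eval hs.fst) (j.measurable_eval hs.fst) (x.measurable_eval hs.fst) a)).prodMk
      hs.snd)
  | setReal a i j x =>
    exact MeasurablePartial.some ((measurable_tick (measurable_putReal hs.fst
      (i.measurable_eval hs.fst) (j.measurable_eval hs.fst) (x.measurable_eval hE hs.fst)
      a)).prodMk hs.snd)
  | query a i j x y =>
    refine MeasurablePartial.some ((measurable_tick (measurable_countQuery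
      (measurable_putReal hs.fst (i.measurable_eval hs.fst) (j.measurable_eval hs.fst) ?_
      a))).prodMk ?_)
    · exact measurable_apply_countable (f := fun (k : ℕ × ℕ) t => (E t).oracle k.1 k.2)
        (fun k => (measurable_env_iff.1 hE).1 k.1 k.2)
        ((x.measurable_eval hs.fst).prodMk (y.measurable_eval hs.fst))
    · exact (measurable_of_countable
        (fun k : (ℕ × ℕ) × List (ℕ × ℕ) => k.1 :: k.2)).comp
        (((x.measurable_eval hs.fst).prodMk (y.measurable_eval hs.fst)).prodMk hs.snd)
  | seq p q ihp ihq => exact (ihp hs).bind fun h hh => ihq hh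
  | ite b p q ihp ihq =>
    have ht := (measurable_tick hs.fst).prodMk hs.snd
    exact MeasurablePartial.ite (S := {t | b.Holds (E t).tape (s t).1})
      (b.measurableSet_holds hE hs.fst) (ihp ht) (ihq ht)
  | loop b p ih =>
    exact loopLog_measurable (fun s hs => b.measurableSet_holds hE hs) (fun s hs => ih hs) fuel hs

/-- The final state and the log of a run that halts. -/
theorem Program.measurable_log {E : P → Env} (hE : Measurable E) (p : Program) {s : P → State}
    (hs : Measurable s) (hp : ∀ t, ∃ s', p.HaltsIn (E t) (s t) s') :
    ∃ L : P → State × List (ℕ × ℕ), Measurable L ∧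
      ∀ t, (L t).1 = p.final (E t) (s t) ∧
        ∃ fuel, p.execLog (E t) fuel (s t, []) = some (L t) := by
  classical
  choose g hg hgS hgG using fun fuel =>
    p.execLog_measurable hE fuel (s := fun t => (s t, [])) (hs.prodMk measurable_const)
  have hex : ∀ t, ∃ fuel, (p.execLog (E t) fuel (s t, [])).isSome := by
    intro t
    obtain ⟨s', k, hk⟩ := hp t
    obtain ⟨l, hl⟩ := Program.exists_execLog hk []
    exact ⟨k, by rw [hl]; rfl⟩
  have key : ∀ t, p.execLog (E t) (Nat.find (hex t)) (s t, []) =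
      some (g (Nat.find (hex t)) t) := by
    intro t
    obtain ⟨x, hx⟩ := Option.isSome_iff_exists.1 (Nat.find_spec (hex t))
    rw [hx, hgG _ t x hx]
  -- Gluing along the least sufficient fuel is measurable, since halting within a given fuel is a
  -- measurable event.
  refine ⟨fun t => g (Nat.find (hex t)) t, Measurable.find hg (fun k => hgS k) hex, fun t =>
    ⟨?_, _, key t⟩⟩
  refine (Program.HaltsIn.final_eq ⟨Nat.find (hex t), ?_⟩).symm
  rw [← Program.execLog_map_fst _ _ _ (s t, []), key t]
  rfl

end Measurability

/-! ## Relocating the memory of a program -/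

/-- Rename the arrays of an expression by `f`. -/
def NExp.relocate (f : ℕ → ℕ) : NExp → NExp
  | .const c => .const c
  | .get a i j => .get (f a) (i.relocate f) (j.relocate f)
  | .add x y => .add (x.relocate f) (y.relocate f)
  | .sub x y => .sub (x.relocate f) (y.relocate f)

/-- Rename the arrays of an expression by `f` and the streams by `g`. -/
def RExp.relocate (f g : ℕ → ℕ) : RExp → RExp
  | .const c => .const c
  | .ofNat x => .ofNat (x.relocate f)
  | .get a i j => .get (f a) (i.relocate f) (j.relocate f)
  | .draw src a i => .draw src (g a) (i.relocate f)
  | .add x y => .add (x.relocate f g) (y.relocate f g)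
  | .sub x y => .sub (x.relocate f g) (y.relocate f g)
  | .mul x y => .mul (x.relocate f g) (y.relocate f g)
  | .div x y => .div (x.relocate f g) (y.relocate f g)
  | .exp x => .exp (x.relocate f g)
  | .log x => .log (x.relocate f g)
  | .sqrt x => .sqrt (x.relocate f g)

/-- Rename the arrays of a test by `f` and the streams by `g`. -/
def BExp.relocate (f g : ℕ → ℕ) : BExp → BExp
  | .natLt x y => .natLt (x.relocate f) (y.relocate f)
  | .realLt x y => .realLt (x.relocate f g) (y.relocate f g)
  | .not b => .not (b.relocate f g)
  | .and b c => .and (b.relocate f g) (c.relocate f g)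

/-- The natural number in cell `(0, k)` of array `a`. -/
def NExp.cell (a k : ℕ) : NExp := .get a (.const 0) (.const k)

/-- Add one to cell `(0, k)` of array `a`. -/
def Program.incr (a k : ℕ) : Program :=
  .setNat a (.const 0) (.const k) (.add (.cell a k) (.const 1))

/-- Rename the arrays of a program by `f` and the streams by `g`; queries are counted in
cell `(0, 0)` of array `c` and answered by the code `ans`. -/
def Program.relocate (f g : ℕ → ℕ) (c : ℕ) (ans : ℕ → NExp → NExp → NExp → NExp → Program) :
    Program → Program
  | .skip => .skip
  | .setNat a i j x => .setNat (f a) (i.relocate f) (j.relocate f) (x.relocate f)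
  | .setReal a i j x => .setReal (f a) (i.relocate f) (j.relocate f) (x.relocate f g)
  | .query a i j x y => .seq (.incr c 0)
      (ans (f a) (i.relocate f) (j.relocate f) (x.relocate f) (y.relocate f))
  | .seq p q => .seq (p.relocate f g c ans) (q.relocate f g c ans)
  | .ite b p q => .ite (b.relocate f g) (p.relocate f g c ans) (q.relocate f g c ans)
  | .while b p => .while (b.relocate f g) (p.relocate f g c ans)

/-- The state `s` simulates `s₀`: its arrays `f a` hold the arrays `a` of `s₀`, the counter is
correct, and the other arrays are the same as in `t`. -/
structure Simulates (f : ℕ → ℕ) (c : ℕ) (t s₀ s : State) : Prop where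
  nat : ∀ a i j, s.nat (f a) i j = s₀.nat a i j
  real : ∀ a i j, s.real (f a) i j = s₀.real a i j
  counter : s.nat c 0 0 = s₀.queries
  nat_frame : ∀ a, a ∉ Set.range f → a ≠ c → s.nat a = t.nat a
  real_frame : ∀ a, a ∉ Set.range f → s.real a = t.real a

theorem Simulates.tick {f : ℕ → ℕ} {c : ℕ} {t s₀ s : State} (h : Simulates f c t s₀ s) :
    Simulates f c t s₀.tick s.tick :=
  ⟨h.nat, h.real, h.counter, h.nat_frame, h.real_frame⟩

theorem Simulates.putNat {f : ℕ → ℕ} (hf : Function.Injective f) {c : ℕ}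
    (hc : c ∉ Set.range f) {t s₀ s : State} (h : Simulates f c t s₀ s) (a i j v : ℕ) :
    Simulates f c t (s₀.putNat a i j v) (s.putNat (f a) i j v) where
  nat a' i' j' := by simp only [State.putNat, hf.eq_iff, h.nat]
  real := h.real
  counter := by
    have : c ≠ f a := fun e => hc ⟨a, e.symm⟩
    simp [State.putNat, this, h.counter]
  nat_frame a' ha' hc' := by
    have : a' ≠ f a := fun e => ha' ⟨a, e.symm⟩
    simp [State.putNat, this, h.nat_frame a' ha' hc']
  real_frame := h.real_frame

theorem Simulates.putReal {f : ℕ → ℕ} (hf : Function.Injective f) {c : ℕ}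
    {t s₀ s : State} (h : Simulates f c t s₀ s) (a i j : ℕ) (v : ℝ) :
    Simulates f c t (s₀.putReal a i j v) (s.putReal (f a) i j v) where
  nat := h.nat
  real a' i' j' := by simp only [State.putReal, hf.eq_iff, h.real]
  counter := h.counter
  nat_frame := h.nat_frame
  real_frame a' ha' := by
    have : a' ≠ f a := fun e => ha' ⟨a, e.symm⟩
    simp [State.putReal, this, h.real_frame a' ha']

theorem Simulates.nexp {f : ℕ → ℕ} {c : ℕ} {t s₀ s : State} (h : Simulates f c t s₀ s)
    (x : NExp) : (x.relocate f).eval s = x.eval s₀ := by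
  induction x with
  | const c => rfl
  | get a i j ihi ihj => simp only [NExp.relocate, NExp.eval, ihi, ihj, h.nat]
  | add x y ihx ihy => simp only [NExp.relocate, NExp.eval, ihx, ihy]
  | sub x y ihx ihy => simp only [NExp.relocate, NExp.eval, ihx, ihy]

theorem Simulates.rexp {f g : ℕ → ℕ} {c : ℕ} {t s₀ s : State} (h : Simulates f c t s₀ s)
    {ω₀ ω : Tape} (hω : ∀ src a i, ω.read src (g a) i = ω₀.read src a i) (x : RExp) :
    (x.relocate f g).eval ω s = x.eval ω₀ s₀ := by
  induction x with
  | get a i j => simp only [RExp.relocate, RExp.eval, h.nexp, h.real]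
  | draw src a i => simp only [RExp.relocate, RExp.eval, h.nexp, hω]
  | _ => simp_all only [RExp.relocate, RExp.eval, h.nexp]

theorem Simulates.bexp {f g : ℕ → ℕ} {c : ℕ} {t s₀ s : State} (h : Simulates f c t s₀ s)
    {ω₀ ω : Tape} (hω : ∀ src a i, ω.read src (g a) i = ω₀.read src a i) (b : BExp) :
    (b.relocate f g).Holds ω s ↔ b.Holds ω₀ s₀ := by
  induction b with
  | natLt x y => simp only [BExp.relocate, BExp.Holds, h.nexp]
  | realLt x y => simp only [BExp.relocate, BExp.Holds, h.rexp hω]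
  | not b ih => simp only [BExp.relocate, BExp.Holds, ih]
  | and b c ihb ihc => simp only [BExp.relocate, BExp.Holds, ihb, ihc]

/-- The code `ans` answers queries as the oracle `o` does, whenever the arrays outside the range
of `f` and other than `c` are those of `t`. -/
def Answers (f : ℕ → ℕ) (c : ℕ) (t : State) (ω : Tape)
    (o : ℕ → ℕ → ℝ) (ans : ℕ → NExp → NExp → NExp → NExp → Program) : Prop :=
  ∀ (fuel a : ℕ) (i j x y : NExp) (s : State),
    (∀ a, a ∉ Set.range f → a ≠ c → s.nat a = t.nat a) →
    (∀ a, a ∉ Set.range f → s.real a = t.real a) →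
    ∃ s', (ans a i j x y).exec (dataEnv ω) fuel s = some s' ∧ s'.nat = s.nat ∧
      s'.real = (s.putReal a (i.eval s) (j.eval s) (o (x.eval s) (y.eval s))).real ∧
      s'.steps ≤ s.steps + 6

/-- A cell of an array outside the range of `f` is irrelevant for relocated expressions. -/
theorem NExp.relocate_eval_putNat {f : ℕ → ℕ} {c : ℕ} (hc : c ∉ Set.range f) (x : NExp)
    (s : State) (i j v : ℕ) :
    (x.relocate f).eval (s.putNat c i j v) = (x.relocate f).eval s := by
  induction x with
  | const c => rfl
  | get a i' j' ihi ihj =>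
    have : f a ≠ c := fun e => hc ⟨a, e⟩
    simp only [NExp.relocate, NExp.eval, ihi, ihj]
    simp [State.putNat, this]
  | add x y ihx ihy => simp only [NExp.relocate, NExp.eval, ihx, ihy]
  | sub x y ihx ihy => simp only [NExp.relocate, NExp.eval, ihx, ihy]

theorem NExp.eval_tick (x : NExp) (s : State) : x.eval s.tick = x.eval s := by
  induction x with
  | const c => rfl
  | get a i' j' ihi ihj =>
    simp only [NExp.eval, ihi, ihj]
    rfl
  | add x y ihx ihy => simp only [NExp.eval, ihx, ihy]
  | sub x y ihx ihy => simp only [NExp.eval, ihx, ihy]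

theorem RExp.eval_tick (x : RExp) (ω : Tape) (s : State) : x.eval ω s.tick = x.eval ω s := by
  induction x with
  | get a i j =>
    simp only [RExp.eval, NExp.eval_tick]
    rfl
  | _ => simp_all only [RExp.eval, NExp.eval_tick]

/-- The relocated program simulates the original one, with at most seven steps for each step. -/
theorem Program.relocate_exec {f g : ℕ → ℕ} (hf : Function.Injective f) {c : ℕ}
    (hc : c ∉ Set.range f) {t : State} {ω₀ ω : Tape}
    (hω : ∀ src a i, ω.read src (g a) i = ω₀.read src a i) {o : ℕ → ℕ → ℝ}
    {ans : ℕ → NExp → NExp → NExp → NExp → Program} (hans : Answers f c t ω o ans)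
    {fuel : ℕ} {p : Program} {s₀ s₀' s : State} (h₀ : p.exec ⟨o, ω₀⟩ fuel s₀ = some s₀')
    (h : Simulates f c t s₀ s) :
    ∃ s', (p.relocate f g c ans).exec (dataEnv ω) fuel s = some s' ∧ Simulates f c t s₀' s' ∧
      s'.steps + 7 * s₀.steps ≤ s.steps + 7 * s₀'.steps := by
  induction p using Program.inductionOn generalizing s₀ s₀' s with
  | skip =>
    obtain rfl := Option.some.inj h₀
    exact ⟨s.tick, rfl, h.tick, by simp only [State.tick]; omega⟩
  | setNat a i j x =>
    obtain rfl := Option.some.inj h₀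
    refine ⟨_, rfl, ?_, ?_⟩
    · rw [h.nexp, h.nexp, h.nexp]
      exact (h.putNat hf hc _ _ _ _).tick
    · simp only [State.tick, State.putNat]; omega
  | setReal a i j x =>
    obtain rfl := Option.some.inj h₀
    refine ⟨_, rfl, ?_, ?_⟩
    · rw [h.nexp, h.nexp]
      simp only [dataEnv]
      rw [h.rexp hω]
      exact (h.putReal hf _ _ _ _).tick
    · simp only [State.tick, State.putReal]; omega
  | query a i j x y =>
    obtain rfl := Option.some.inj h₀
    -- The counter is incremented before the answering code runs; relocated expressions cannot see
    -- the counter array, so their values are unchanged.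
    set s₁ := (s.putNat c 0 0 (s.nat c 0 0 + 1)).tick with hs₁
    have hev : ∀ z : NExp, (z.relocate f).eval s₁ = z.eval s₀ := by
      intro z
      rw [hs₁, NExp.eval_tick, NExp.relocate_eval_putNat hc, h.nexp]
    obtain ⟨s', h1, h2, h3, h4⟩ := hans fuel (f a) (i.relocate f) (j.relocate f) (x.relocate f)
      (y.relocate f) s₁ (fun a' ha' hc' => by
        rw [← h.nat_frame a' ha' hc']
        funext i' j'
        simp [hs₁, State.tick, State.putNat, hc']) h.real_frame
    refine ⟨s', Option.bind_eq_some_iff.2 ⟨s₁, rfl, h1⟩, ?_, ?_⟩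
    · rw [hev, hev, hev, hev] at h3
      have hr := h.putReal hf a (i.eval s₀) (j.eval s₀) (o (x.eval s₀) (y.eval s₀))
      refine ⟨fun a' i' j' => ?_, fun a' i' j' => ?_, ?_, fun a' ha' hc' => ?_, fun a' ha' => ?_⟩
      · have : f a' ≠ c := fun e => hc ⟨a', e⟩
        refine Eq.trans ?_ (hr.nat a' i' j')
        rw [h2]
        simp [hs₁, State.tick, State.putNat, State.putReal, this]
      · rw [h3]
        exact hr.real a' i' j'
      · rw [h2]
        simp [hs₁, State.tick, State.putNat, State.putReal, State.countQuery, h.counter]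
      · rw [h2, ← h.nat_frame a' ha' hc']
        funext i' j'
        simp [hs₁, State.tick, State.putNat, hc']
      · rw [h3]
        exact hr.real_frame a' ha'
    · simp only [hs₁, State.tick, State.putNat, State.putReal, State.countQuery] at h4 ⊢
      omega
  | seq p q ihp ihq =>
    obtain ⟨t₀, ht₀, h₀⟩ := Option.bind_eq_some_iff.1 h₀
    obtain ⟨s₁, h1, h2, h3⟩ := ihp ht₀ h
    obtain ⟨s₂, h4, h5, h6⟩ := ihq h₀ h2
    exact ⟨s₂, Option.bind_eq_some_iff.2 ⟨s₁, h1, h4⟩, h5, by omega⟩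
  | ite b p q ihp ihq =>
    unfold Program.exec at h₀
    unfold Program.relocate Program.exec
    have hb := h.bexp hω b
    by_cases hh : b.Holds ω₀ s₀
    · rw [if_pos hh] at h₀
      rw [if_pos (show (b.relocate f g).Holds (dataEnv ω).tape s from hb.2 hh)]
      obtain ⟨s₁, h1, h2, h3⟩ := ihp h₀ h.tick
      exact ⟨s₁, h1, h2, by simp only [State.tick] at h3; omega⟩
    · rw [if_neg hh] at h₀
      rw [if_neg (show ¬ (b.relocate f g).Holds (dataEnv ω).tape s from fun e => hh (hb.1 e))]
      obtain ⟨s₁, h1, h2, h3⟩ := ihq h₀ h.tick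
      exact ⟨s₁, h1, h2, by simp only [State.tick] at h3; omega⟩
  | loop b p ih =>
    unfold Program.exec at h₀
    unfold Program.relocate Program.exec
    -- The fuel of the body stays fixed while the number `k` of permitted tests varies. Both loops
    -- evaluate the test equally often, so the simulation needs no additional fuel.
    suffices H : ∀ k s₀ s, loop (fun s => b.Holds ω₀ s) (p.exec ⟨o, ω₀⟩ fuel) k s₀ = some s₀' →
        Simulates f c t s₀ s →
        ∃ s', loop (fun s => (b.relocate f g).Holds (dataEnv ω).tape s)
            ((p.relocate f g c ans).exec (dataEnv ω) fuel) k s = some s' ∧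
          Simulates f c t s₀' s' ∧ s'.steps + 7 * s₀.steps ≤ s.steps + 7 * s₀'.steps from
      H fuel s₀ s h₀ h
    intro k
    induction k with
    | zero => intro s₀ s h₀; simp [loop] at h₀
    | succ k ihk =>
      intro s₀ s h₀ h
      have hb := h.bexp hω b
      unfold loop at h₀ ⊢
      by_cases hh : b.Holds ω₀ s₀
      · rw [if_pos hh] at h₀
        rw [if_pos (show (b.relocate f g).Holds (dataEnv ω).tape s from hb.2 hh)]
        obtain ⟨t₀, ht₀, h₀⟩ := Option.bind_eq_some_iff.1 h₀
        obtain ⟨s₁, h1, h2, h3⟩ := ih ht₀ h.tick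
        obtain ⟨s₂, h4, h5, h6⟩ := ihk _ _ h₀ h2
        exact ⟨s₂, Option.bind_eq_some_iff.2 ⟨s₁, h1, h4⟩, h5, by
          simp only [State.tick] at h3; omega⟩
      · rw [if_neg hh] at h₀
        rw [if_neg (show ¬ (b.relocate f g).Holds (dataEnv ω).tape s from fun e => hh (hb.1 e))]
        obtain rfl := Option.some.inj h₀
        exact ⟨s.tick, rfl, h.tick, by simp only [State.tick]; omega⟩

/-! ## The query answering code -/

/-- Clipping to `[0, 1]`. -/
noncomputable def clip (x : ℝ) : ℝ := max 0 (min 1 x)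

/-- Below the diagonal the code clips the complement, whereas `clipMatrix` takes the complement of
the clipped entry. -/
theorem clip_one_sub (x : ℝ) : clip (1 - x) = 1 - clip x := by
  unfold clip
  rcases le_total x 0 with h | h
  · rw [min_eq_left (by linarith), min_eq_right (by linarith), max_eq_left h]
    norm_num
  · rcases le_total x 1 with h' | h'
    · rw [min_eq_right (by linarith), min_eq_right h', max_eq_right h, max_eq_right (by linarith)]
    · rw [min_eq_right (by linarith), min_eq_left h', max_eq_left (by linarith)]
      norm_num

/-- The matrix satisfying the probability constraint that has the clipped entries of `M` above
the diagonal. -/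
noncomputable def clipMatrix {m : ℕ} (M : Fin m → Fin m → ℝ) (i j : Fin m) : ℝ :=
  if i < j then clip (M i j) else if j < i then 1 - clip (M j i) else 0

theorem clip_mem (x : ℝ) : 0 ≤ clip x ∧ clip x ≤ 1 :=
  ⟨le_max_left _ _, max_le zero_le_one (min_le_left _ _)⟩

/-- The noisy matrix itself need not satisfy the constraint. Defining the lower triangle by
complements forces the sums, and clipping forces the signs, so the guarantees for `A` apply whatever
`Q` returns. -/
theorem probConstraint_clipMatrix {m : ℕ} (M : Fin m → Fin m → ℝ) :
    ProbConstraint (clipMatrix M) := by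
  intro i j hij
  rcases lt_or_gt_of_ne hij with h | h
  · simp only [clipMatrix, h, h.not_gt, if_true, if_false]
    exact ⟨(clip_mem _).1, by ring⟩
  · simp only [clipMatrix, h, h.not_gt, if_true, if_false]
    exact ⟨by linarith [(clip_mem (M j i)).2], by ring⟩

/-- Store the clipped value of `z`. -/
def Program.clipInto (a : ℕ) (i j : NExp) (z : RExp) : Program :=
  .ite (.realLt z (.const 0)) (.setReal a i j (.const 0))
    (.ite (.realLt (.const 1) z) (.setReal a i j (.const 1)) (.setReal a i j z))

theorem Program.clipInto_exec (E : Env) (fuel a : ℕ) (i j : NExp) (z : RExp) (s : State) :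
    ∃ s', (Program.clipInto a i j z).exec E fuel s = some s' ∧ s'.nat = s.nat ∧
      s'.real = (s.putReal a (i.eval s) (j.eval s) (clip (z.eval E.tape s))).real ∧
      s'.steps ≤ s.steps + 3 := by
  by_cases h0 : z.eval E.tape s < 0
  · have : clip (z.eval E.tape s) = 0 := by
      rw [clip, min_eq_right (by linarith), max_eq_left h0.le]
    simp only [clipInto, exec, BExp.Holds, RExp.eval, Rat.cast_zero, h0, if_true, NExp.eval_tick,
      this]
    exact ⟨_, rfl, rfl, rfl, Nat.le_succ _⟩
  · by_cases h1 : 1 < z.eval E.tape s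
    · have : clip (z.eval E.tape s) = 1 := by
        rw [clip, min_eq_left h1.le, max_eq_right zero_le_one]
      simp only [clipInto, exec, BExp.Holds, RExp.eval, Rat.cast_zero, h0, if_false,
        RExp.eval_tick, Rat.cast_one, h1, if_true, NExp.eval_tick, this]
      exact ⟨_, rfl, rfl, rfl, le_rfl⟩
    · have : clip (z.eval E.tape s) = z.eval E.tape s := by
        rw [clip, min_eq_right (not_lt.1 h1), max_eq_right (not_lt.1 h0)]
      simp only [clipInto, exec, BExp.Holds, RExp.eval, Rat.cast_zero, h0, if_false,
        RExp.eval_tick, Rat.cast_one, h1, NExp.eval_tick, this]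
      exact ⟨_, rfl, rfl, rfl, le_rfl⟩

/-- Answer a query by the clipped matrix whose entries are in array `1`; the number of items is in
cell `(0, 0)` of array `5`. -/
def Program.answerClipped (a : ℕ) (i j x y : NExp) : Program :=
  .ite (.and (.natLt x (.cell 5 0)) (.natLt y (.cell 5 0)))
    (.ite (.natLt x y) (.clipInto a i j (.get 1 x y))
      (.ite (.natLt y x) (.clipInto a i j (.sub (.const 1) (.get 1 y x)))
        (.setReal a i j (.const 0))))
    (.setReal a i j (.const 0))

/-- The longest branch has three tests followed by the at most three steps of `Program.clipInto`. -/
theorem Program.answerClipped_exec {m : ℕ} (M : Fin m → Fin m → ℝ) (E : Env) (fuel a : ℕ)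
    (i j x y : NExp) (s : State) (hm : s.nat 5 0 0 = m)
    (hM : ∀ i j : Fin m, i ≠ j → s.real 1 i j = M i j) :
    ∃ s', (Program.answerClipped a i j x y).exec E fuel s = some s' ∧ s'.nat = s.nat ∧
      s'.real = (s.putReal a (i.eval s) (j.eval s)
        (weightOracle (clipMatrix M) (x.eval s) (y.eval s))).real ∧
      s'.steps ≤ s.steps + 6 := by
  by_cases hxy : x.eval s < m ∧ y.eval s < m
  · rcases lt_trichotomy (x.eval s) (y.eval s) with h | h | h
    · have hw : weightOracle (clipMatrix M) (x.eval s) (y.eval s) =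
          clip (s.real 1 (x.eval s) (y.eval s)) := by
        rw [weightOracle, dif_pos ⟨hxy.1, hxy.2, h.ne⟩, clipMatrix, if_pos (by simpa using h),
          ← hM _ _ (by simpa using h.ne)]
      obtain ⟨s', h1, h2, h3, h4⟩ := clipInto_exec E fuel a i j (.get 1 x y) s.tick.tick
      refine ⟨s', ?_, h2, ?_, ?_⟩
      · rw [← h1]
        simp [answerClipped, exec, BExp.Holds, NExp.eval, NExp.cell, hm, hxy, NExp.eval_tick, h]
      · rw [h3, hw]
        simp only [NExp.eval_tick, RExp.eval]
        rfl
      · simp only [State.tick] at h4; omega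
    · have hw : weightOracle (clipMatrix M) (x.eval s) (y.eval s) = 0 := by
        rw [weightOracle, dif_neg (by simp [h])]
      rw [hw]
      simp only [answerClipped, exec, BExp.Holds, NExp.eval, NExp.cell, hm, hxy,
        and_self, if_true, NExp.eval_tick, h, lt_irrefl, if_false, RExp.eval, Rat.cast_zero]
      exact ⟨_, rfl, rfl, rfl, by simp [State.tick, State.putReal]⟩
    · have hw : weightOracle (clipMatrix M) (x.eval s) (y.eval s) =
          clip (1 - s.real 1 (y.eval s) (x.eval s)) := by
        rw [clip_one_sub, weightOracle, dif_pos ⟨hxy.1, hxy.2, h.ne'⟩, clipMatrix,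
          if_neg (by simpa using h.le), if_pos (by simpa using h), ← hM _ _ (by simpa using h.ne)]
      obtain ⟨s', h1, h2, h3, h4⟩ := clipInto_exec E fuel a i j
        (.sub (.const 1) (.get 1 y x)) s.tick.tick.tick
      refine ⟨s', ?_, h2, ?_, ?_⟩
      · rw [← h1]
        simp [answerClipped, exec, BExp.Holds, NExp.eval, NExp.cell, hm, hxy, NExp.eval_tick, h,
          h.not_gt]
      · rw [h3, hw]
        simp only [NExp.eval_tick, RExp.eval, Rat.cast_one]
        rfl
      · simp only [State.tick] at h4; omega
  · have hw : weightOracle (clipMatrix M) (x.eval s) (y.eval s) = 0 := by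
      rw [weightOracle, dif_neg (fun h => hxy ⟨h.1, h.2.1⟩)]
    simp only [answerClipped, exec, BExp.Holds, NExp.eval, NExp.cell, hm, hxy, NExp.eval_tick,
      if_false, hw, RExp.eval, Rat.cast_zero]
    exact ⟨_, rfl, rfl, rfl, by simp [State.tick, State.putReal]⟩

/-! ## Counting loops -/

/-- Run `p` with cell `(0, k)` of array `8` ranging from `0` to `b - 1`. -/
def Program.forLoop (k : ℕ) (b : NExp) (p : Program) : Program :=
  .seq (.setNat 8 (.const 0) (.const k) (.const 0))
    (.while (.natLt (.cell 8 k) b) (.seq p (.incr 8 k)))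

/-- The invariant has to survive arbitrary writes to the counter cell, so applications examine only
the loop body. Each iteration pays for its test and its increment besides the body; the final `2` is
the initialization and the last, failing test. -/
theorem Program.Runs.forLoop {E : Env} {k : ℕ} {b : NExp} {p : Program} {N K : ℕ}
    {I : ℕ → State → Prop} (htick : ∀ i s, I i s → I i s.tick)
    (hput : ∀ i v s, I i s → I i (s.putNat 8 0 k v)) (hb : ∀ i s, I i s → b.eval s = N)
    (hp : ∀ i s, i < N → I i s → s.nat 8 0 k = i →
      p.Runs E s (fun s' => I (i + 1) s' ∧ s'.nat 8 0 k = i) K)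
    {s : State} (hs : I 0 s) : (Program.forLoop k b p).Runs E s (I N) (N * (K + 2) + 2) := by
  have hmain : ∀ s, (I 0 s ∧ s.nat 8 0 k = 0) →
      (Program.while (.natLt (.cell 8 k) b) (.seq p (.incr 8 k))).Runs E s
        (fun s => I N s ∧ s.nat 8 0 k = N) (N * (K + 1 + 1) + 1) := by
    intro s hs
    refine Program.Runs.while (I := fun i s => I i s ∧ s.nat 8 0 k = i)
      (fun i s h => ⟨htick i s h.1, h.2⟩) ?_ ?_ hs
    · intro i s hi h
      simp only [BExp.Holds, NExp.cell, NExp.eval, hb i s h.1, h.2]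
    · intro i s hi h
      refine (hp i s hi h.1 h.2).seq fun s' h' => ?_
      refine .of_exec (s' := (s'.putNat 8 0 k (s'.nat 8 0 k + 1)).tick) rfl
        ⟨htick _ _ (hput _ _ _ h'.1), ?_⟩ (by simp [State.tick, State.putNat])
      simp [State.tick, State.putNat, h'.2]
  have hset : (Program.setNat 8 (.const 0) (.const k) (.const 0)).Runs E s
      (fun s => I 0 s ∧ s.nat 8 0 k = 0) 1 :=
    .of_exec rfl ⟨htick _ _ (hput _ 0 _ hs), by simp [State.tick, State.putNat, NExp.eval]⟩
      (by simp [State.tick, State.putNat])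
  exact (hset.seq hmain).mono (fun s h => h.1) (by ring_nf; omega)

theorem Program.Runs.setNat {E : Env} {a : ℕ} {i j x : NExp} {s : State} {Q : State → Prop}
    (h : Q (s.putNat a (i.eval s) (j.eval s) (x.eval s)).tick) :
    (Program.setNat a i j x).Runs E s Q 1 :=
  .of_exec rfl h le_rfl

theorem Program.Runs.setReal {E : Env} {a : ℕ} {i j : NExp} {x : RExp} {s : State}
    {Q : State → Prop} (h : Q (s.putReal a (i.eval s) (j.eval s) (x.eval E.tape s)).tick) :
    (Program.setReal a i j x).Runs E s Q 1 :=
  .of_exec rfl h le_rfl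

/-! ## The fallback: sorting the items by noisy average positions -/

/-- Add up the positions of item `(8, 0, 0)` into cell `(0, 2)` of array `8`. -/
def Program.sumPositions : Program :=
  .forLoop 1 (.cell 0 1) (.setNat 8 (.const 0) (.const 2)
    (.add (.cell 8 2) (.get 1 (.cell 8 1) (.cell 8 0))))

/-- Compute the noisy scores in row `0` of array `5`. -/
def Program.scores : Program :=
  .forLoop 0 (.cell 0 0) (.seq (.setNat 8 (.const 0) (.const 2) (.const 0))
    (.seq .sumPositions (.setReal 5 (.const 0) (.cell 8 0)
      (.add (.draw .laplace 2 (.cell 8 0))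
        (.div (.mul (.get 0 (.const 0) (.const 0)) (.ofNat (.cell 8 2)))
          (.mul (.const 2) (.mul (.ofNat (.cell 0 0)) (.ofNat (.cell 0 0)))))))))

/-- The score computed by `Program.scores`. -/
noncomputable def scoreVal (ω : Tape) (t : State) (n m j : ℕ) : ℝ :=
  ω (.laplace, 2, j) +
    t.real 0 0 0 * ((∑ i ∈ Finset.range n, t.nat 1 i j : ℕ) : ℝ) / (2 * ((m : ℝ) * m))

theorem Program.sumPositions_runs {E : Env} {n : ℕ} {s : State} (hn : s.nat 0 0 1 = n)
    (h2 : s.nat 8 0 2 = 0) :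
    Program.sumPositions.Runs E s (fun s' => (∀ a, a ≠ 8 → s'.nat a = s.nat a) ∧
      s'.real = s.real ∧ s'.nat 8 0 0 = s.nat 8 0 0 ∧
      s'.nat 8 0 2 = ∑ i ∈ Finset.range n, s.nat 1 i (s.nat 8 0 0)) (n * 3 + 2) := by
  refine Program.Runs.forLoop (K := 1) (I := fun k s' => (∀ a, a ≠ 8 → s'.nat a = s.nat a) ∧
      s'.real = s.real ∧ s'.nat 8 0 0 = s.nat 8 0 0 ∧
      s'.nat 8 0 2 = ∑ i ∈ Finset.range k, s.nat 1 i (s.nat 8 0 0)) ?_ ?_ ?_ ?_ ?_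
  · exact fun i s h => h
  · intro i v s' h
    refine ⟨fun a ha => ?_, h.2.1, ?_, ?_⟩
    · rw [← h.1 a ha]; funext i j; simp [State.putNat, ha]
    · simp [State.putNat, h.2.2.1]
    · simp [State.putNat, h.2.2.2]
  · intro i s' h
    simp [NExp.cell, NExp.eval, h.1, hn]
  · intro i s' hi h hk
    refine .setNat ⟨⟨fun a ha => ?_, h.2.1, ?_, ?_⟩, ?_⟩
    · rw [← h.1 a ha]; funext i j; simp [State.tick, State.putNat, ha]
    · simp [State.tick, State.putNat, h.2.2.1, NExp.eval]
    · simp [State.tick, State.putNat, NExp.eval, NExp.cell, h.1, h.2.2, hk, Finset.sum_range_succ]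
    · simp [State.tick, State.putNat, NExp.eval, hk]
  · simp [h2]

theorem Program.scores_runs {ω : Tape} {n m : ℕ} {t : State} (hm : t.nat 0 0 0 = m)
    (hn : t.nat 0 0 1 = n) :
    Program.scores.Runs (dataEnv ω) t (fun s => (∀ a, a ≠ 8 → s.nat a = t.nat a) ∧
      (∀ a, a ≠ 5 → s.real a = t.real a) ∧ ∀ j < m, s.real 5 0 j = scoreVal ω t n m j)
      (m * (n * 3 + 6) + 2) := by
  refine Program.Runs.forLoop (K := n * 3 + 4) (I := fun k s => (∀ a, a ≠ 8 → s.nat a = t.nat a) ∧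
      (∀ a, a ≠ 5 → s.real a = t.real a) ∧ ∀ j < k, s.real 5 0 j = scoreVal ω t n m j)
      ?_ ?_ ?_ ?_ ?_
  · exact fun i s h => h
  · intro i v s h
    refine ⟨fun a ha => ?_, h.2.1, h.2.2⟩
    rw [← h.1 a ha]; funext i j; simp [State.putNat, ha]
  · intro i s h
    simp [NExp.cell, NExp.eval, h.1, hm]
  · intro i s hi h hk
    refine Program.Runs.mono (K := 1 + ((n * 3 + 2) + 1)) (Program.Runs.seq (Q := fun s =>
      ((∀ a, a ≠ 8 → s.nat a = t.nat a) ∧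
      (∀ a, a ≠ 5 → s.real a = t.real a) ∧ ∀ j < i, s.real 5 0 j = scoreVal ω t n m j) ∧
      s.nat 8 0 0 = i ∧ s.nat 8 0 2 = 0) (.setNat ⟨⟨fun a ha => ?_, h.2⟩, ?_, ?_⟩)
      fun s' h' => ?_) (fun _ h => h) (by omega)
    · rw [← h.1 a ha]; funext i j; simp [State.tick, State.putNat, ha]
    · simp [State.tick, State.putNat, NExp.eval, hk]
    · simp [State.tick, State.putNat, NExp.eval]
    refine (Program.sumPositions_runs (n := n) (by rw [h'.1.1 0 (by simp), hn]) h'.2.2).seq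
      fun s'' h'' => .setReal ⟨⟨fun a ha => ?_, fun a ha => ?_, fun j hj => ?_⟩, ?_⟩
    · exact (h''.1 a ha).trans (h'.1.1 a ha)
    · rw [← h'.1.2.1 a ha, ← h''.2.1]
      funext i j; simp [State.tick, State.putReal, ha]
    · have e0 : s''.nat 8 0 0 = i := h''.2.2.1.trans h'.2.1
      rcases Nat.lt_succ_iff_lt_or_eq.1 hj with hj | rfl
      · rw [← h'.1.2.2 j hj, ← h''.2.1]
        simp [State.tick, State.putReal, NExp.eval, NExp.cell, e0, hj.ne]
      · have e1 : s''.nat 0 0 0 = m := by rw [h''.1 0 (by simp), h'.1.1 0 (by simp), hm]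
        have e2 : s''.real 0 0 0 = t.real 0 0 0 := by rw [h''.2.1, h'.1.2.1 0 (by simp)]
        have e3 : s''.nat 8 0 2 = ∑ i ∈ Finset.range n, t.nat 1 i j := by
          rw [h''.2.2.2, h'.1.1 1 (by simp), h'.2.1]
        simp [State.tick, State.putReal, NExp.eval, NExp.cell, RExp.eval, e0, e1, e2, e3, scoreVal,
          dataEnv, Tape.read]
    · exact h''.2.2.1.trans h'.2.1
  · exact ⟨fun _ _ => rfl, fun _ _ => rfl, by simp⟩

/-- The test whether item `(8, 0, 1)` goes before item `(8, 0, 0)`. -/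
def BExp.before : BExp :=
  .not (.and (.not (.realLt (.get 5 (.const 0) (.cell 8 1)) (.get 5 (.const 0) (.cell 8 0))))
    (.not (.and (.not (.realLt (.get 5 (.const 0) (.cell 8 0)) (.get 5 (.const 0) (.cell 8 1))))
      (.natLt (.cell 8 1) (.cell 8 0)))))

/-- Item `i` goes before item `j` when sorting by `x`, ties being broken by the index. -/
def Before {ι : Type*} [LT ι] (x : ι → ℝ) (i j : ι) : Prop :=
  x i < x j ∨ ¬ x j < x i ∧ i < j

/-- Compute the positions of the items sorted by the scores in row `0` of array `5`. -/
def Program.positions : Program :=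
  .forLoop 0 (.cell 0 0) (.seq (.setNat 8 (.const 0) (.const 2) (.const 0))
    (.seq (.forLoop 1 (.cell 0 0) (.ite .before (.incr 8 2) .skip))
      (.setNat 2 (.const 0) (.cell 8 0) (.cell 8 2))))

open Classical in
/-- The position computed by `Program.positions`. -/
noncomputable def positionVal (x : ℕ → ℝ) (m j : ℕ) : ℕ :=
  ∑ i ∈ Finset.range m, if Before x i j then 1 else 0

theorem Program.countBefore_runs {E : Env} {m : ℕ} {s : State} (hm : s.nat 0 0 0 = m)
    (h2 : s.nat 8 0 2 = 0) :
    (Program.forLoop 1 (.cell 0 0) (.ite .before (.incr 8 2) .skip)).Runs E s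
      (fun s' => (∀ a, a ≠ 8 → s'.nat a = s.nat a) ∧
      s'.real = s.real ∧ s'.nat 8 0 0 = s.nat 8 0 0 ∧
      s'.nat 8 0 2 = positionVal (s.real 5 0) m (s.nat 8 0 0)) (m * 4 + 2) := by
  refine Program.Runs.forLoop (K := 1 + 1) (I := fun k s' => (∀ a, a ≠ 8 → s'.nat a = s.nat a) ∧
      s'.real = s.real ∧ s'.nat 8 0 0 = s.nat 8 0 0 ∧
      s'.nat 8 0 2 = positionVal (s.real 5 0) k (s.nat 8 0 0)) ?_ ?_ ?_ ?_ ?_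
  · exact fun i s h => h
  · intro i v s' h
    refine ⟨fun a ha => ?_, h.2.1, ?_, ?_⟩
    · rw [← h.1 a ha]; funext i j; simp [State.putNat, ha]
    · simp [State.putNat, h.2.2.1]
    · simp [State.putNat, h.2.2.2]
  · intro i s' h
    simp [NExp.cell, NExp.eval, h.1, hm]
  · intro i s' hi h hk
    -- Tests offer only negation and conjunction, so the disjunctions in `Before` are coded by De
    -- Morgan's law.
    have hb : BExp.before.Holds E.tape s' ↔ Before (s.real 5 0) i (s.nat 8 0 0) := by
      simp [BExp.before, BExp.Holds, NExp.cell, NExp.eval, RExp.eval, hk, h.2.1, h.2.2.1, Before,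
        imp_iff_not_or]
    refine .ite (fun hh => .setNat ⟨⟨fun a ha => ?_, h.2.1, ?_, ?_⟩, ?_⟩)
      (fun hh => .of_exec (s' := s'.tick.tick) rfl ⟨⟨h.1, h.2.1, h.2.2.1, ?_⟩, hk⟩ le_rfl)
    · rw [← h.1 a ha]; funext i j; simp [State.tick, State.putNat, ha]
    · simp [State.tick, State.putNat, h.2.2.1, NExp.eval]
    · rw [hb] at hh
      rw [positionVal, Finset.sum_range_succ, if_pos hh]
      simp [State.tick, State.putNat, NExp.eval, NExp.cell, h.2.2, positionVal]
    · simp [State.tick, State.putNat, NExp.eval, hk]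
    · rw [hb] at hh
      rw [positionVal, Finset.sum_range_succ, if_neg hh]
      exact h.2.2.2
  · simp [h2, positionVal]

theorem Program.positions_runs {E : Env} {m : ℕ} {t : State} (hm : t.nat 0 0 0 = m) :
    Program.positions.Runs E t (fun s => (∀ a, a ≠ 8 → a ≠ 2 → s.nat a = t.nat a) ∧
      s.real = t.real ∧ ∀ j < m, s.nat 2 0 j = positionVal (t.real 5 0) m j)
      (m * (m * 4 + 6) + 2) := by
  refine Program.Runs.forLoop (K := m * 4 + 4)
    (I := fun k s => (∀ a, a ≠ 8 → a ≠ 2 → s.nat a = t.nat a) ∧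
      s.real = t.real ∧ ∀ j < k, s.nat 2 0 j = positionVal (t.real 5 0) m j)
      ?_ ?_ ?_ ?_ ?_
  · exact fun i s h => h
  · intro i v s h
    refine ⟨fun a ha ha' => ?_, h.2.1, fun j hj => ?_⟩
    · rw [← h.1 a ha ha']; funext i j; simp [State.putNat, ha]
    · rw [← h.2.2 j hj]; simp [State.putNat]
  · intro i s h
    simp [NExp.cell, NExp.eval, h.1, hm]
  · intro i s hi h hk
    refine Program.Runs.mono (K := 1 + ((m * 4 + 2) + 1)) (Program.Runs.seq (Q := fun s =>
      ((∀ a, a ≠ 8 → a ≠ 2 → s.nat a = t.nat a) ∧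
      s.real = t.real ∧ ∀ j < i, s.nat 2 0 j = positionVal (t.real 5 0) m j) ∧
      s.nat 8 0 0 = i ∧ s.nat 8 0 2 = 0) (.setNat ⟨⟨fun a ha ha' => ?_, h.2.1, fun j hj => ?_⟩,
      ?_, ?_⟩) fun s' h' => ?_) (fun _ h => h) (by omega)
    · rw [← h.1 a ha ha']; funext i j; simp [State.tick, State.putNat, ha]
    · rw [← h.2.2 j hj]; simp [State.tick, State.putNat]
    · simp [State.tick, State.putNat, NExp.eval, hk]
    · simp [State.tick, State.putNat, NExp.eval]
    refine (Program.countBefore_runs (m := m) (by rw [h'.1.1 0 (by simp) (by simp), hm])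
      h'.2.2).seq fun s'' h'' => .setNat ⟨⟨fun a ha ha' => ?_, ?_, fun j hj => ?_⟩, ?_⟩
    · rw [← h'.1.1 a ha ha', ← h''.1 a ha]; funext i j; simp [State.tick, State.putNat, ha']
    · exact h''.2.1.trans h'.1.2.1
    · have e0 : s''.nat 8 0 0 = i := h''.2.2.1.trans h'.2.1
      rcases Nat.lt_succ_iff_lt_or_eq.1 hj with hj | rfl
      · rw [← h'.1.2.2 j hj, ← h''.1 2 (by simp)]
        simp [State.tick, State.putNat, NExp.eval, NExp.cell, e0, hj.ne]
      · simp [State.tick, State.putNat, NExp.eval, NExp.cell, e0, h''.2.2.2, h'.1.2.1, h'.2.1]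
    · simpa [State.tick, State.putNat, NExp.eval] using h''.2.2.1.trans h'.2.1
  · exact ⟨fun _ _ _ => rfl, rfl, by simp⟩

/-- Copy row `0` of array `10` to array `2`. -/
def Program.copyRanking : Program :=
  .forLoop 0 (.cell 5 0) (.setNat 2 (.const 0) (.cell 8 0) (.get 10 (.const 0) (.cell 8 0)))

theorem Program.copyRanking_runs {E : Env} {m : ℕ} {t : State} (hm : t.nat 5 0 0 = m) :
    Program.copyRanking.Runs E t (fun s => ∀ j < m, s.nat 2 0 j = t.nat 10 0 j)
      (m * 3 + 2) := by
  refine Program.Runs.mono (Program.Runs.forLoop (N := m) (K := 1)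
    (I := fun k s => (∀ a, a ≠ 8 → a ≠ 2 → s.nat a = t.nat a) ∧
      ∀ j < k, s.nat 2 0 j = t.nat 10 0 j) ?_ ?_ ?_ ?_ ?_) (fun s h => h.2) le_rfl
  · exact fun i s h => h
  · intro i v s h
    refine ⟨fun a ha ha' => ?_, fun j hj => ?_⟩
    · rw [← h.1 a ha ha']; funext i j; simp [State.putNat, ha]
    · rw [← h.2 j hj]; simp [State.putNat]
  · intro i s h
    simp [NExp.cell, NExp.eval, h.1, hm]
  · intro i s hi h hk
    refine .setNat ⟨⟨fun a ha ha' => ?_, fun j hj => ?_⟩, ?_⟩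
    · rw [← h.1 a ha ha']; funext i j; simp [State.tick, State.putNat, ha']
    · rcases Nat.lt_succ_iff_lt_or_eq.1 hj with hj | rfl
      · rw [← h.2 j hj]
        simp [State.tick, State.putNat, NExp.eval, NExp.cell, hk, hj.ne]
      · simp [State.tick, State.putNat, NExp.eval, NExp.cell, hk, h.1]
    · simpa [State.tick, State.putNat, NExp.eval] using hk
  · exact ⟨fun _ _ _ => rfl, by simp⟩

/-! ## Sorting items by scores -/

section Sorting

variable {m : ℕ} (x : Fin m → ℝ)

theorem Before.irrefl {ι : Type*} [LinearOrder ι] (x : ι → ℝ) (i : ι) : ¬ Before x i i := by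
  simp [Before]

/-- This is the lexicographic order of the pairs `(x i, i)`. It is a strict linear order even when
scores coincide, so no almost sure distinctness of the scores is required. -/
theorem Before.trans {ι : Type*} [LinearOrder ι] {x : ι → ℝ} {i j k : ι} (h : Before x i j)
    (h' : Before x j k) : Before x i k := by
  rcases h with h | ⟨h, hij⟩ <;> rcases h' with h' | ⟨h', hjk⟩
  · exact .inl (h.trans h')
  · exact .inl (h.trans_le (not_lt.1 h'))
  · exact .inl ((not_lt.1 h).trans_lt h')
  · exact .inr ⟨not_lt.2 ((not_lt.1 h).trans (not_lt.1 h')), hij.trans hjk⟩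

theorem Before.total {ι : Type*} [LinearOrder ι] (x : ι → ℝ) {i j : ι} (h : i ≠ j) :
    Before x i j ∨ Before x j i := by
  rcases lt_trichotomy (x i) (x j) with hx | hx | hx
  · exact .inl (.inl hx)
  · rcases lt_or_gt_of_ne h with h | h
    · exact .inl (.inr ⟨hx.le.not_gt, h⟩)
    · exact .inr (.inr ⟨hx.ge.not_gt, h⟩)
  · exact .inr (.inl hx)

open Classical in
-- By transitivity the predecessors of `i` are predecessors of `j`, and `i` itself is a new one.
-- Hence counting predecessors is injective and defines a ranking.
theorem card_before_lt {i j : Fin m} (h : Before x i j) :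
    (Finset.univ.filter fun k => Before x k i).card <
      (Finset.univ.filter fun k => Before x k j).card := by
  refine Finset.card_lt_card ⟨fun k hk => ?_, fun hs => ?_⟩
  · simp only [Finset.mem_filter, Finset.mem_univ, true_and] at hk ⊢
    exact hk.trans h
  · have := hs (show i ∈ Finset.univ.filter fun k => Before x k j by simpa using h)
    simp only [Finset.mem_filter, Finset.mem_univ, true_and] at this
    exact Before.irrefl x i this

open Classical in
theorem card_before_lt_card (i : Fin m) :
    (Finset.univ.filter fun k => Before x k i).card < m := by
  conv_rhs => rw [← Finset.card_fin m]
  exact Finset.card_lt_card ⟨Finset.filter_subset _ _, fun h =>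
    Before.irrefl x i (by simpa using h (Finset.mem_univ i))⟩

open Classical in
/-- The ranking that sorts the items by increasing scores. -/
noncomputable def sortRanking : Ranking m :=
  Equiv.ofBijective (fun j => (⟨_, card_before_lt_card x j⟩ : Fin m)) <|
    Finite.injective_iff_bijective.1 fun i j h => by
      by_contra hij
      simp only [Fin.mk.injEq] at h
      rcases Before.total x hij with hb | hb
      · exact (card_before_lt x hb).ne h
      · exact (card_before_lt x hb).ne' h

theorem before_of_sortRanking_lt {i j : Fin m} (h : sortRanking x i < sortRanking x j) :
    Before x i j := by
  classical
  have hij : i ≠ j := fun e => by simp [e] at h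
  refine (Before.total x hij).resolve_right fun hb => ?_
  exact absurd (card_before_lt x hb) (not_lt.2 (le_of_lt h))

theorem sortRanking_val (y : ℕ → ℝ) (hy : ∀ i : Fin m, y i = x i) (j : Fin m) :
    positionVal y m j = (sortRanking x j : ℕ) := by
  classical
  rw [positionVal, ← Fin.sum_univ_eq_sum_range (fun i => if Before y i j then 1 else 0) m]
  simp only [sortRanking, Equiv.ofBijective_apply, Finset.card_filter]
  refine Finset.sum_congr rfl fun i _ => ?_
  simp only [Before, hy, Fin.lt_def]

end Sorting

/-- A permutation is determined by its values, so the choice in `outRanking` is forced. -/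
theorem HoldsRanking.outRanking_eq {m : ℕ} {s : State} {σ : Ranking m} (h : HoldsRanking s σ) :
    outRanking m s = σ := by
  have hex : ∃ σ : Ranking m, HoldsRanking s σ := ⟨σ, h⟩
  rw [outRanking, dif_pos hex]
  ext j
  exact (hex.choose_spec j).symm.trans (h j)

/-! ## The private ranking algorithm -/

/-- The location of the arrays of the query answering algorithm. -/
def locQ (a : ℕ) : ℕ := if a < 2 then a else 3 * a

/-- The location of the arrays of the ranking algorithm with query access. -/
def locA (a : ℕ) : ℕ := 3 * a + 4

theorem locQ_injective : Function.Injective locQ := by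
  intro a b h
  simp only [locQ] at h
  split_ifs at h <;> omega

theorem locA_injective : Function.Injective locA := by
  intro a b h
  simp only [locA] at h
  omega

/-- Memory layout: `Q` keeps its input arrays `0` and `1` and otherwise uses multiples of `3`; `A`
uses the residue `1` from `4` on. Arrays with residue `2` are left for the fallback, the saved
parameters and the query counters. -/
theorem notMem_range_locQ {a : ℕ} (h : 2 ≤ a) (h' : a % 3 ≠ 0) : a ∉ Set.range locQ := by
  rintro ⟨b, rfl⟩
  simp only [locQ] at h h'
  split_ifs at h h' <;> omega

theorem notMem_range_locA {a : ℕ} (h' : a < 4 ∨ a % 3 ≠ 1) : a ∉ Set.range locA := by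
  rintro ⟨b, rfl⟩
  simp only [locA] at h'
  omega

/-- Save `m` and `q` in row `0` of array `5` and write the input of the relocated ranking
algorithm. -/
def Program.setup : Program :=
  .seq (.setNat 5 (.const 0) (.const 0) (.cell 0 0))
    (.seq (.setNat 5 (.const 0) (.const 2) (.cell 0 2))
      (.seq (.setNat 4 (.const 0) (.const 0) (.cell 0 0))
        (.setNat 4 (.const 0) (.const 1) (.cell 0 1))))

/-- The query answering algorithm, relocated. -/
def Program.relocateQ (Q : Program) : Program :=
  Q.relocate locQ (fun a => 3 * a) 14 (fun a i j _ _ => .setReal a i j (.const 0))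

/-- The ranking algorithm with query access, relocated, with its queries answered by clipped
entries of the matrix computed by the query answering algorithm. -/
def Program.relocateA (A : Program) : Program :=
  A.relocate locA (fun a => 3 * a + 1) 11 Program.answerClipped

/-- Rank the items by noisy average positions; then run the query answering algorithm and the
ranking algorithm, and replace the ranking unless too many queries have been made. -/
def Program.privateRanking (A Q : Program) : Program :=
  .seq .setup (.seq .scores (.seq .positions (.seq Q.relocateQ (.seq A.relocateA
    (.ite (.natLt (.cell 5 2) (.cell 11 0)) .skip .copyRanking)))))

/-- The part of the tape that consists of the streams with remainder `r` modulo `3`. -/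
def Tape.part (r : ℕ) (ω : Tape) : Tape := fun k => ω (k.1, 3 * k.2.1 + r, k.2.2)

theorem Tape.read_part (r : ℕ) (ω : Tape) (src : Source) (a i : ℕ) :
    (ω.part r).read src a i = ω.read src (3 * a + r) i := by
  cases src <;> rfl

/-- The scores of the fallback ranking. -/
noncomputable def noisyScore {n m : ℕ} (D : Dataset n m) (ε : ℝ) (L : Fin m → ℝ) (j : Fin m) : ℝ :=
  L j + ε * ((∑ k, (D k j : ℕ) : ℕ) : ℝ) / (2 * ((m : ℝ) * m))

/-- The fallback ranking. -/
noncomputable def fallback {n m : ℕ} (D : Dataset n m) (ε : ℝ) (ω : Tape) : Ranking m :=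
  sortRanking (noisyScore D ε fun j => ω (.laplace, 0, j))

open Classical in
/-- The ranking computed by `Program.privateRanking`. -/
noncomputable def privateResult (A Q : Program) {n m : ℕ} (D : Dataset n m) (q : ℕ) (ε δ : ℝ)
    (ω₀ ω₁ ω₂ : Tape) : Ranking m :=
  let s := queryRun A n (clipMatrix (answerMatrix Q D q ε δ ω₀)) ω₁
  if s.queries ≤ q then outRanking m s else fallback D ε ω₂

open Classical in
theorem privateResult_eq (A Q : Program) {n m : ℕ} (D : Dataset n m) (q : ℕ) (ε δ : ℝ)
    (ω₀ ω₁ ω₂ : Tape) : privateResult A Q D q ε δ ω₀ ω₁ ω₂ =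
      if (queryRun A n (clipMatrix (answerMatrix Q D q ε δ ω₀)) ω₁).queries ≤ q then
        outRanking m (queryRun A n (clipMatrix (answerMatrix Q D q ε δ ω₀)) ω₁)
      else fallback D ε ω₂ := rfl

/-! ### Correctness of the combined program -/

theorem Program.relocate_runs {f g : ℕ → ℕ} (hf : Function.Injective f) {c : ℕ}
    (hc : c ∉ Set.range f) {t : State} {ω₀ ω : Tape}
    (hω : ∀ src a i, ω.read src (g a) i = ω₀.read src a i) {o : ℕ → ℕ → ℝ}
    {ans : ℕ → NExp → NExp → NExp → NExp → Program} (hans : Answers f c t ω o ans)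
    {p : Program} {s₀ s₀' s : State} (h₀ : p.HaltsIn ⟨o, ω₀⟩ s₀ s₀') (h0 : s₀.steps = 0)
    (h : Simulates f c t s₀ s) :
    (p.relocate f g c ans).Runs (dataEnv ω) s (Simulates f c t s₀') (7 * s₀'.steps) := by
  obtain ⟨k, hk⟩ := h₀
  obtain ⟨s', h1, h2, h3⟩ := Program.relocate_exec hf hc hω hans hk h
  exact ⟨s', ⟨k, h1⟩, h2, by omega⟩

theorem Program.setup_runs (E : Env) (t : State) :
    Program.setup.Runs E t (fun s => s.real = t.real ∧
      s.nat = fun a i j => if a = 5 ∧ i = 0 ∧ j = 0 then t.nat 0 0 0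
        else if a = 5 ∧ i = 0 ∧ j = 2 then t.nat 0 0 2
        else if a = 4 ∧ i = 0 ∧ j = 0 then t.nat 0 0 0
        else if a = 4 ∧ i = 0 ∧ j = 1 then t.nat 0 0 1
        else t.nat a i j) 4 := by
  refine .of_exec rfl ⟨rfl, ?_⟩ le_rfl
  funext a i j
  simp only [State.tick, State.putNat, NExp.eval, NExp.cell]
  simp
  grind

/-- The fallback is computed first and `m` and `q` are saved, because the relocated `Q` may
overwrite its input. Afterwards each phase touches only its own arrays, and the frame conditions of
`Simulates` carry the other data along. -/
theorem Program.privateRanking_runs {A Q : Program} {n m : ℕ} (D : Dataset n m) (q : ℕ) (ε δ : ℝ)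
    (ω : Tape) {sQ sA : State} (hQ : Q.HaltsIn (dataEnv (ω.part 0)) (dataInput D q ε δ) sQ)
    (hA : A.HaltsIn ⟨weightOracle (clipMatrix (answerMatrix Q D q ε δ (ω.part 0))), ω.part 1⟩
      (sizeInput n m) sA) (hσ : ∃ σ : Ranking m, HoldsRanking sA σ) :
    (Program.privateRanking A Q).Runs (dataEnv ω) (dataInput D q ε δ)
      (fun s => HoldsRanking s (privateResult A Q D q ε δ (ω.part 0) (ω.part 1) (ω.part 2)))
      (4 + ((m * (n * 3 + 6) + 2) + ((m * (m * 4 + 6) + 2) + (7 * sQ.steps + (7 * sA.steps +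
        (m * 3 + 2 + 1)))))) := by
  have hQf : dataRun Q D q ε δ (ω.part 0) = sQ := hQ.final_eq
  have hAf : queryRun A n (clipMatrix (answerMatrix Q D q ε δ (ω.part 0))) (ω.part 1) = sA :=
    hA.final_eq
  set t := dataInput D q ε δ with ht
  refine (setup_runs (dataEnv ω) t).seq fun s₁ h₁ => ?_
  have hm₁ : s₁.nat 0 0 0 = m := by simp [h₁.2, ht, dataInput]
  have hn₁ : s₁.nat 0 0 1 = n := by simp [h₁.2, ht, dataInput]
  refine (scores_runs hm₁ hn₁).seq fun s₂ h₂ => ?_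
  refine (positions_runs (by rw [h₂.1 0 (by simp), hm₁])).seq fun s₃ h₃ => ?_
  have hnat₃ : ∀ a, a ≠ 8 → a ≠ 2 → s₃.nat a = s₁.nat a := fun a ha ha' =>
    (h₃.1 a ha ha').trans (h₂.1 a ha)
  have hreal₃ : ∀ a, a ≠ 5 → s₃.real a = t.real a := fun a ha => by
    rw [h₃.2.1, h₂.2.1 a ha, h₁.1]
  have hfb : ∀ j : Fin m, s₃.nat 2 0 j = (fallback D ε (ω.part 2) j : ℕ) := by
    intro j
    rw [h₃.2.2 j j.2]
    refine sortRanking_val _ _ (fun i => ?_) j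
    rw [h₂.2.2 i i.2, scoreVal, noisyScore, h₁.1]
    have hsum : (∑ k ∈ Finset.range n, s₁.nat 1 k i) = ∑ k, (D k i : ℕ) := by
      rw [← Fin.sum_univ_eq_sum_range (fun k => s₁.nat 1 k i) n]
      refine Finset.sum_congr rfl fun k _ => ?_
      simp [h₁.2, ht, dataInput]
    rw [hsum]
    -- The scores draw from stream `2`, which is stream `0` of part `2` of the tape.
    simp [ht, dataInput, Tape.part]
  -- the query answering algorithm
  have hsimQ : Simulates locQ 14 s₃ t s₃ := by
    refine ⟨fun a i j => ?_, fun a i j => ?_, ?_, fun _ _ _ => rfl, fun _ _ => rfl⟩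
    · rw [hnat₃ _ (by unfold locQ; split_ifs <;> omega) (by unfold locQ; split_ifs <;> omega),
        h₁.2]
      have h4 : locQ a ≠ 4 := by unfold locQ; split_ifs <;> omega
      have h5 : locQ a ≠ 5 := by unfold locQ; split_ifs <;> omega
      simp only [h4, h5, false_and, if_false]
      by_cases ha : a < 2
      · simp [locQ, ha]
      · have : locQ a = 3 * a := by simp [locQ, ha]
        have e1 : 3 * a ≠ 1 := by omega
        have e2 : a ≠ 0 := by omega
        have e3 : a ≠ 1 := by omega
        simp [ht, dataInput, this, e1, e2, e3]
    · rw [hreal₃ _ (by unfold locQ; split_ifs <;> omega)]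
      by_cases ha : a < 2
      · simp [locQ, ha]
      · have : locQ a = 3 * a := by simp [locQ, ha]
        have e2 : a ≠ 0 := by omega
        simp [ht, dataInput, this, e2]
    · rw [hnat₃ _ (by simp) (by simp), h₁.2]
      simp [ht, dataInput]
  -- The oracle of `dataEnv` is constantly `0`, so a query of `Q` may be replaced by storing `0`;
  -- the count in array `14` is never read.
  refine (Program.relocate_runs locQ_injective (notMem_range_locQ (by simp) (by simp))
    (ω₀ := ω.part 0) (fun src a i => by rw [Tape.read_part, add_zero]) (o := fun _ _ => 0)
    (fun fuel a i j x y s _ _ => by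
      refine ⟨_, rfl, rfl, ?_, ?_⟩
      · simp [RExp.eval, State.tick]
      · simp [State.tick, State.putReal]) hQ rfl hsimQ).seq fun s₄ h₄ => ?_
  -- the ranking algorithm
  have hnat₄ : ∀ a, 2 ≤ a → a % 3 ≠ 0 → a ≠ 14 → s₄.nat a = s₃.nat a := fun a ha ha' h14 =>
    h₄.nat_frame a (notMem_range_locQ ha ha') h14
  have hm₄ : s₄.nat 5 0 0 = m := by
    rw [hnat₄ 5 (by simp) (by simp) (by simp), hnat₃ 5 (by simp) (by simp), h₁.2]
    simp [ht, dataInput]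
  have hq₄ : s₄.nat 5 0 2 = q := by
    rw [hnat₄ 5 (by simp) (by simp) (by simp), hnat₃ 5 (by simp) (by simp), h₁.2]
    simp [ht, dataInput]
  have hM₄ : ∀ i j : Fin m, i ≠ j → s₄.real 1 i j = answerMatrix Q D q ε δ (ω.part 0) i j := by
    intro i j hij
    rw [answerMatrix, if_neg hij, hQf]
    exact h₄.real 1 i j
  have hsimA : Simulates locA 11 s₄ (sizeInput n m) s₄ := by
    refine ⟨fun a i j => ?_, fun a i j => ?_, ?_, fun _ _ _ => rfl, fun _ _ => rfl⟩
    · by_cases h14 : locA a = 14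
      · simp only [locA] at h14; omega
      rw [hnat₄ _ (by simp only [locA]; omega) (by simp only [locA]; omega) h14,
        hnat₃ _ (by simp only [locA]; omega) (by simp only [locA]; omega), h₁.2]
      have h5 : locA a ≠ 5 := by simp only [locA]; omega
      by_cases ha : a = 0
      · subst ha
        simp [locA, ht, dataInput, sizeInput]
      · have h4 : locA a ≠ 4 := by simp only [locA]; omega
        have h0 : locA a ≠ 0 := by simp only [locA]; omega
        have h1 : locA a ≠ 1 := by simp only [locA]; omega
        simp [h4, h5, h0, h1, ha, ht, dataInput, sizeInput]
    · rw [h₄.real_frame _ (notMem_range_locQ (by simp only [locA]; omega)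
        (by simp only [locA]; omega)), hreal₃ _ (by simp only [locA]; omega)]
      simp [ht, dataInput, sizeInput, locA]
    · rw [hnat₄ _ (by simp) (by simp) (by simp), hnat₃ _ (by simp) (by simp), h₁.2]
      simp [ht, dataInput, sizeInput]
  refine (Program.relocate_runs locA_injective (notMem_range_locA (by simp))
    (ω₀ := ω.part 1) (fun src a i => by rw [Tape.read_part])
    (fun fuel a i j x y s hs hs' => answerClipped_exec _ _ fuel a i j x y s
      (by rw [hs 5 (notMem_range_locA (by simp)) (by simp), hm₄]) (fun i' j' hij => by
        rw [hs' 1 (notMem_range_locA (by simp)), hM₄ i' j' hij])) hA rfl hsimA).seq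
    fun s₅ h₅ => ?_
  have hcnt : s₅.nat 11 0 0 = sA.queries := h₅.counter
  have hm₅ : s₅.nat 5 0 0 = m := by
    rw [h₅.nat_frame 5 (notMem_range_locA (by simp)) (by simp), hm₄]
  have hq₅ : s₅.nat 5 0 2 = q := by
    rw [h₅.nat_frame 5 (notMem_range_locA (by simp)) (by simp), hq₄]
  have hres : privateResult A Q D q ε δ (ω.part 0) (ω.part 1) (ω.part 2) =
      if sA.queries ≤ q then outRanking m sA else fallback D ε (ω.part 2) := by
    rw [privateResult, hAf]
  rw [hres]
  refine .ite (fun hb => ?_) (fun hb => ?_)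
  · have hb' : ¬ sA.queries ≤ q := by
      simpa [BExp.Holds, NExp.eval, NExp.cell, hcnt, hq₅] using hb
    refine .of_exec rfl ?_ (by simp [State.tick])
    rw [if_neg hb']
    intro j
    -- Neither relocated program touches array `2`, so the fallback is still there.
    have e : s₅.nat 2 = s₃.nat 2 := (h₅.nat_frame 2 (notMem_range_locA (by simp)) (by simp)).trans
      (hnat₄ 2 (by simp) (by simp) (by simp))
    change s₅.nat 2 0 j = _
    rw [e, hfb j]
  · have hb' : sA.queries ≤ q := by
      simpa [BExp.Holds, NExp.eval, NExp.cell, hcnt, hq₅] using hb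
    refine (copyRanking_runs (t := s₅.tick) hm₅).mono (fun s hs => ?_) le_rfl
    rw [if_pos hb']
    obtain ⟨σ, hσ⟩ := hσ
    rw [hσ.outRanking_eq]
    intro j
    rw [hs j j.2]
    -- The output array `2` of `A` was moved to `locA 2 = 10`, from which the ranking is copied.
    exact (h₅.nat 2 0 j).trans (hσ j)

/-! ## Adaptive strategies -/

section Adaptive

variable {m : ℕ}

/-- The matrix with the entries `a` at the pairs asked for by `K`, and `0` elsewhere; `K M k` is
the query number `k` on the matrix `M`. -/
noncomputable def fillMatrix (K : (Fin m → Fin m → ℝ) → ℕ → Fin m × Fin m) :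
    (k : ℕ) → (Fin k → ℝ) → Fin m → Fin m → ℝ
  | 0, _ => 0
  | k + 1, a => fun i j =>
      if (i, j) = K (fillMatrix K k (Fin.init a)) k then a (Fin.last k)
      else fillMatrix K k (Fin.init a) i j

theorem measurable_fillMatrix {K : (Fin m → Fin m → ℝ) → ℕ → Fin m × Fin m}
    (hK : ∀ k, Measurable fun M => K M k) (k : ℕ) : Measurable (fillMatrix K k) := by
  induction k with
  | zero => exact measurable_const
  | succ k ih =>
    have hi : Measurable fun a : Fin (k + 1) → ℝ => fillMatrix K k (Fin.init a) :=
      ih.comp (measurable_pi_iff.2 fun i => measurable_pi_apply _)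
    refine measurable_pi_iff.2 fun i => measurable_pi_iff.2 fun j => ?_
    refine Measurable.ite (measurableSet_eq_fun measurable_const ((hK k).comp hi))
      (measurable_pi_apply _) ?_
    exact (measurable_pi_apply j).comp ((measurable_pi_apply i).comp hi)

/-- The strategy that asks for the queries of `K`. -/
noncomputable def adaptiveStrategy (K : (Fin m → Fin m → ℝ) → ℕ → Fin m × Fin m)
    (hK : ∀ k, Measurable fun M => K M k) : Strategy m where
  next k a := K (fillMatrix K k a) k
  measurable_next k := (hK k).comp (measurable_fillMatrix hK k)

variable {X : Type*} {K : (Fin m → Fin m → ℝ) → ℕ → Fin m × Fin m}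
  {N : (Fin m → Fin m → ℝ) → ℕ} {R : (Fin m → Fin m → ℝ) → X}

/-- The matrix reconstructed from the first `k` answers has the right entries at the first `k`
queries. -/
theorem fillMatrix_answers (hK : ∀ k, Measurable fun M => K M k)
    (h : ∀ M M', (K M = K M' ∧ N M = N M' ∧ R M = R M') ∨
      ∃ d, d < N M ∧ d < N M' ∧ (∀ k ≤ d, K M k = K M' k) ∧
        M (K M d).1 (K M d).2 ≠ M' (K M d).1 (K M d).2)
    (M : Fin m → Fin m → ℝ) (k : ℕ) :
    (∀ i < k, fillMatrix K k ((adaptiveStrategy K hK).answers M k) (K M i).1 (K M i).2 =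
      M (K M i).1 (K M i).2) ∧
    K (fillMatrix K k ((adaptiveStrategy K hK).answers M k)) k = K M k := by
  -- The next query depends only on the entries already asked for: a divergence before query `k`
  -- would need a differing entry among them.
  have hsame : ∀ M' : Fin m → Fin m → ℝ, (∀ i < k, M' (K M i).1 (K M i).2 =
      M (K M i).1 (K M i).2) → K M' k = K M k := by
    intro M' hM'
    rcases h M M' with h1 | ⟨d, -, -, hd, hne⟩
    · rw [h1.1]
    · rcases lt_or_ge d k with hk | hk
      · exact absurd (hM' d hk).symm hne
      · exact (hd k hk).symm
  -- By `hsame` the second claim follows from the first, so both goals are now the same and one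
  -- induction proves them.
  refine ⟨?_, hsame _ ?_⟩ <;> clear hsame
  all_goals
    induction k with
    | zero => simp
    | succ k ih =>
      have hk : K (fillMatrix K k ((adaptiveStrategy K hK).answers M k)) k = K M k := by
        rcases h M (fillMatrix K k ((adaptiveStrategy K hK).answers M k)) with h1 | ⟨d, -, -, hd, hne⟩
        · rw [← h1.1]
        · rcases lt_or_ge d k with hk | hk
          · exact absurd (ih d hk).symm hne
          · exact (hd k hk).symm
      intro i hi
      simp only [fillMatrix, Strategy.answers, Fin.init_snoc, Fin.snoc_last]
      have hnext : (adaptiveStrategy K hK).next k ((adaptiveStrategy K hK).answers M k) =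
        K M k := hk
      rw [hnext, hk]
      -- A repeated query overwrites an entry, but with the same value.
      by_cases hik : K M i = K M k
      · simp [hik]
      · rw [if_neg (by simpa using hik)]
        rcases Nat.lt_succ_iff_lt_or_eq.1 hi with hi | rfl
        · exact ih i hi
        · exact absurd rfl hik

/-- The outcome of at most `q` adaptive queries is a function of the answers. -/
theorem exists_measurableSet_answers [MeasurableSpace X] [DiscreteMeasurableSpace X]
    (hK : ∀ k, Measurable fun M => K M k) (hN : Measurable N)
    (hR : Measurable R)
    (h : ∀ M M', (K M = K M' ∧ N M = N M' ∧ R M = R M') ∨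
      ∃ d, d < N M ∧ d < N M' ∧ (∀ k ≤ d, K M k = K M' k) ∧
        M (K M d).1 (K M d).2 ≠ M' (K M d).1 (K M d).2) (q : ℕ) (V : Set X) (b : Prop) :
    ∃ U : Set (Fin q → ℝ), MeasurableSet U ∧ ∀ M,
      (adaptiveStrategy K hK).answers M q ∈ U ↔ (N M ≤ q ∧ R M ∈ V ∨ ¬ N M ≤ q ∧ b) := by
  have hf := measurable_fillMatrix hK q
  refine ⟨{a | N (fillMatrix K q a) ≤ q ∧ R (fillMatrix K q a) ∈ V ∨
    ¬ N (fillMatrix K q a) ≤ q ∧ b}, ?_, fun M => ?_⟩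
  · have h1 : MeasurableSet {a | N (fillMatrix K q a) ≤ q} :=
      measurableSet_le (hN.comp hf) measurable_const
    have h2 : MeasurableSet {a | R (fillMatrix K q a) ∈ V} :=
      (hR.comp hf) (MeasurableSet.of_discrete (s := V))
    exact (h1.inter h2).union (h1.compl.inter (MeasurableSet.const b))
  · rcases h M (fillMatrix K q ((adaptiveStrategy K hK).answers M q)) with h1 | ⟨d, hd, hd', -, hne⟩
    · simp only [Set.mem_ofPred_eq, h1.2.1, h1.2.2]
    · have hq : q ≤ d := by
        by_contra hlt
        exact hne ((fillMatrix_answers hK h M q).1 d (by omega)).symm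
      have e1 : ¬ N M ≤ q := by omega
      have e2 : ¬ N (fillMatrix K q ((adaptiveStrategy K hK).answers M q)) ≤ q := by omega
      simp only [Set.mem_ofPred_eq, e1, e2, false_and, not_false_eq_true, true_and, false_or]

end Adaptive

/-! ## The queries of a ranking algorithm -/

theorem loopLog_mono {g : State → Prop}
    {f f' : State × List (ℕ × ℕ) → Option (State × List (ℕ × ℕ))}
    (hf : ∀ s s', f s = some s' → f' s = some s') {fuel fuel' : ℕ} (h : fuel ≤ fuel')
    {s s' : State × List (ℕ × ℕ)} (hs : loopLog g f fuel s = some s') :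
    loopLog g f' fuel' s = some s' := by
  induction fuel generalizing fuel' s with
  | zero => simp [loopLog] at hs
  | succ k ih =>
    obtain ⟨k', rfl⟩ : ∃ k', fuel' = k' + 1 := ⟨fuel' - 1, by omega⟩
    unfold loopLog at hs ⊢
    split_ifs at hs ⊢ with hg
    · obtain ⟨t, ht, hs⟩ := Option.bind_eq_some_iff.1 hs
      exact Option.bind_eq_some_iff.2 ⟨t, hf _ _ ht, ih (by omega) hs⟩
    · exact hs

theorem Program.execLog_mono {E : Env} {fuel fuel' : ℕ} (h : fuel ≤ fuel') {p : Program}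
    {s s' : State × List (ℕ × ℕ)} (hs : p.execLog E fuel s = some s') :
    p.execLog E fuel' s = some s' := by
  induction p using Program.inductionOn generalizing s s' with
  | seq p q ihp ihq =>
    obtain ⟨t, ht, hs⟩ := Option.bind_eq_some_iff.1 hs
    exact Option.bind_eq_some_iff.2 ⟨t, ihp ht, ihq hs⟩
  | ite b p q ihp ihq =>
    unfold Program.execLog at hs ⊢
    split_ifs at hs ⊢
    · exact ihp hs
    · exact ihq hs
  | loop b p ih => exact loopLog_mono (fun s s' => ih) h hs
  | _ => exact hs

instance {m : ℕ} : MeasurableSpace (Ranking m) := ⊤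

/-- Only `m` natural-number cells are read, and any function on a countable discrete space is
measurable, including one defined by choice. -/
theorem measurable_outRanking (m : ℕ) : Measurable (outRanking m) := by
  classical
  have h : outRanking m = (fun v : Fin m → ℕ =>
      if h : ∃ σ : Ranking m, ∀ j, v j = (σ j : ℕ) then h.choose else 1) ∘
      fun (s : State) (j : Fin m) => s.nat 2 0 j := by
    funext s
    by_cases h : ∃ σ : Ranking m, HoldsRanking s σ
    · rw [outRanking, dif_pos h]
      exact (dif_pos h).symm
    · have h' : ¬ ∃ σ : Ranking m, ∀ j : Fin m, s.nat 2 0 j = (σ j : ℕ) := h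
      rw [outRanking, dif_neg h, Function.comp_apply, dif_neg h']
  rw [h]
  exact (measurable_of_countable _).comp
    (measurable_pi_iff.2 fun j => (measurable_state_iff.1 measurable_id).1 2 0 j)

/-- The entry of the matrix above the diagonal that determines the answer to a query; a diagonal
entry if there is none. -/
def queryPair {m : ℕ} (hm : 0 < m) (c : ℕ × ℕ) : Fin m × Fin m :=
  if h : c.1 < m ∧ c.2 < m then
    if c.1 < c.2 then (⟨c.1, h.1⟩, ⟨c.2, h.2⟩) else (⟨c.2, h.2⟩, ⟨c.1, h.1⟩)
  else (⟨0, hm⟩, ⟨0, hm⟩)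

/-- One entry of the noisy matrix determines the answer to a query, so each query of `A` uses only
one of the `q` answers that `Q` protects. -/
theorem weightOracle_clipMatrix_congr {m : ℕ} (hm : 0 < m) {M M' : Fin m → Fin m → ℝ} (c : ℕ × ℕ)
    (h : M (queryPair hm c).1 (queryPair hm c).2 = M' (queryPair hm c).1 (queryPair hm c).2) :
    weightOracle (clipMatrix M) c.1 c.2 = weightOracle (clipMatrix M') c.1 c.2 := by
  unfold weightOracle
  split_ifs with hc
  · rw [queryPair, dif_pos ⟨hc.1, hc.2.1⟩] at h
    unfold clipMatrix
    rcases lt_or_gt_of_ne hc.2.2 with hlt | hlt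
    · rw [if_pos hlt] at h
      simp only [Fin.mk_lt_mk, hlt, if_true, h]
    · rw [if_neg hlt.not_gt] at h
      simp only [Fin.mk_lt_mk, hlt, hlt.not_gt, if_true, if_false, h]
  · rfl

/-- Query number `k` according to a log. -/
def logPair {m : ℕ} (hm : 0 < m) (l : List (ℕ × ℕ)) (k : ℕ) : Fin m × Fin m :=
  (l.reverse[k]?).elim (⟨0, hm⟩, ⟨0, hm⟩) (queryPair hm)

/-- Logs list the latest query first, so a common suffix is a common initial segment in time. -/
theorem getElem?_reverse_of_suffix {α : Type*} {c : α} {r l : List α} (h : c :: r <:+ l) {k : ℕ}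
    (hk : k ≤ r.length) : l.reverse[k]? = (c :: r).reverse[k]? := by
  obtain ⟨t, rfl⟩ := h
  rw [List.reverse_append, List.getElem?_append_left (by simp; omega)]

theorem measurable_clipMatrix {m : ℕ} (i j : Fin m) :
    Measurable fun M : Fin m → Fin m → ℝ => clipMatrix M i j := by
  have h : ∀ i j : Fin m, Measurable fun M : Fin m → Fin m → ℝ => clip (M i j) := fun i j => by
    unfold clip; fun_prop
  unfold clipMatrix
  split_ifs
  · exact h i j
  · exact measurable_const.sub (h j i)
  · exact measurable_const

theorem measurable_queryEnv {m : ℕ} :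
    Measurable fun p : (Fin m → Fin m → ℝ) × Tape =>
      (⟨weightOracle (clipMatrix p.1), p.2⟩ : Env) := by
  refine measurable_env_iff.2 ⟨fun x y => ?_, measurable_snd⟩
  by_cases h : x < m ∧ y < m ∧ x ≠ y
  · simp only [weightOracle, h, ne_eq, not_false_eq_true, and_self, dite_true]
    exact (measurable_clipMatrix _ _).comp measurable_fst
  · simp only [weightOracle, h, dite_false]
    exact measurable_const

/-- The run of `A` on the clipped matrix, with its log. -/
theorem exists_queryLog {A : Program} (hA : PolyTimeQueryRanking A) {n m : ℕ} (hn : 1 ≤ n)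
    (hm : 1 ≤ m) :
    ∃ L : (Fin m → Fin m → ℝ) × Tape → State × List (ℕ × ℕ), Measurable L ∧
      ∀ p, (L p).1 = queryRun A n (clipMatrix p.1) p.2 ∧
        ∃ fuel, A.execLog ⟨weightOracle (clipMatrix p.1), p.2⟩ fuel (sizeInput n m, []) =
          some (L p) := by
  obtain ⟨T, hT⟩ := hA
  refine Program.measurable_log measurable_queryEnv A (s := fun _ => sizeInput n m)
    measurable_const fun p => ?_
  obtain ⟨s', h, -⟩ := hT n m hn hm _ (probConstraint_clipMatrix p.1) p.2
  exact ⟨s', h⟩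

theorem measurable_queryRun {A : Program} (hA : PolyTimeQueryRanking A) {n m : ℕ} (hn : 1 ≤ n)
    (hm : 1 ≤ m) :
    Measurable fun p : (Fin m → Fin m → ℝ) × Tape => queryRun A n (clipMatrix p.1) p.2 := by
  obtain ⟨L, hL, h⟩ := exists_queryLog hA hn hm
  convert hL.fst using 2 with p
  exact (h p).1.symm

/-- With a fixed tape, the result of `A` is determined by the answers to a query strategy,
provided that at most `q` queries are made. -/
theorem exists_strategy {A : Program} (hA : PolyTimeQueryRanking A) {n m : ℕ} (hn : 1 ≤ n)
    (hm : 1 ≤ m) (ω : Tape) (q : ℕ) :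
    ∃ S : Strategy m, ∀ (V : Set (Ranking m)) (b : Prop), ∃ U : Set (Fin q → ℝ),
      MeasurableSet U ∧ ∀ M, S.answers M q ∈ U ↔
        ((queryRun A n (clipMatrix M) ω).queries ≤ q ∧
          outRanking m (queryRun A n (clipMatrix M) ω) ∈ V ∨
        ¬ (queryRun A n (clipMatrix M) ω).queries ≤ q ∧ b) := by
  obtain ⟨L, hL, hrun⟩ := exists_queryLog hA hn hm
  have hLω : Measurable fun M => L (M, ω) := hL.comp measurable_prodMk_right
  have hlen : ∀ M, (L (M, ω)).2.length = (L (M, ω)).1.queries := by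
    intro M
    obtain ⟨fuel, hf⟩ := (hrun (M, ω)).2
    simpa [sizeInput] using (Program.execLog_extends hf).2.symm
  have hK : ∀ k, Measurable fun M => logPair hm (L (M, ω)).2 k := fun k =>
    (measurable_from_top (f := fun l => logPair hm l k)).comp hLω.snd
  have htwo : ∀ M M', ((fun k => logPair hm (L (M, ω)).2 k) = (fun k => logPair hm (L (M', ω)).2 k)
        ∧ (L (M, ω)).1.queries = (L (M', ω)).1.queries
        ∧ outRanking m (L (M, ω)).1 = outRanking m (L (M', ω)).1) ∨
      ∃ d, d < (L (M, ω)).1.queries ∧ d < (L (M', ω)).1.queries ∧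
        (∀ k ≤ d, logPair hm (L (M, ω)).2 k = logPair hm (L (M', ω)).2 k) ∧
        M (logPair hm (L (M, ω)).2 d).1 (logPair hm (L (M, ω)).2 d).2 ≠
          M' (logPair hm (L (M, ω)).2 d).1 (logPair hm (L (M, ω)).2 d).2 := by
    intro M M'
    obtain ⟨f₁, h₁⟩ := (hrun (M, ω)).2
    obtain ⟨f₂, h₂⟩ := (hrun (M', ω)).2
    rcases Program.execLog_eq_or_diverged (Program.execLog_mono (le_max_left f₁ f₂) h₁)
      (Program.execLog_mono (le_max_right f₁ f₂) h₂) with he | ⟨c, r, hne, hs, hs'⟩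
    · left
      rw [he]
      exact ⟨rfl, rfl, rfl⟩
    · right
      have l1 := hs.length_le
      have l2 := hs'.length_le
      rw [hlen, List.length_cons] at l1 l2
      -- The diverging query `c` comes after the `r.length` common queries in `r`, so this is its
      -- index when counting from `0`.
      refine ⟨r.length, l1, l2, fun k hk => ?_, fun heq => hne ?_⟩
      · rw [logPair, logPair, getElem?_reverse_of_suffix hs hk, getElem?_reverse_of_suffix hs' hk]
      · have hp : logPair hm (L (M, ω)).2 r.length = queryPair hm c := by
          rw [logPair, getElem?_reverse_of_suffix hs le_rfl]
          simp
        rw [hp] at heq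
        exact weightOracle_clipMatrix_congr hm c heq
  -- A strategy must always ask another pair; once the run has ended, `logPair` asks for a diagonal
  -- entry.
  refine ⟨adaptiveStrategy (fun M k => logPair hm (L (M, ω)).2 k) hK, fun V b => ?_⟩
  obtain ⟨U, hU, hUM⟩ := exists_measurableSet_answers hK
    (N := fun M => (L (M, ω)).1.queries) (R := fun M => outRanking m (L (M, ω)).1)
    ((measurable_state_iff.1 hLω.fst).2.2.2) ((measurable_outRanking m).comp hLω.fst) htwo q V b
  refine ⟨U, hU, fun M => ?_⟩
  rw [hUM, (hrun (M, ω)).1]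

/-! ## Splitting the tape -/

instance : IsProbabilityMeasure tapeLaw :=
  inferInstanceAs (IsProbabilityMeasure (Measure.infinitePi _))

/-- The location on the tape of the draw `k` of part `r`. -/
def tapeIndex (r : ℕ) (k : Source × ℕ × ℕ) : Source × ℕ × ℕ := (k.1, 3 * k.2.1 + r, k.2.2)

theorem tapeIndex_injective (r : ℕ) : Function.Injective (tapeIndex r) := by
  rintro ⟨s, a, i⟩ ⟨s', a', i'⟩ h
  simp only [tapeIndex, Prod.mk.injEq] at h ⊢
  exact ⟨h.1, by omega, h.2.2⟩

theorem mem_range_tapeIndex {r : ℕ} (hr : r < 3) (k : Source × ℕ × ℕ) :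
    k ∈ Set.range (tapeIndex r) ↔ k.2.1 % 3 = r := by
  constructor
  · rintro ⟨k, rfl⟩
    simp only [tapeIndex]
    omega
  · intro h
    refine ⟨(k.1, k.2.1 / 3, k.2.2), ?_⟩
    ext
    · rfl
    · simp only [tapeIndex]; omega
    · rfl

theorem Tape.measurable_part (r : ℕ) : Measurable (Tape.part r) :=
  measurable_pi_iff.2 fun _ => measurable_pi_apply _

/-- Put a tape together from three parts. -/
def mergeTapes (p : Tape × Tape × Tape) : Tape := fun k =>
  if k.2.1 % 3 = 0 then p.1 (k.1, k.2.1 / 3, k.2.2)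
  else if k.2.1 % 3 = 1 then p.2.1 (k.1, k.2.1 / 3, k.2.2)
  else p.2.2 (k.1, k.2.1 / 3, k.2.2)

theorem measurable_mergeTapes : Measurable mergeTapes := by
  refine measurable_pi_iff.2 fun k => ?_
  unfold mergeTapes
  split_ifs <;> fun_prop

theorem mergeTapes_tapeIndex (p : Tape × Tape × Tape) (k : Source × ℕ × ℕ) :
    mergeTapes p (tapeIndex 0 k) = p.1 k ∧ mergeTapes p (tapeIndex 1 k) = p.2.1 k ∧
      mergeTapes p (tapeIndex 2 k) = p.2.2 k := by
  have h1 : (3 * k.2.1 + 1) % 3 = 1 := by omega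
  have h2 : (3 * k.2.1 + 2) % 3 = 2 := by omega
  have h1' : (3 * k.2.1 + 1) / 3 = k.2.1 := by omega
  have h2' : (3 * k.2.1 + 2) / 3 = k.2.1 := by omega
  simp [mergeTapes, tapeIndex, h1, h2, h1', h2']

theorem mergeTapes_preimage_pi (s : Finset (Source × ℕ × ℕ)) (t : Source × ℕ × ℕ → Set ℝ) :
    mergeTapes ⁻¹' (Set.pi s t) =
      (Set.pi (s.preimage (tapeIndex 0) (tapeIndex_injective 0).injOn) fun k => t (tapeIndex 0 k)) ×ˢ
      (Set.pi (s.preimage (tapeIndex 1) (tapeIndex_injective 1).injOn) fun k => t (tapeIndex 1 k)) ×ˢ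
      (Set.pi (s.preimage (tapeIndex 2) (tapeIndex_injective 2).injOn) fun k => t (tapeIndex 2 k)) := by
  ext p
  simp only [Set.mem_preimage, Set.mem_pi, Set.mem_prod, Finset.coe_preimage, Finset.mem_coe]
  constructor
  · intro h
    refine ⟨fun k hk => ?_, fun k hk => ?_, fun k hk => ?_⟩
    · rw [← (mergeTapes_tapeIndex p k).1]; exact h _ hk
    · rw [← (mergeTapes_tapeIndex p k).2.1]; exact h _ hk
    · rw [← (mergeTapes_tapeIndex p k).2.2]; exact h _ hk
  · rintro ⟨h0, h1, h2⟩ k hk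
    have h3 : k.2.1 % 3 = 0 ∨ k.2.1 % 3 = 1 ∨ k.2.1 % 3 = 2 := by omega
    rcases h3 with h | h | h
    · obtain ⟨k, rfl⟩ := (mem_range_tapeIndex (by norm_num) k).2 h
      rw [(mergeTapes_tapeIndex p k).1]; exact h0 k hk
    · obtain ⟨k, rfl⟩ := (mem_range_tapeIndex (by norm_num) k).2 h
      rw [(mergeTapes_tapeIndex p k).2.1]; exact h1 k hk
    · obtain ⟨k, rfl⟩ := (mem_range_tapeIndex (by norm_num) k).2 h
      rw [(mergeTapes_tapeIndex p k).2.2]; exact h2 k hk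

/-- Only coordinates in the residue class `r` are constrained. The factor `1` for the others lets
all three classes be written over the same index set. -/
theorem tapeLaw_preimage_pi (r : ℕ) (s : Finset (Source × ℕ × ℕ)) (t : Source × ℕ × ℕ → Set ℝ)
    (ht : ∀ k, MeasurableSet (t k)) (hr : r < 3) :
    tapeLaw (Set.pi (s.preimage (tapeIndex r) (tapeIndex_injective r).injOn)
      fun k => t (tapeIndex r k)) = ∏ k ∈ s, if k.2.1 % 3 = r then k.1.law (t k) else 1 := by
  classical
  rw [tapeLaw, Measure.infinitePi_pi _ (fun k _ => ht _)]
  have := Finset.prod_preimage' (tapeIndex r) s (tapeIndex_injective r).injOn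
    (fun k => k.1.law (t k))
  rw [Finset.prod_filter] at this
  simp only [mem_range_tapeIndex hr] at this
  exact this

/-- An infinite product measure is determined by finite boxes. The preimage of a box is a product of
three boxes, and each coordinate contributes to exactly one of them. -/
theorem map_mergeTapes : (tapeLaw.prod (tapeLaw.prod tapeLaw)).map mergeTapes = tapeLaw := by
  refine Measure.eq_infinitePi _ fun s t ht => ?_
  rw [Measure.map_apply measurable_mergeTapes
    (MeasurableSet.pi s.countable_toSet fun k _ => ht k), mergeTapes_preimage_pi,
    Measure.prod_prod, Measure.prod_prod, tapeLaw_preimage_pi 0 s t ht (by norm_num),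
    tapeLaw_preimage_pi 1 s t ht (by norm_num), tapeLaw_preimage_pi 2 s t ht (by norm_num),
    ← Finset.prod_mul_distrib, ← Finset.prod_mul_distrib]
  refine Finset.prod_congr rfl fun k _ => ?_
  have h3 : k.2.1 % 3 = 0 ∨ k.2.1 % 3 = 1 ∨ k.2.1 % 3 = 2 := by omega
  rcases h3 with h | h | h <;> simp [h]

/-- Splitting undoes merging, and merging three independent tapes yields a tape with the right law.
-/
theorem map_tapeParts : tapeLaw.map (fun ω => (ω.part 0, ω.part 1, ω.part 2)) =
    tapeLaw.prod (tapeLaw.prod tapeLaw) := by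
  have hm : Measurable fun ω : Tape => (ω.part 0, ω.part 1, ω.part 2) :=
    (Tape.measurable_part 0).prodMk ((Tape.measurable_part 1).prodMk (Tape.measurable_part 2))
  conv_lhs => rw [← map_mergeTapes]
  rw [Measure.map_map hm measurable_mergeTapes]
  convert Measure.map_id using 2
  funext p
  refine Prod.ext (funext fun k => ?_) (Prod.ext (funext fun k => ?_) (funext fun k => ?_))
  · exact (mergeTapes_tapeIndex p k).1
  · exact (mergeTapes_tapeIndex p k).2.1
  · exact (mergeTapes_tapeIndex p k).2.2

theorem lintegral_tapeParts {F : Tape × Tape × Tape → ℝ≥0∞} (hF : Measurable F) :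
    ∫⁻ ω, F (ω.part 0, ω.part 1, ω.part 2) ∂tapeLaw =
      ∫⁻ ω₀, ∫⁻ ω₁, ∫⁻ ω₂, F (ω₀, ω₁, ω₂) ∂tapeLaw ∂tapeLaw ∂tapeLaw := by
  have hm : Measurable fun ω : Tape => (ω.part 0, ω.part 1, ω.part 2) :=
    (Tape.measurable_part 0).prodMk ((Tape.measurable_part 1).prodMk (Tape.measurable_part 2))
  rw [← lintegral_map hF hm, map_tapeParts, lintegral_prod _ hF.aemeasurable]
  refine lintegral_congr fun ω₀ => ?_
  rw [lintegral_prod _ (by fun_prop)]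

/-- The Laplace draws of stream `0` that the fallback uses are independent. -/
theorem map_laplaceDraws (m : ℕ) :
    tapeLaw.map (fun ω (j : Fin m) => ω (.laplace, 0, (j : ℕ))) =
      Measure.pi fun _ => stdLaplace := by
  classical
  have hm : Measurable fun (ω : Tape) (j : Fin m) => ω (Source.laplace, 0, (j : ℕ)) := by fun_prop
  symm
  refine Measure.pi_eq fun t ht => ?_
  let e : Fin m ↪ Source × ℕ × ℕ :=
    ⟨fun j => (Source.laplace, 0, (j : ℕ)), fun i j h => by simpa [Fin.ext_iff] using h⟩
  let t' : Source × ℕ × ℕ → Set ℝ := fun k => if h : k.2.2 < m then t ⟨k.2.2, h⟩ else Set.univ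
  have ht' : ∀ j, t' (e j) = t j := fun j => dif_pos j.2
  rw [Measure.map_apply hm (MeasurableSet.univ_pi ht)]
  have hpre : (fun (ω : Tape) (j : Fin m) => ω (Source.laplace, 0, (j : ℕ))) ⁻¹' Set.univ.pi t =
      Set.pi (Finset.univ.map e : Finset _) t' := by
    ext ω
    simp only [Set.mem_preimage, Set.mem_pi, Set.mem_univ, forall_true_left, Finset.coe_map,
      Finset.coe_univ, Set.image_univ, Set.forall_mem_range, ht']
    rfl
  rw [hpre, tapeLaw, Measure.infinitePi_pi, Finset.prod_map]
  · exact Finset.prod_congr rfl fun j _ => by rw [ht']; rfl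
  · intro k hk
    obtain ⟨j, -, rfl⟩ := Finset.mem_map.1 hk
    rw [ht']
    exact ht j

/-! ## Costs -/

theorem kendallTau_eq_sum {m : ℕ} (σ π : Ranking m) :
    (kendallTau σ π : ℝ) = ∑ i, ∑ j, if σ i < σ j then (if π j < π i then (1 : ℝ) else 0) else 0 := by
  rw [kendallTau, Finset.card_filter, Nat.cast_sum, Fintype.sum_prod_type]
  refine Finset.sum_congr rfl fun i _ => Finset.sum_congr rfl fun j _ => ?_
  by_cases h1 : σ i < σ j <;> by_cases h2 : π j < π i <;> simp [h1, h2]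

/-- Exchange the sum over users with the sum over pairs. -/
theorem kemeny_eq_weightedCost {n m : ℕ} (σ : Ranking m) (D : Dataset n m) :
    kemeny σ D = weightedCost σ (pairWeight D) := by
  simp only [kemeny, weightedCost, pairWeight, kendallTau_eq_sum]
  rw [Finset.sum_comm, Finset.sum_div]
  refine Finset.sum_congr rfl fun i _ => ?_
  rw [Finset.sum_comm, Finset.sum_div]
  refine Finset.sum_congr rfl fun j _ => ?_
  split_ifs with h
  · rw [Finset.card_filter]; push_cast; rfl
  · simp

theorem opt_eq_weightedOpt {n m : ℕ} (D : Dataset n m) : opt D = weightedOpt (pairWeight D) := by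
  simp only [opt, weightedOpt, kemeny_eq_weightedCost]

theorem kemeny_nonneg {n m : ℕ} (σ : Ranking m) (D : Dataset n m) : 0 ≤ kemeny σ D :=
  div_nonneg (Finset.sum_nonneg fun _ _ => Nat.cast_nonneg _) (Nat.cast_nonneg _)

theorem exists_kemeny_eq_opt {n m : ℕ} (D : Dataset n m) : ∃ σ : Ranking m, kemeny σ D = opt D :=
  exists_eq_ciInf_of_finite

theorem opt_nonneg {n m : ℕ} (D : Dataset n m) : 0 ≤ opt D := by
  obtain ⟨σ, h⟩ := exists_kemeny_eq_opt D
  exact h ▸ kemeny_nonneg σ D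

/-- The distance of two weight matrices. -/
noncomputable def weightDist {m : ℕ} (w w' : Fin m → Fin m → ℝ) : ℝ :=
  ∑ i, ∑ j, if i = j then 0 else |w i j - w' i j|

theorem weightDist_nonneg {m : ℕ} (w w' : Fin m → Fin m → ℝ) : 0 ≤ weightDist w w' :=
  Finset.sum_nonneg fun i _ => Finset.sum_nonneg fun j _ => by split_ifs <;> positivity

theorem weightDist_comm {m : ℕ} (w w' : Fin m → Fin m → ℝ) : weightDist w w' = weightDist w' w := by
  simp only [weightDist, abs_sub_comm]

/-- A cost adds up some off-diagonal entries, each at most once. -/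
theorem weightedCost_le_add_weightDist {m : ℕ} (σ : Ranking m) (w w' : Fin m → Fin m → ℝ) :
    weightedCost σ w ≤ weightedCost σ w' + weightDist w w' := by
  rw [weightDist, Finset.sum_comm, weightedCost, weightedCost, ← Finset.sum_add_distrib]
  refine Finset.sum_le_sum fun i _ => ?_
  rw [← Finset.sum_add_distrib]
  refine Finset.sum_le_sum fun j _ => ?_
  by_cases hij : j = i
  · simp [hij]
  · rw [if_neg hij]
    split_ifs with h
    · linarith [le_abs_self (w j i - w' j i)]
    · positivity

theorem weightedOpt_le_add_weightDist {m : ℕ} (w w' : Fin m → Fin m → ℝ) :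
    weightedOpt w ≤ weightedOpt w' + weightDist w w' := by
  obtain ⟨σ, h⟩ : ∃ σ : Ranking m, weightedCost σ w' = weightedOpt w' := exists_eq_ciInf_of_finite
  rw [← h]
  exact (ciInf_le (Set.finite_range _).bddBelow σ).trans (weightedCost_le_add_weightDist σ w w')

theorem pairWeight_probConstraint {n m : ℕ} (hn : 1 ≤ n) (D : Dataset n m) :
    ProbConstraint (pairWeight D) := by
  intro i j hij
  have hn' : (n : ℝ) ≠ 0 := by positivity
  refine ⟨by unfold pairWeight; positivity, ?_⟩
  rw [pairWeight, pairWeight, ← add_div, div_eq_one_iff_eq hn', ← Nat.cast_add]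
  congr 1
  have h : ∀ k, D k j < D k i ↔ ¬ D k i < D k j := fun k => by
    have : D k i ≠ D k j := fun e => hij ((D k).injective e)
    rw [not_lt, le_iff_lt_or_eq]
    exact ⟨.inl, fun h => h.resolve_right this.symm⟩
  simp only [h]
  rw [Finset.card_filter_add_card_filter_not]
  simp

theorem pairWeight_mem {n m : ℕ} (hn : 1 ≤ n) (D : Dataset n m) {i j : Fin m} (h : i ≠ j) :
    0 ≤ pairWeight D i j ∧ pairWeight D i j ≤ 1 := by
  have h1 := pairWeight_probConstraint hn D i j h
  have h2 := pairWeight_probConstraint hn D j i h.symm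
  exact ⟨h1.1, by linarith⟩

/-- Clipping is 1-Lipschitz and fixes `w`. -/
theorem abs_clip_sub_le {x w : ℝ} (h : 0 ≤ w ∧ w ≤ 1) : |clip x - w| ≤ |x - w| := by
  have hw : clip w = w := by rw [clip, min_eq_right h.2, max_eq_right h.1]
  conv_lhs => rw [← hw]
  unfold clip
  refine (abs_max_sub_max_le_max _ _ _ _).trans ?_
  have := abs_min_sub_min_le_max 1 x 1 w
  simpa using this

/-- An entry below the diagonal is the complement of the mirrored one in both matrices, so its error
is that of the entry above the diagonal; hence `min` and `max`. -/
theorem weightDist_clipMatrix_le {n m : ℕ} (hn : 1 ≤ n) (D : Dataset n m)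
    (M : Fin m → Fin m → ℝ) :
    weightDist (pairWeight D) (clipMatrix M) ≤
      ∑ i, ∑ j, if i = j then 0 else |M (min i j) (max i j) - pairWeight D (min i j) (max i j)| := by
  refine Finset.sum_le_sum fun i _ => Finset.sum_le_sum fun j _ => ?_
  split_ifs with hij
  · exact le_rfl
  · rcases lt_or_gt_of_ne hij with h | h
    · rw [min_eq_left h.le, max_eq_right h.le, clipMatrix, if_pos h, abs_sub_comm]
      exact abs_clip_sub_le (pairWeight_mem hn D hij)
    · rw [min_eq_right h.le, max_eq_left h.le, clipMatrix, if_neg h.not_gt, if_pos h]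
      refine le_trans (le_of_eq ?_) (abs_clip_sub_le (pairWeight_mem hn D (Ne.symm hij)))
      congr 1
      linarith [(pairWeight_probConstraint hn D i j hij).2]

/-! ## The cost of the fallback ranking -/

theorem card_filter_lt_apply {m : ℕ} (π : Ranking m) (j : Fin m) :
    (Finset.univ.filter fun a => π a < π j).card = (π j : ℕ) := by
  rw [← Fin.card_Iio (π j)]
  refine Finset.card_bij (fun a _ => π a) (by simp) (fun a _ b _ h => π.injective h) ?_
  intro b hb
  exact ⟨π.symm b, by simpa using hb, by simp⟩

/-- A position is the number of items placed earlier. An item before `j` in one ranking but not in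
the other forms a discordant pair with `j`. -/
theorem apply_le_add_kendallTau {m : ℕ} (σ π : Ranking m) (j : Fin m) :
    (π j : ℕ) ≤ σ j + kendallTau σ π ∧ (σ j : ℕ) ≤ π j + kendallTau σ π := by
  rw [← card_filter_lt_apply π j, ← card_filter_lt_apply σ j]
  constructor
  · have h : (Finset.univ.filter fun a => π a < π j) ⊆ (Finset.univ.filter fun a => σ a < σ j) ∪
        (Finset.univ.filter fun a => π a < π j ∧ σ j < σ a) := by
      intro a ha
      simp only [Finset.mem_filter, Finset.mem_univ, true_and, Finset.mem_union] at ha ⊢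
      have hne : σ a ≠ σ j := fun e => ha.ne (by rw [σ.injective e])
      rcases lt_or_gt_of_ne hne with h | h
      · exact .inl h
      · exact .inr ⟨ha, h⟩
    refine (Finset.card_le_card h).trans ((Finset.card_union_le _ _).trans
      (Nat.add_le_add_left ?_ _))
    refine Finset.card_le_card_of_injOn (fun a => (j, a)) (fun a ha => ?_)
      (fun a _ b _ h => (Prod.mk.inj h).2)
    simpa [and_comm] using ha
  · have h : (Finset.univ.filter fun a => σ a < σ j) ⊆ (Finset.univ.filter fun a => π a < π j) ∪
        (Finset.univ.filter fun a => σ a < σ j ∧ π j < π a) := by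
      intro a ha
      simp only [Finset.mem_filter, Finset.mem_univ, true_and, Finset.mem_union] at ha ⊢
      have hne : π a ≠ π j := fun e => ha.ne (by rw [π.injective e])
      rcases lt_or_gt_of_ne hne with h | h
      · exact .inl h
      · exact .inr ⟨ha, h⟩
    refine (Finset.card_le_card h).trans ((Finset.card_union_le _ _).trans
      (Nat.add_le_add_left ?_ _))
    refine Finset.card_le_card_of_injOn (fun a => (a, j)) (fun a ha => ?_)
      (fun a _ b _ h => (Prod.mk.inj h).1)
    simpa using ha

/-- The comparison of positions with the Kendall tau distance, averaged over the users. -/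
theorem abs_averagePosition_sub_le {n m : ℕ} (hn : 1 ≤ n) (σ : Ranking m) (D : Dataset n m)
    (j : Fin m) : |((∑ k, (D k j : ℕ) : ℕ) : ℝ) / n - (σ j : ℕ)| ≤ kemeny σ D := by
  have hn' : (0 : ℝ) < n := by positivity
  have h1 : (∑ k, (D k j : ℕ) : ℕ) ≤ n * (σ j : ℕ) + ∑ k, kendallTau σ (D k) := by
    refine (Finset.sum_le_sum fun k _ => (apply_le_add_kendallTau σ (D k) j).1).trans ?_
    simp [Finset.sum_add_distrib]
  have h2 : n * (σ j : ℕ) ≤ (∑ k, (D k j : ℕ) : ℕ) + ∑ k, kendallTau σ (D k) := by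
    have := Finset.sum_le_sum (s := Finset.univ) fun k _ =>
      (apply_le_add_kendallTau σ (D k) j).2
    simpa [Finset.sum_add_distrib] using this
  have h1' : ((∑ k, (D k j : ℕ) : ℕ) : ℝ) ≤ n * ((σ j : ℕ) : ℝ) + ∑ k, (kendallTau σ (D k) : ℝ) := by
    exact_mod_cast h1
  have h2' : n * ((σ j : ℕ) : ℝ) ≤ ((∑ k, (D k j : ℕ) : ℕ) : ℝ) + ∑ k, (kendallTau σ (D k) : ℝ) := by
    exact_mod_cast h2
  rw [kemeny, div_sub' hn'.ne', abs_div, abs_of_pos hn']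
  refine div_le_div_of_nonneg_right ?_ hn'.le
  rw [abs_le]
  constructor <;> linarith

/-- By symmetry the pairs in order and the reversed pairs have equal sums; the diagonal is
nonnegative. -/
theorem sum_lt_le_half {m : ℕ} (σ : Ranking m) (f : Fin m → Fin m → ℝ) (hf : ∀ i j, 0 ≤ f i j)
    (hsymm : ∀ i j, f i j = f j i) :
    ∑ i, ∑ j, (if σ i < σ j then f i j else 0) ≤ (∑ i, ∑ j, f i j) / 2 := by
  have h1 : ∑ i, ∑ j, (if σ i < σ j then f i j else 0) =
      ∑ i, ∑ j, (if σ j < σ i then f i j else 0) := by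
    rw [Finset.sum_comm]
    refine Finset.sum_congr rfl fun i _ => Finset.sum_congr rfl fun j _ => ?_
    rw [hsymm]
  have h2 : ∑ i, ∑ j, (if σ i < σ j then f i j else 0) +
      ∑ i, ∑ j, (if σ j < σ i then f i j else 0) ≤ ∑ i, ∑ j, f i j := by
    rw [← Finset.sum_add_distrib]
    refine Finset.sum_le_sum fun i _ => ?_
    rw [← Finset.sum_add_distrib]
    refine Finset.sum_le_sum fun j _ => ?_
    have := hf i j
    split_ifs with h h' <;> first | linarith | exact absurd h h'.not_gt
  linarith

/-- Each pair is charged separately against an optimal ranking `τ`: a pair ordered as in `τ` costs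
at most `OPT`, and any other at most `2 OPT` plus noise. Since only half of the ordered pairs count,
the factor is `m²`. -/
theorem kemeny_sortRanking_le {n m : ℕ} (hn : 1 ≤ n) (hm : 1 ≤ m) (D : Dataset n m) {ε : ℝ}
    (hε : 0 < ε) (L : Fin m → ℝ) :
    kemeny (sortRanking (noisyScore D ε L)) D ≤
      (m : ℝ) ^ 2 * opt D + 2 * (m : ℝ) ^ 3 / (ε * n) * ∑ i, |L i| := by
  have hn' : (0 : ℝ) < n := by positivity
  have hm' : (0 : ℝ) < m := by positivity
  -- Multiplication by `c` turns the scores into average positions plus noise of scale `c`.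
  set c : ℝ := 2 * (m : ℝ) ^ 2 / (ε * n) with hc
  have hc0 : 0 < c := by positivity
  set σ := sortRanking (noisyScore D ε L) with hσ
  obtain ⟨τ, hτ⟩ := exists_kemeny_eq_opt D
  have hopt := opt_nonneg D
  have key : ∀ i j, σ i < σ j → pairWeight D j i ≤ 2 * opt D + c * (|L i| + |L j|) := by
    intro i j hij
    have hne : i ≠ j := fun e => by simp [e] at hij
    have hnoise : 0 ≤ c * (|L i| + |L j|) := by positivity
    have hw := pairWeight_mem hn D hne.symm
    have hne' : τ i ≠ τ j := fun e => hne (τ.injective e)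
    rcases lt_or_gt_of_ne hne' with h | h
    · have : pairWeight D j i ≤ opt D := by
        rw [← hτ, kemeny_eq_weightedCost, weightedCost]
        have hnn : ∀ i j : Fin m, 0 ≤ if τ i < τ j then pairWeight D j i else 0 := fun i j => by
          split_ifs
          · unfold pairWeight; positivity
          · exact le_rfl
        refine le_trans ?_ (Finset.single_le_sum (fun i _ => Finset.sum_nonneg fun j _ => hnn i j)
          (Finset.mem_univ i))
        refine le_trans ?_ (Finset.single_le_sum (fun j _ => hnn i j) (Finset.mem_univ j))
        rw [if_pos h]
      linarith
    · have hsort : noisyScore D ε L i ≤ noisyScore D ε L j := by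
        rcases before_of_sortRanking_lt _ hij with hb | hb
        · exact hb.le
        · exact not_lt.1 hb.1
      have hs : ∀ j, c * noisyScore D ε L j = c * L j + ((∑ k, (D k j : ℕ) : ℕ) : ℝ) / n := by
        intro j
        rw [noisyScore, hc]
        field_simp
      have h1 := mul_le_mul_of_nonneg_left hsort hc0.le
      rw [hs, hs] at h1
      have h2 := abs_le.1 (abs_averagePosition_sub_le hn τ D i)
      have h3 := abs_le.1 (abs_averagePosition_sub_le hn τ D j)
      rw [hτ] at h2 h3
      -- The gap of at least `1` between positions in `τ` dominates the weight, which is at most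
      -- `1`; the scores reverse this gap, so it is bounded by the two position errors and the
      -- noise.
      have h4 : ((τ j : ℕ) : ℝ) + 1 ≤ (τ i : ℕ) := by exact_mod_cast h
      have h5 : c * (L j - L i) ≤ c * (|L i| + |L j|) :=
        mul_le_mul_of_nonneg_left (by linarith [le_abs_self (L j), neg_abs_le (L i)]) hc0.le
      linarith
  have hsum : ∑ i, ∑ j, (2 * opt D + c * (|L i| + |L j|)) =
      2 * (m : ℝ) ^ 2 * opt D + 2 * c * m * ∑ i, |L i| := by
    simp only [mul_add, Finset.sum_add_distrib, Finset.sum_const, Finset.card_univ,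
      Fintype.card_fin, nsmul_eq_mul, ← Finset.mul_sum]
    ring
  calc kemeny σ D = ∑ i, ∑ j, if σ i < σ j then pairWeight D j i else 0 :=
        kemeny_eq_weightedCost σ D
    _ ≤ ∑ i, ∑ j, if σ i < σ j then 2 * opt D + c * (|L i| + |L j|) else 0 := by
        refine Finset.sum_le_sum fun i _ => Finset.sum_le_sum fun j _ => ?_
        split_ifs with h
        · exact key i j h
        · exact le_rfl
    _ ≤ (∑ i, ∑ j, (2 * opt D + c * (|L i| + |L j|))) / 2 :=
        sum_lt_le_half σ (fun i j => 2 * opt D + c * (|L i| + |L j|))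
          (fun i j => by positivity) (fun i j => by ring)
    _ = (m : ℝ) ^ 2 * opt D + 2 * (m : ℝ) ^ 3 / (ε * n) * ∑ i, |L i| := by
        rw [hsum, hc]
        ring

/-! ## The Laplace mechanism -/

/-- The ratio of the shifted densities is bounded pointwise, by the triangle inequality in the
exponent. -/
theorem stdLaplace_map_add_le (a b : ℝ) :
    stdLaplace.map (· + a) ≤ Real.toNNReal (Real.exp |a - b|) • stdLaplace.map (· + b) := by
  have hmap : ∀ (a : ℝ) (S : Set ℝ), MeasurableSet S → stdLaplace.map (· + a) S =
      ∫⁻ x, S.indicator (fun x => ENNReal.ofReal (Real.exp (-|x - a|) / 2)) x := by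
    intro a S hS
    have hSa : MeasurableSet ((· + a) ⁻¹' S) := measurable_add_const a hS
    rw [Measure.map_apply (measurable_add_const a) hS, stdLaplace, withDensity_apply _ hSa,
      ← lintegral_indicator hSa, ← lintegral_add_right_eq_self
        (fun x => S.indicator (fun x => ENNReal.ofReal (Real.exp (-|x - a|) / 2)) x) a]
    refine lintegral_congr fun x => ?_
    by_cases hx : x + a ∈ S
    · rw [Set.indicator_of_mem (s := S) hx, Set.indicator_of_mem (by exact hx), add_sub_cancel_right]
    · rw [Set.indicator_of_notMem (s := S) hx, Set.indicator_of_notMem (by exact hx)]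
  refine Measure.le_iff.2 fun S hS => ?_
  rw [Measure.smul_apply, hmap a S hS, hmap b S hS, ENNReal.smul_def, smul_eq_mul,
    ← lintegral_const_mul' _ _ ENNReal.coe_ne_top]
  refine lintegral_mono fun x => ?_
  by_cases hx : x ∈ S
  · simp only [Set.indicator_of_mem hx]
    change _ ≤ ENNReal.ofReal _ * _
    rw [← ENNReal.ofReal_mul (Real.exp_pos _).le, ← mul_div_assoc, ← Real.exp_add]
    refine ENNReal.ofReal_le_ofReal (div_le_div_of_nonneg_right (Real.exp_le_exp.2 ?_) two_pos.le)
    have := abs_sub_abs_le_abs_sub (x - b) (x - a)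
    have e : x - b - (x - a) = a - b := by ring
    rw [e] at this
    linarith
  · simp [Set.indicator_of_notMem hx]

/-- The product outer measure is the largest one bounded on boxes by the product of the sides. -/
theorem measurePi_mono {ι : Type*} [Fintype ι] {μ ν : ι → Measure ℝ} (h : ∀ i, μ i ≤ ν i) :
    Measure.pi μ ≤ Measure.pi ν := by
  refine Measure.le_iff.2 fun S hS => ?_
  rw [Measure.pi_def, Measure.pi_def, toMeasure_apply _ _ hS, toMeasure_apply _ _ hS]
  have hle : OuterMeasure.pi (fun i => (μ i).toOuterMeasure) ≤
      OuterMeasure.pi (fun i => (ν i).toOuterMeasure) := by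
    refine OuterMeasure.le_pi.2 fun s _ => (OuterMeasure.pi_pi_le _ s).trans ?_
    exact Finset.prod_le_prod' fun i _ => h i (s i)
  exact hle S

/-- Compare coordinatewise: the factors pull out of the product measure, and their exponents add up.
-/
theorem laplace_shift_le {m : ℕ} (v v' : Fin m → ℝ) {G : Set (Fin m → ℝ)} (hG : MeasurableSet G) :
    Measure.pi (fun _ : Fin m => stdLaplace) {L | (fun j => L j + v j) ∈ G} ≤
      ENNReal.ofReal (Real.exp (∑ j, |v j - v' j|)) *
        Measure.pi (fun _ : Fin m => stdLaplace) {L | (fun j => L j + v' j) ∈ G} := by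
  have hm : ∀ v : Fin m → ℝ, Measurable fun (L : Fin m → ℝ) j => L j + v j := fun v => by fun_prop
  have hp : ∀ a : ℝ, IsProbabilityMeasure (stdLaplace.map (· + a)) := fun a =>
    Measure.isProbabilityMeasure_map (measurable_add_const a).aemeasurable
  have hmap : ∀ v : Fin m → ℝ, Measure.pi (fun _ : Fin m => stdLaplace)
      {L | (fun j => L j + v j) ∈ G} = Measure.pi (fun j => stdLaplace.map (· + v j)) G := by
    intro v
    rw [← Measure.pi_map_pi (fun j => (measurable_add_const (v j)).aemeasurable),
      Measure.map_apply (hm v) hG]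
    rfl
  rw [hmap, hmap]
  refine (measurePi_mono (fun j => stdLaplace_map_add_le (v j) (v' j)) G).trans (le_of_eq ?_)
  have hpi : Measure.pi (fun j => Real.toNNReal (Real.exp |v j - v' j|) •
      stdLaplace.map (· + v' j)) = (∏ j, Real.toNNReal (Real.exp |v j - v' j|)) •
        Measure.pi (fun j => stdLaplace.map (· + v' j)) := by
    refine Measure.pi_eq fun s _ => ?_
    rw [Measure.smul_apply, Measure.pi_pi, ENNReal.smul_def, smul_eq_mul, ENNReal.ofNNReal_finsetProd,
      ← Finset.prod_mul_distrib]
    rfl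
  rw [hpi, Measure.smul_apply, ENNReal.smul_def, smul_eq_mul, Real.exp_sum]
  congr 1
  rw [← Real.toNNReal_prod_of_nonneg (fun j _ => (Real.exp_pos _).le)]
  rfl

theorem measurable_sortRanking (m : ℕ) : Measurable (sortRanking (m := m)) := by
  classical
  refine measurable_to_countable' fun σ => ?_
  have hb : ∀ i j : Fin m, MeasurableSet {x : Fin m → ℝ | Before x i j} := fun i j =>
    (measurableSet_lt (measurable_pi_apply i) (measurable_pi_apply j)).union
      ((measurableSet_lt (measurable_pi_apply j) (measurable_pi_apply i)).compl.inter
        (MeasurableSet.const _))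
  have h : sortRanking ⁻¹' {σ} =
      ⋂ j : Fin m, {x | ∑ i, (if Before x i j then 1 else 0) = (σ j : ℕ)} := by
    ext x
    simp only [Set.mem_preimage, Set.mem_singleton_iff, Set.mem_iInter, Set.mem_ofPred_eq,
      Equiv.ext_iff, Fin.ext_iff]
    refine forall_congr' fun j => ?_
    simp only [sortRanking, Equiv.ofBijective_apply, Finset.card_filter]
  rw [h]
  refine MeasurableSet.iInter fun j => measurableSet_eq_fun ?_ measurable_const
  exact Finset.measurable_sum _ fun i _ =>
    Measurable.ite (hb i j) measurable_const measurable_const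

theorem measurable_noisyScore {n m : ℕ} (D : Dataset n m) (ε : ℝ) :
    Measurable (noisyScore D ε) := by
  refine measurable_pi_iff.2 fun j => ?_
  unfold noisyScore
  fun_prop

theorem measurable_fallback {n m : ℕ} (D : Dataset n m) (ε : ℝ) : Measurable (fallback D ε) :=
  (measurable_sortRanking m).comp ((measurable_noisyScore D ε).comp (by fun_prop))

/-- One user changes a position sum by at most `m`, hence a score by at most `ε / (2 m)`, and there
are `m` scores. -/
theorem sum_abs_noisyScore_sub_le {n m : ℕ} (hm : 1 ≤ m) {D D' : Dataset n m}
    (h : Neighbors D D') {ε : ℝ} (hε : 0 < ε) :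
    ∑ j, |noisyScore D ε 0 j - noisyScore D' ε 0 j| ≤ ε / 2 := by
  obtain ⟨k, hk⟩ := h
  have hm' : (0 : ℝ) < m := by positivity
  have hterm : ∀ j, |noisyScore D ε 0 j - noisyScore D' ε 0 j| ≤ ε / (2 * m) := by
    intro j
    have h1 : ∀ D : Dataset n m, ((∑ k, (D k j : ℕ) : ℕ) : ℝ) =
        (D k j : ℕ) + ∑ k' ∈ Finset.univ.erase k, ((D k' j : ℕ) : ℝ) := fun D => by
      rw [← Finset.add_sum_erase _ _ (Finset.mem_univ k)]
      push_cast
      rfl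
    have h2 : ∑ k' ∈ Finset.univ.erase k, ((D k' j : ℕ) : ℝ) =
        ∑ k' ∈ Finset.univ.erase k, ((D' k' j : ℕ) : ℝ) :=
      Finset.sum_congr rfl fun k' hk' => by rw [hk k' (Finset.ne_of_mem_erase hk')]
    have h3 : noisyScore D ε 0 j - noisyScore D' ε 0 j =
        ε / (2 * (m * m)) * (((D k j : ℕ) : ℝ) - ((D' k j : ℕ) : ℝ)) := by
      rw [noisyScore, noisyScore, h1 D, h1 D', h2]
      simp only [Pi.zero_apply]
      ring
    have h4 : |((D k j : ℕ) : ℝ) - ((D' k j : ℕ) : ℝ)| ≤ m := by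
      have e1 : ((D k j : ℕ) : ℝ) ≤ m := by exact_mod_cast (D k j).2.le
      have e2 : ((D' k j : ℕ) : ℝ) ≤ m := by exact_mod_cast (D' k j).2.le
      have e3 : (0 : ℝ) ≤ ((D k j : ℕ) : ℝ) := Nat.cast_nonneg _
      have e4 : (0 : ℝ) ≤ ((D' k j : ℕ) : ℝ) := Nat.cast_nonneg _
      rw [abs_le]
      constructor <;> linarith
    rw [h3, abs_mul, abs_of_pos (by positivity)]
    refine (mul_le_mul_of_nonneg_left h4 (by positivity)).trans (le_of_eq ?_)
    field_simp
  refine (Finset.sum_le_sum fun j _ => hterm j).trans (le_of_eq ?_)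
  rw [Finset.sum_const, Finset.card_univ, Fintype.card_fin, nsmul_eq_mul]
  field_simp

/-- Sorting is post-processing of the Laplace mechanism, whose sensitivity is at most `ε / 2`. -/
theorem fallback_private {n m : ℕ} (hm : 1 ≤ m) {D D' : Dataset n m}
    (h : Neighbors D D') {ε : ℝ} (hε : 0 < ε) (V : Set (Ranking m)) :
    tapeLaw {ω | fallback D ε ω ∈ V} ≤
      ENNReal.ofReal (Real.exp (ε / 2)) * tapeLaw {ω | fallback D' ε ω ∈ V} := by
  have hG : MeasurableSet (sortRanking (m := m) ⁻¹' V) :=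
    measurable_sortRanking m MeasurableSpace.measurableSet_top
  have hd : Measurable fun (ω : Tape) (j : Fin m) => ω (Source.laplace, 0, (j : ℕ)) := by fun_prop
  have key : ∀ D : Dataset n m, tapeLaw {ω | fallback D ε ω ∈ V} =
      Measure.pi (fun _ : Fin m => stdLaplace)
        {L | (fun j => L j + noisyScore D ε 0 j) ∈ sortRanking (m := m) ⁻¹' V} := by
    intro D
    have hms : Measurable fun (L : Fin m → ℝ) j => L j + noisyScore D ε 0 j := by fun_prop
    have hmS : MeasurableSet {L : Fin m → ℝ |
        (fun j => L j + noisyScore D ε 0 j) ∈ sortRanking (m := m) ⁻¹' V} := hms hG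
    rw [← map_laplaceDraws, Measure.map_apply hd hmS]
    congr 1
    ext ω
    simp only [Set.mem_ofPred_eq, Set.mem_preimage, fallback]
    have : (noisyScore D ε fun j => ω (Source.laplace, 0, (j : ℕ))) =
        fun j : Fin m => ω (Source.laplace, 0, (j : ℕ)) + noisyScore D ε 0 j := by
      funext j
      simp [noisyScore]
    rw [this]
  rw [key, key]
  refine (laplace_shift_le _ _ hG).trans (mul_le_mul_left ?_ _)
  exact ENNReal.ofReal_le_ofReal (Real.exp_le_exp.2 (sum_abs_noisyScore_sub_le hm h hε))

/-! ### Expected cost of the fallback -/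

/-- By symmetry this is the integral of `x * exp (-x)` over the positive half-line, which is `Γ(2) =
1`. -/
theorem lintegral_abs_stdLaplace : ∫⁻ x, ENNReal.ofReal |x| ∂stdLaplace = 1 := by
  have hint : ∫ x : ℝ, Real.exp (-|x|) / 2 * |x| = 1 := by
    rw [integral_comp_abs (f := fun x => Real.exp (-x) / 2 * x)]
    have h := Real.Gamma_eq_integral (s := 2) two_pos
    have e : ∫ x in Set.Ioi (0 : ℝ), Real.exp (-x) / 2 * x =
        (∫ x in Set.Ioi (0 : ℝ), Real.exp (-x) * x ^ ((2 : ℝ) - 1)) / 2 := by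
      rw [← integral_div]
      refine setIntegral_congr_fun measurableSet_Ioi fun x _ => ?_
      have : ((2 : ℝ) - 1) = 1 := by norm_num
      simp only [this, Real.rpow_one]
      ring
    rw [e, ← h, Real.Gamma_two]
    norm_num
  have hI : Integrable (fun x : ℝ => Real.exp (-|x|) / 2 * |x|) := by
    -- The integral of a nonintegrable function is `0` by convention, so the value `1` proves
    -- integrability.
    by_contra h
    rw [integral_undef h] at hint
    exact zero_ne_one hint
  rw [stdLaplace, lintegral_withDensity_eq_lintegral_mul _ (by fun_prop) (by fun_prop)]
  simp only [Pi.mul_apply, ← ENNReal.ofReal_mul (show (0 : ℝ) ≤ Real.exp _ / 2 by positivity)]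
  rw [← ofReal_integral_eq_lintegral_ofReal hI (Filter.Eventually.of_forall fun x => by positivity),
    hint, ENNReal.ofReal_one]

theorem lintegral_abs_laplaceDraw (j : ℕ) :
    ∫⁻ ω : Tape, ENNReal.ofReal |ω (.laplace, 0, j)| ∂tapeLaw = 1 := by
  rw [← lintegral_abs_stdLaplace]
  exact (measurePreserving_eval_infinitePi (fun k : Source × ℕ × ℕ => k.1.law)
    (Source.laplace, 0, j)).lintegral_comp
    (show Measurable fun x : ℝ => ENNReal.ofReal |x| by fun_prop)

/-- The expected cost of the fallback ranking. -/
theorem lintegral_kemeny_fallback_le {n m : ℕ} (hn : 1 ≤ n) (hm : 1 ≤ m) (D : Dataset n m) {ε : ℝ}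
    (hε : 0 < ε) :
    ∫⁻ ω, ENNReal.ofReal (kemeny (fallback D ε ω) D) ∂tapeLaw ≤
      ENNReal.ofReal ((m : ℝ) ^ 2 * opt D + 2 * (m : ℝ) ^ 4 / (ε * n)) := by
  have hn' : (0 : ℝ) < n := by positivity
  have hopt := opt_nonneg D
  have hc : (0 : ℝ) ≤ 2 * (m : ℝ) ^ 3 / (ε * n) := by positivity
  calc ∫⁻ ω, ENNReal.ofReal (kemeny (fallback D ε ω) D) ∂tapeLaw
      ≤ ∫⁻ ω, (ENNReal.ofReal ((m : ℝ) ^ 2 * opt D) + ENNReal.ofReal (2 * (m : ℝ) ^ 3 / (ε * n)) *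
          ∑ i : Fin m, ENNReal.ofReal |ω (.laplace, 0, (i : ℕ))|) ∂tapeLaw := by
        refine lintegral_mono fun ω => ?_
        refine (ENNReal.ofReal_le_ofReal (kemeny_sortRanking_le hn hm D hε _)).trans ?_
        rw [ENNReal.ofReal_add (by positivity) (by positivity), ENNReal.ofReal_mul hc,
          ENNReal.ofReal_sum_of_nonneg fun i _ => abs_nonneg _]
    _ = ENNReal.ofReal ((m : ℝ) ^ 2 * opt D) + ENNReal.ofReal (2 * (m : ℝ) ^ 3 / (ε * n)) *
          (m : ℝ≥0∞) := by
        rw [lintegral_add_left measurable_const, lintegral_const, measure_univ, mul_one,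
          lintegral_const_mul' _ _ ENNReal.ofReal_ne_top,
          lintegral_finsetSum _ (fun i _ => by fun_prop)]
        simp [lintegral_abs_laplaceDraw]
    _ = ENNReal.ofReal ((m : ℝ) ^ 2 * opt D + 2 * (m : ℝ) ^ 4 / (ε * n)) := by
        rw [← ENNReal.ofReal_natCast m, ← ENNReal.ofReal_mul hc,
          ← ENNReal.ofReal_add (by positivity) (by positivity)]
        congr 1
        ring

/-! ## The private ranking algorithm: analysis -/

theorem measurable_answerMatrix {Q : Program} {n m : ℕ} (D : Dataset n m) {q : ℕ} {ε δ : ℝ}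
    (hQ : ∀ ω, ∃ s', Q.HaltsIn (dataEnv ω) (dataInput D q ε δ) s') :
    Measurable fun ω => answerMatrix Q D q ε δ ω := by
  have hE : Measurable dataEnv := measurable_env_iff.2 ⟨fun _ _ => measurable_const, measurable_id⟩
  obtain ⟨L, hL, h⟩ := Program.measurable_log hE Q (s := fun _ => dataInput D q ε δ)
    measurable_const hQ
  refine measurable_pi_iff.2 fun i => measurable_pi_iff.2 fun j => ?_
  unfold answerMatrix
  split_ifs
  · exact measurable_const
  · convert (measurable_state_iff.1 hL.fst).2.1 1 i j using 2 with ω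
    rw [(h ω).1]
    rfl

theorem measurable_privateResult {A Q : Program} (hA : PolyTimeQueryRanking A) {n m : ℕ}
    (hn : 1 ≤ n) (hm : 1 ≤ m) (D : Dataset n m) {q : ℕ} {ε δ : ℝ}
    (hQ : ∀ ω, ∃ s', Q.HaltsIn (dataEnv ω) (dataInput D q ε δ) s') :
    Measurable fun p : Tape × Tape × Tape => privateResult A Q D q ε δ p.1 p.2.1 p.2.2 := by
  have hM : Measurable fun p : Tape × Tape × Tape => answerMatrix Q D q ε δ p.1 :=
    (measurable_answerMatrix D hQ).comp measurable_fst
  have hs : Measurable fun p : Tape × Tape × Tape =>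
      queryRun A n (clipMatrix (answerMatrix Q D q ε δ p.1)) p.2.1 := by
    simpa only [Function.comp_def] using
      (measurable_queryRun hA hn hm).comp (hM.prodMk (measurable_fst.comp measurable_snd))
  have hq := (measurable_state_iff.1 hs).2.2.2
  have hr : Measurable fun p : Tape × Tape × Tape =>
      outRanking m (queryRun A n (clipMatrix (answerMatrix Q D q ε δ p.1)) p.2.1) := by
    simpa only [Function.comp_def] using (measurable_outRanking m).comp hs
  have hf : Measurable fun p : Tape × Tape × Tape => fallback D ε p.2.2 := by
    simpa only [Function.comp_def] using
      (measurable_fallback D ε).comp (measurable_snd.comp measurable_snd)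
  simp only [privateResult_eq]
  simpa only [Function.comp_def] using (measurable_of_countable
    (fun k : ℕ × Ranking m × Ranking m => if k.1 ≤ q then k.2.1 else k.2.2)).comp
    (hq.prodMk (hr.prodMk hf))

/-- For privacy the tape of `A` has to be fixed first, and the answers of `Q` integrated innermost.
-/
theorem lintegral_swap_tapes {F : Tape × Tape × Tape → ℝ≥0∞} (hF : Measurable F) :
    ∫⁻ ω₀, ∫⁻ ω₁, ∫⁻ ω₂, F (ω₀, ω₁, ω₂) ∂tapeLaw ∂tapeLaw ∂tapeLaw =
      ∫⁻ ω₁, ∫⁻ ω₂, ∫⁻ ω₀, F (ω₀, ω₁, ω₂) ∂tapeLaw ∂tapeLaw ∂tapeLaw := by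
  rw [lintegral_lintegral_swap]
  · refine lintegral_congr fun ω₁ => ?_
    rw [lintegral_lintegral_swap]
    exact Measurable.aemeasurable (by fun_prop)
  · refine Measurable.aemeasurable ?_
    have : Measurable fun p : (Tape × Tape) × Tape => F (p.1.1, p.1.2, p.2) := by fun_prop
    exact this.lintegral_prod_right'

/-- The probability of an event, computed with the tape of the ranking algorithm first, then that
of the fallback, then that of the query answering algorithm. -/
theorem tapeLaw_parts {F : Tape × Tape × Tape → Prop} (hF : MeasurableSet {p | F p}) :
    tapeLaw {ω | F (ω.part 0, ω.part 1, ω.part 2)} =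
      ∫⁻ ω₁, ∫⁻ ω₂, tapeLaw {ω₀ | F (ω₀, ω₁, ω₂)} ∂tapeLaw ∂tapeLaw := by
  have hm : Measurable fun ω : Tape => (ω.part 0, ω.part 1, ω.part 2) :=
    (Tape.measurable_part 0).prodMk ((Tape.measurable_part 1).prodMk (Tape.measurable_part 2))
  have hI : Measurable (Set.indicator {p | F p} (1 : Tape × Tape × Tape → ℝ≥0∞)) :=
    measurable_one.indicator hF
  calc tapeLaw {ω | F (ω.part 0, ω.part 1, ω.part 2)}
      = ∫⁻ ω, Set.indicator {p | F p} (1 : Tape × Tape × Tape → ℝ≥0∞)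
          (ω.part 0, ω.part 1, ω.part 2) ∂tapeLaw :=
        (lintegral_indicator_one (hm hF)).symm
    _ = _ := by
        rw [lintegral_tapeParts hI, lintegral_swap_tapes hI]
        refine lintegral_congr fun ω₁ => lintegral_congr fun ω₂ => ?_
        have hω : Measurable fun ω₀ : Tape => (ω₀, ω₁, ω₂) := by fun_prop
        exact lintegral_indicator_one (hω hF)

/-! ### Privacy of the combined algorithm -/

/-- Privacy for functions instead of events: in the composition, `g` is the probability of an output
event given the fallback ranking. -/
theorem lintegral_fallback_le {n m : ℕ} (hm : 1 ≤ m) {D D' : Dataset n m}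
    (h : Neighbors D D') {ε : ℝ} (hε : 0 < ε) (g : Ranking m → ℝ≥0∞) :
    ∫⁻ ω, g (fallback D ε ω) ∂tapeLaw ≤
      ENNReal.ofReal (Real.exp (ε / 2)) * ∫⁻ ω, g (fallback D' ε ω) ∂tapeLaw := by
  have hle : tapeLaw.map (fallback D ε) ≤
      ENNReal.ofReal (Real.exp (ε / 2)) • tapeLaw.map (fallback D' ε) := by
    refine Measure.le_iff.2 fun V hV => ?_
    rw [Measure.smul_apply, Measure.map_apply (measurable_fallback D ε) hV,
      Measure.map_apply (measurable_fallback D' ε) hV]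
    exact fallback_private hm h hε V
  rw [← lintegral_map (f := g) measurable_from_top (measurable_fallback D ε),
    ← lintegral_map (f := g) measurable_from_top (measurable_fallback D' ε),
    ← smul_eq_mul, ← lintegral_smul_measure]
  exact lintegral_mono' hle le_rfl

theorem privateResult_private {A Q : Program} (hA : PolyTimeQueryRanking A) {n m : ℕ}
    (hn : 1 ≤ n) (hm : 1 ≤ m) {q : ℕ} {ε δ : ℝ} (hε : 0 < ε)
    (hQ : ∀ (D : Dataset n m) ω, ∃ s', Q.HaltsIn (dataEnv ω) (dataInput D q ε δ) s')
    {D D' : Dataset n m} (hD : Neighbors D D')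
    (hdp : ∀ (S : Strategy m) (U : Set (Fin q → ℝ)), MeasurableSet U →
      tapeLaw {ω | S.answers (answerMatrix Q D q ε δ ω) q ∈ U} ≤
        ENNReal.ofReal (Real.exp (ε / 2)) *
          tapeLaw {ω | S.answers (answerMatrix Q D' q ε δ ω) q ∈ U} + ENNReal.ofReal δ)
    (V : Set (Ranking m)) :
    tapeLaw {ω | privateResult A Q D q ε δ (ω.part 0) (ω.part 1) (ω.part 2) ∈ V} ≤
      ENNReal.ofReal (Real.exp ε) *
        tapeLaw {ω | privateResult A Q D' q ε δ (ω.part 0) (ω.part 1) (ω.part 2) ∈ V} +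
      ENNReal.ofReal δ := by
  have hmeas : ∀ D : Dataset n m, MeasurableSet {p : Tape × Tape × Tape |
      privateResult A Q D q ε δ p.1 p.2.1 p.2.2 ∈ V} := fun D =>
    measurable_privateResult hA hn hm D (hQ D) MeasurableSpace.measurableSet_top
  rw [tapeLaw_parts (hmeas D), tapeLaw_parts (hmeas D')]
  have hee : ENNReal.ofReal (Real.exp ε) =
      ENNReal.ofReal (Real.exp (ε / 2)) * ENNReal.ofReal (Real.exp (ε / 2)) := by
    rw [← ENNReal.ofReal_mul (Real.exp_pos _).le, ← Real.exp_add, add_halves]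
  have hω₁ : ∀ ω₁, ∫⁻ ω₂, tapeLaw {ω₀ | privateResult A Q D q ε δ ω₀ ω₁ ω₂ ∈ V} ∂tapeLaw ≤
      ENNReal.ofReal (Real.exp ε) *
        ∫⁻ ω₂, tapeLaw {ω₀ | privateResult A Q D' q ε δ ω₀ ω₁ ω₂ ∈ V} ∂tapeLaw +
      ENNReal.ofReal δ := by
    intro ω₁
    obtain ⟨S, hS⟩ := exists_strategy hA hn hm ω₁ q
    -- The event about the answers depends on the fallback only through whether that ranking lies in
    -- `V`; the strategy does not depend on it.
    choose U hU hUM using hS V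
    have hset : ∀ (D : Dataset n m) ω₂, {ω₀ | privateResult A Q D q ε δ ω₀ ω₁ ω₂ ∈ V} =
        {ω₀ | S.answers (answerMatrix Q D q ε δ ω₀) q ∈ U (fallback D ε ω₂ ∈ V)} := by
      intro D ω₂
      ext ω₀
      simp only [Set.mem_ofPred_eq, hUM, privateResult_eq]
      split_ifs with h <;> simp [h]
    simp only [hset]
    set g : Ranking m → ℝ≥0∞ := fun τ =>
      tapeLaw {ω₀ | S.answers (answerMatrix Q D' q ε δ ω₀) q ∈ U (τ ∈ V)} with hg
    calc ∫⁻ ω₂, tapeLaw {ω₀ | S.answers (answerMatrix Q D q ε δ ω₀) q ∈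
          U (fallback D ε ω₂ ∈ V)} ∂tapeLaw
        -- The answers are compared first and the fallback second, so the factor of the fallback
        -- never multiplies `δ`.
        ≤ ∫⁻ ω₂, (ENNReal.ofReal (Real.exp (ε / 2)) * g (fallback D ε ω₂) + ENNReal.ofReal δ)
            ∂tapeLaw := lintegral_mono fun ω₂ => hdp S _ (hU _)
      _ = ENNReal.ofReal (Real.exp (ε / 2)) * ∫⁻ ω₂, g (fallback D ε ω₂) ∂tapeLaw +
            ENNReal.ofReal δ := by
          rw [lintegral_add_right _ measurable_const, lintegral_const_mul' _ _ ENNReal.ofReal_ne_top,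
            lintegral_const, measure_univ, mul_one]
      _ ≤ _ := by
          rw [hee, mul_assoc]
          gcongr
          exact lintegral_fallback_le hm hD hε g
  refine (lintegral_mono hω₁).trans (le_of_eq ?_)
  rw [lintegral_add_right _ measurable_const, lintegral_const_mul' _ _ ENNReal.ofReal_ne_top,
    lintegral_const, measure_univ, mul_one]

/-! ### Accuracy of the combined algorithm -/

theorem lintegral_weightDist_le {n m : ℕ} (hn : 1 ≤ n) (D : Dataset n m)
    {M : Tape → Fin m → Fin m → ℝ} (hM : Measurable M) {e : ℝ}
    (he : ∀ i j, i ≠ j → ∫⁻ ω, ENNReal.ofReal |M ω i j - pairWeight D i j| ∂tapeLaw ≤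
      ENNReal.ofReal e) :
    ∫⁻ ω, ENNReal.ofReal (weightDist (pairWeight D) (clipMatrix (M ω))) ∂tapeLaw ≤
      ENNReal.ofReal ((m : ℝ) ^ 2 * e) := by
  have hMij : ∀ i j, Measurable fun ω => M ω i j := fun i j =>
    (measurable_pi_apply j).comp ((measurable_pi_apply i).comp hM)
  have hmeas : ∀ i j : Fin m, Measurable fun ω => if i = j then (0 : ℝ≥0∞) else
      ENNReal.ofReal |M ω (min i j) (max i j) - pairWeight D (min i j) (max i j)| := by
    intro i j
    have := hMij (min i j) (max i j)
    split_ifs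
    · exact measurable_const
    · exact ENNReal.measurable_ofReal.comp (continuous_abs.measurable.comp
        (this.sub measurable_const))
  calc ∫⁻ ω, ENNReal.ofReal (weightDist (pairWeight D) (clipMatrix (M ω))) ∂tapeLaw
      ≤ ∫⁻ ω, ∑ i, ∑ j, (if i = j then (0 : ℝ≥0∞) else
          ENNReal.ofReal |M ω (min i j) (max i j) - pairWeight D (min i j) (max i j)|)
          ∂tapeLaw := by
        refine lintegral_mono fun ω => ?_
        refine (ENNReal.ofReal_le_ofReal (weightDist_clipMatrix_le hn D (M ω))).trans ?_
        have hnn : ∀ i j : Fin m, 0 ≤ if i = j then (0 : ℝ) else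
            |M ω (min i j) (max i j) - pairWeight D (min i j) (max i j)| := fun i j => by
          split_ifs <;> positivity
        rw [ENNReal.ofReal_sum_of_nonneg fun i _ => Finset.sum_nonneg fun j _ => hnn i j]
        refine Finset.sum_le_sum fun i _ => ?_
        rw [ENNReal.ofReal_sum_of_nonneg fun j _ => hnn i j]
        refine Finset.sum_le_sum fun j _ => ?_
        split_ifs <;> simp
    _ = ∑ i, ∑ j, ∫⁻ ω, (if i = j then (0 : ℝ≥0∞) else
          ENNReal.ofReal |M ω (min i j) (max i j) - pairWeight D (min i j) (max i j)|)
          ∂tapeLaw := by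
        rw [lintegral_finsetSum _ fun i _ => Finset.measurable_sum _ fun j _ => hmeas i j]
        refine Finset.sum_congr rfl fun i _ => ?_
        rw [lintegral_finsetSum _ fun j _ => hmeas i j]
    _ ≤ ∑ _i : Fin m, ∑ _j : Fin m, ENNReal.ofReal e := by
        refine Finset.sum_le_sum fun i _ => Finset.sum_le_sum fun j _ => ?_
        by_cases hij : i = j
        · simp [hij]
        · simp only [hij, if_false]
          refine he _ _ fun h => hij ?_
          rcases le_total i j with hle | hle
          · rwa [min_eq_left hle, max_eq_right hle] at h
          · rw [min_eq_right hle, max_eq_left hle] at h; exact h.symm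
    _ = ENNReal.ofReal ((m : ℝ) ^ 2 * e) := by
        rw [ENNReal.ofReal_mul (by positivity)]
        simp only [Finset.sum_const, Finset.card_univ, Fintype.card_fin, nsmul_eq_mul]
        rw [← mul_assoc, ← sq, ENNReal.ofReal_pow (Nat.cast_nonneg m), ENNReal.ofReal_natCast]

theorem measurable_queryRun_tape {A : Program} (hA : PolyTimeQueryRanking A) {n m : ℕ}
    (hn : 1 ≤ n) (hm : 1 ≤ m) (M : Fin m → Fin m → ℝ) :
    Measurable fun ω => queryRun A n (clipMatrix M) ω := by
  simpa only [Function.comp_def, id_eq] using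
    (measurable_queryRun hA hn hm).comp (measurable_const (a := M) |>.prodMk measurable_id)

theorem tapeLaw_manyQueries_le {A : Program} (hA : PolyTimeQueryRanking A) {n m : ℕ}
    (hn : 1 ≤ n) (hm : 1 ≤ m) (M : Fin m → Fin m → ℝ) {q : ℕ} {z : ℝ} (hz : 0 ≤ 1 - z)
    (h : ENNReal.ofReal (1 - z) ≤ tapeLaw {ω | (queryRun A n (clipMatrix M) ω).queries ≤ q}) :
    tapeLaw {ω | ¬ (queryRun A n (clipMatrix M) ω).queries ≤ q} ≤ ENNReal.ofReal z := by
  have hs := measurable_queryRun_tape hA hn hm M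
  have hset : MeasurableSet {ω | (queryRun A n (clipMatrix M) ω).queries ≤ q} :=
    measurableSet_le (measurable_state_iff.1 hs).2.2.2 measurable_const
  have hc : {ω | ¬ (queryRun A n (clipMatrix M) ω).queries ≤ q} =
      {ω | (queryRun A n (clipMatrix M) ω).queries ≤ q}ᶜ := rfl
  rw [hc, prob_compl_eq_one_sub hset]
  refine (tsub_le_tsub_left h 1).trans (le_of_eq ?_)
  rw [← ENNReal.ofReal_one, ← ENNReal.ofReal_sub _ hz]
  congr 1
  ring

theorem privateResult_approx {A Q : Program} {α : ℝ} (hα : 0 < α) (hA : PolyTimeQueryRanking A)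
    (happ : QueryApproximation A α) {n m : ℕ} (hn : 1 ≤ n) (hm : 1 ≤ m) {q : ℕ} {ε δ ζ e : ℝ}
    (hε : 0 < ε) (he0 : 0 < e) (hζ : ζ ∈ Set.Icc (0 : ℝ) 1)
    (hfew : ∀ w : Fin m → Fin m → ℝ, ProbConstraint w →
      ENNReal.ofReal (1 - ζ / (m : ℝ) ^ 4) ≤ tapeLaw {ω | (queryRun A n w ω).queries ≤ q})
    (D : Dataset n m)
    (hQ : ∀ ω, ∃ s', Q.HaltsIn (dataEnv ω) (dataInput D q ε δ) s')
    (he : ∀ i j : Fin m, i ≠ j →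
      ∫⁻ ω, ENNReal.ofReal |answerMatrix Q D q ε δ ω i j - pairWeight D i j| ∂tapeLaw ≤
        ENNReal.ofReal e) :
    ∫⁻ ω, ENNReal.ofReal
        (kemeny (privateResult A Q D q ε δ (ω.part 0) (ω.part 1) (ω.part 2)) D) ∂tapeLaw ≤
      ENNReal.ofReal ((α + ζ) * opt D + (α + 3) * ((m : ℝ) ^ 2 * e + 1 / (ε * n))) := by
  have hn' : (0 : ℝ) < n := by positivity
  have hm' : (1 : ℝ) ≤ m := by exact_mod_cast hm
  have hm0 : (0 : ℝ) < m := by positivity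
  have hopt := opt_nonneg D
  have hM := measurable_answerMatrix D hQ
  have hkem : Measurable fun σ : Ranking m => ENNReal.ofReal (kemeny σ D) := measurable_from_top
  have hfb : Measurable fun ω => ENNReal.ofReal (kemeny (fallback D ε ω) D) := by
    simpa only [Function.comp_def] using hkem.comp (measurable_fallback D ε)
  set F : ℝ := (m : ℝ) ^ 2 * opt D + 2 * (m : ℝ) ^ 4 / (ε * n) with hF
  have hF0 : 0 ≤ F := by positivity
  have hz : 0 ≤ 1 - ζ / (m : ℝ) ^ 4 := by
    rw [sub_nonneg, div_le_one (by positivity)]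
    exact hζ.2.trans (one_le_pow₀ hm')
  have hz0 : 0 ≤ ζ / (m : ℝ) ^ 4 := div_nonneg hζ.1 (by positivity)
  -- the expected cost for fixed answers
  have hω₀ : ∀ ω₀, ∫⁻ ω₁, ∫⁻ ω₂, ENNReal.ofReal (kemeny (privateResult A Q D q ε δ ω₀ ω₁ ω₂) D)
      ∂tapeLaw ∂tapeLaw ≤ ENNReal.ofReal (α * opt D + ζ / (m : ℝ) ^ 4 * F) +
        ENNReal.ofReal (α + 1) *
          ENNReal.ofReal (weightDist (pairWeight D) (clipMatrix (answerMatrix Q D q ε δ ω₀))) := by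
    intro ω₀
    set M := answerMatrix Q D q ε δ ω₀ with hMdef
    have hs := measurable_queryRun_tape hA hn hm M
    set w := clipMatrix M with hw
    set err := weightDist (pairWeight D) w with herr
    have herr0 : 0 ≤ err := weightDist_nonneg _ _
    have hfail : MeasurableSet {ω | ¬ (queryRun A n w ω).queries ≤ q} :=
      (measurableSet_le (measurable_state_iff.1 hs).2.2.2 measurable_const).compl
    -- The cost of `A` is included whether or not its ranking is used, so its unconditional
    -- guarantee applies.
    have hcost : ∀ ω₁ ω₂, ENNReal.ofReal (kemeny (privateResult A Q D q ε δ ω₀ ω₁ ω₂) D) ≤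
        (ENNReal.ofReal (weightedCost (outRanking m (queryRun A n w ω₁)) w) +
          ENNReal.ofReal err) +
        Set.indicator {ω | ¬ (queryRun A n w ω).queries ≤ q} 1 ω₁ *
          ENNReal.ofReal (kemeny (fallback D ε ω₂) D) := by
      intro ω₁ ω₂
      by_cases h : (queryRun A n w ω₁).queries ≤ q
      · have hr : privateResult A Q D q ε δ ω₀ ω₁ ω₂ = outRanking m (queryRun A n w ω₁) := by
          rw [privateResult_eq, if_pos h]
        rw [hr]
        refine le_trans ?_ le_self_add
        refine le_trans (ENNReal.ofReal_le_ofReal ?_) ENNReal.ofReal_add_le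
        rw [kemeny_eq_weightedCost]
        exact weightedCost_le_add_weightDist _ _ _
      · have hr : privateResult A Q D q ε δ ω₀ ω₁ ω₂ = fallback D ε ω₂ := by
          rw [privateResult_eq, if_neg h]
        rw [hr, Set.indicator_of_mem (by exact h), Pi.one_apply, one_mul]
        exact le_add_self
    have hind : Measurable (Set.indicator {ω | ¬ (queryRun A n w ω).queries ≤ q}
        (1 : Tape → ℝ≥0∞)) := measurable_one.indicator hfail
    calc ∫⁻ ω₁, ∫⁻ ω₂, ENNReal.ofReal (kemeny (privateResult A Q D q ε δ ω₀ ω₁ ω₂) D)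
          ∂tapeLaw ∂tapeLaw
        ≤ ∫⁻ ω₁, ((ENNReal.ofReal (weightedCost (outRanking m (queryRun A n w ω₁)) w) +
          ENNReal.ofReal err) + Set.indicator {ω | ¬ (queryRun A n w ω).queries ≤ q} 1 ω₁ *
            ENNReal.ofReal F) ∂tapeLaw := by
          -- For fixed answers, failure depends on `ω₁` alone and the fallback on `ω₂` alone, so the
          -- expectation of their product factors.
          refine lintegral_mono fun ω₁ => (lintegral_mono fun ω₂ => hcost ω₁ ω₂).trans ?_
          rw [lintegral_add_left measurable_const, lintegral_const, measure_univ, mul_one,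
            lintegral_const_mul _ hfb]
          gcongr
          exact lintegral_kemeny_fallback_le hn hm D hε
      _ = (∫⁻ ω₁, ENNReal.ofReal (weightedCost (outRanking m (queryRun A n w ω₁)) w) ∂tapeLaw +
          ENNReal.ofReal err) +
          tapeLaw {ω | ¬ (queryRun A n w ω).queries ≤ q} * ENNReal.ofReal F := by
          rw [lintegral_add_right _ (hind.mul_const _), lintegral_add_right _ measurable_const,
            lintegral_const, measure_univ, mul_one, lintegral_mul_const _ hind,
            lintegral_indicator_one hfail]
      _ ≤ (ENNReal.ofReal (α * (opt D + err)) + ENNReal.ofReal err) +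
          ENNReal.ofReal (ζ / (m : ℝ) ^ 4) * ENNReal.ofReal F := by
          have hpc : ProbConstraint w := probConstraint_clipMatrix M
          gcongr
          · refine (happ n m hn hm w hpc).trans (ENNReal.ofReal_le_ofReal ?_)
            refine mul_le_mul_of_nonneg_left ?_ hα.le
            rw [opt_eq_weightedOpt, herr, weightDist_comm]
            exact weightedOpt_le_add_weightDist _ _
          · exact tapeLaw_manyQueries_le hA hn hm M hz (hfew w hpc)
      _ = _ := by
          rw [← ENNReal.ofReal_mul hz0, ← ENNReal.ofReal_add (by positivity) herr0,
            ← ENNReal.ofReal_add (by positivity) (by positivity),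
            ← ENNReal.ofReal_mul (by positivity),
            ← ENNReal.ofReal_add (by positivity) (by positivity)]
          congr 1
          ring
  have hmeas := hkem.comp (measurable_privateResult hA hn hm D hQ)
  have hsplit := lintegral_tapeParts hmeas
  simp only [Function.comp_def] at hsplit
  rw [hsplit]
  refine (lintegral_mono hω₀).trans ?_
  rw [lintegral_add_left measurable_const, lintegral_const, measure_univ, mul_one,
    lintegral_const_mul' _ _ ENNReal.ofReal_ne_top]
  refine (add_le_add_right (mul_le_mul_right (lintegral_weightDist_le hn D hM he) _) _).trans ?_
  rw [← ENNReal.ofReal_mul (by positivity), ← ENNReal.ofReal_add (by positivity) (by positivity)]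
  refine ENNReal.ofReal_le_ofReal ?_
  -- The failure probability cancels the factor `m⁴` in the noise term and more than cancels the
  -- factor `m²` of the optimum.
  have h1 : ζ / (m : ℝ) ^ 4 * F = ζ * opt D / (m : ℝ) ^ 2 + 2 * ζ * (1 / (ε * n)) := by
    rw [hF]
    field_simp
  have h2 : ζ * opt D / (m : ℝ) ^ 2 ≤ ζ * opt D :=
    div_le_self (mul_nonneg hζ.1 hopt) (one_le_pow₀ hm')
  have h3 : 2 * ζ * (1 / (ε * n)) ≤ 2 * (1 / (ε * n)) :=
    mul_le_mul_of_nonneg_right (by linarith [hζ.2]) (by positivity)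
  have h4 : 0 ≤ (m : ℝ) ^ 2 * e := by positivity
  have h5 : 0 ≤ (α + 1) * (1 / (ε * n)) := by positivity
  rw [h1]
  linarith

end RankAgg

/-! ### The theorem -/

theorem mainTheorem7 (α : ℝ) (hα : 0 < α) :
    ∃ C : ℝ, 0 < C ∧
      ∀ (q : ℕ → ℕ → ℕ) (ε δ ζ e : ℕ → ℕ → ℝ),
        (∀ n m, 0 < ε n m) → (∀ n m, 0 < e n m) →
        (∀ n m, δ n m ∈ Set.Icc (0 : ℝ) 1) → (∀ n m, ζ n m ∈ Set.Icc (0 : ℝ) 1) →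
        ∀ A Q : RankAgg.Program,
          RankAgg.PolyTimeQueryRanking A →
          RankAgg.QueryApproximation A α →
          RankAgg.FewQueries A q ζ →
          RankAgg.PolyTimeOnData Q q ε δ →
          RankAgg.ExpectedError Q q ε δ e →
          RankAgg.QueryDP Q q ε δ (fun n m => ε n m / 2) →
          ∃ B : RankAgg.Program,
            RankAgg.PolyTimeOnData B q ε δ ∧
            RankAgg.OutputsRanking B q ε δ ∧
            RankAgg.CentralDP B q ε δ ∧
            RankAgg.DataApproximation B q ε δ (fun n m => α + ζ n m)
              (fun n m => C * ((m : ℝ) ^ 2 * e n m + 1 / (ε n m * n))) := by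
  -- The error of the answers needs `α + 1` and the noise of the fallback needs `2`; the sum covers
  -- both.
  refine ⟨α + 3, by positivity, fun q ε δ ζ e hε he hδ hζ A Q hA happ hfew hQ herr hdp =>
    ⟨RankAgg.Program.privateRanking A Q, ?_⟩⟩
  have hhalt : ∀ n m, 1 ≤ n → 1 ≤ m → ∀ (D : RankAgg.Dataset n m) ω, ∃ s',
      Q.HaltsIn (RankAgg.dataEnv ω) (RankAgg.dataInput D (q n m) (ε n m) (δ n m)) s' := by
    obtain ⟨T, hT⟩ := hQ
    intro n m hn hm D ω
    obtain ⟨s', h, -⟩ := hT n m hn hm D ω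
    exact ⟨s', h⟩
  have hruns : ∃ T : Polynomial ℕ, ∀ n m, 1 ≤ n → 1 ≤ m → ∀ (D : RankAgg.Dataset n m) ω,
      ∃ s', (RankAgg.Program.privateRanking A Q).HaltsIn (RankAgg.dataEnv ω)
        (RankAgg.dataInput D (q n m) (ε n m) (δ n m)) s' ∧ s'.steps ≤ T.eval (n + m) ∧
        RankAgg.HoldsRanking s' (RankAgg.privateResult A Q D (q n m) (ε n m) (δ n m)
          (ω.part 0) (ω.part 1) (ω.part 2)) := by
    obtain ⟨TQ, hTQ⟩ := hQ
    obtain ⟨TA, hTA⟩ := hA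
    -- The overhead of the program is `3 n m + 4 m² + 15 m + 11`, and the two simulations are slowed
    -- down by a factor of at most `7`.
    refine ⟨7 * Polynomial.X ^ 2 + 15 * Polynomial.X + 11 + 7 * TQ + 7 * TA,
      fun n m hn hm D ω => ?_⟩
    obtain ⟨sQ, hsQ, hstQ⟩ := hTQ n m hn hm D (ω.part 0)
    obtain ⟨sA, hsA, hstA, hσ⟩ := hTA n m hn hm _ (RankAgg.probConstraint_clipMatrix
      (RankAgg.answerMatrix Q D (q n m) (ε n m) (δ n m) (ω.part 0))) (ω.part 1)
    obtain ⟨s', h1, h2, h3⟩ := RankAgg.Program.privateRanking_runs D _ _ _ ω hsQ hsA hσ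
    refine ⟨s', h1, h3.trans ?_, h2⟩
    have hd : (RankAgg.dataInput D (q n m) (ε n m) (δ n m)).steps = 0 := rfl
    simp only [Polynomial.eval_add, Polynomial.eval_mul, Polynomial.eval_pow, Polynomial.eval_X,
      Polynomial.eval_ofNat, hd]
    nlinarith
  have hres : ∀ n m, 1 ≤ n → 1 ≤ m → ∀ (D : RankAgg.Dataset n m) ω,
      RankAgg.HoldsRanking (RankAgg.dataRun (RankAgg.Program.privateRanking A Q) D (q n m) (ε n m)
        (δ n m) ω) (RankAgg.privateResult A Q D (q n m) (ε n m) (δ n m)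
          (ω.part 0) (ω.part 1) (ω.part 2)) := by
    obtain ⟨T, hT⟩ := hruns
    intro n m hn hm D ω
    obtain ⟨s', h1, -, h3⟩ := hT n m hn hm D ω
    rw [RankAgg.dataRun, h1.final_eq]
    exact h3
  have hrank : ∀ n m, 1 ≤ n → 1 ≤ m → ∀ (D : RankAgg.Dataset n m) ω,
      RankAgg.dataRanking (RankAgg.Program.privateRanking A Q) D (q n m) (ε n m) (δ n m) ω =
        RankAgg.privateResult A Q D (q n m) (ε n m) (δ n m) (ω.part 0) (ω.part 1) (ω.part 2) :=
    fun n m hn hm D ω => (hres n m hn hm D ω).outRanking_eq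
  refine ⟨?_, fun n m hn hm D ω => ⟨_, hres n m hn hm D ω⟩, fun n m hn hm D D' hD V => ?_,
    fun n m hn hm D => ?_⟩
  · obtain ⟨T, hT⟩ := hruns
    refine ⟨T, fun n m hn hm D ω => ?_⟩
    obtain ⟨s', h1, h2, -⟩ := hT n m hn hm D ω
    exact ⟨s', h1, h2⟩
  · simp only [hrank n m hn hm]
    exact RankAgg.privateResult_private hA hn hm (hε n m) (fun D => hhalt n m hn hm D) hD
      (fun S U hU => hdp n m hn hm S D D' hD U hU) V
  · simp only [hrank n m hn hm]
    exact RankAgg.privateResult_approx hα hA happ hn hm (hε n m) (he n m) (hζ n m)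
      (fun w hw => hfew n m hn hm w hw) D (hhalt n m hn hm D)
      (fun i j hij => herr n m hn hm D i j hij)
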